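/- Let $G=(\mathrm{SL}(2,\mathbb C)\times \mathrm{SL}(2,\mathbb C))\rtimes \mathbb Z/2$, where $\mathbb Z/2$ interchanges the two factors $G^0=\mathrm{SL}(2,\mathbb C)\times\mathrm{SL}(2,\mathbb C)$, act on $V=H^0(\mathbb P^1\times\mathbb P^1,\mathcal O(3,3))$, the space of forms of bidegree $(3,3)$ in $(x_0,x_1;y_0,y_1)$, by linear changes of the coordinates $x$ and $y$ and interchange of $x$ with $y$, and on $X=\mathbb P(V)\cong\mathbb P^{15}$. Let $X^{ss}\subset X$ be the semistable locus of this linearised action. A point of $X^{ss}$ is strictly polystable if its $G$-orbit is closed in $X^{ss}$ and its stabiliser in $G$ is infinite. For a subgroup $R\subset G$ let $Z_R\subset X$ be the set of points fixed by $R$ and $Z_R^{ss}=Z_R\cap X^{ss}$. Let $\mathcal R$ be a set of representatives for the $G$-conjugacy classes of the identity components of the stabilisers of strictly polystable points. Then one can take $\mathcal R=\{R_C,R_D,R_A\}$, three pairwise non-conjugate groups, each of which is the identity component of the stabiliser of some strictly polystable point, where: (i) $R_C\cong \mathrm{SL}(2,\mathbb C)$ is $\mathrm{SL}(2,\mathbb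 C)$ diagonally embedded in $G^0$, and $Z_{R_C}=Z_{R_C}^{ss}=\{3C\}$ is the triple conic $3C=\{(x_0y_1-x_1y_0)^3=0\}$; (ii) $R_D=\{(\mathrm{diag}(t,t^{-1}),\mathrm{diag}(t,t^{-1}),1):t\in\mathbb C^*\}\cong\mathbb C^*$, and $Z_{R_D}^{ss}=\mathbb P\{ax_0^3y_1^3+bx_0^2x_1y_0y_1^2+cx_0x_1^2y_0^2y_1+dx_1^3y_0^3\}\smallsetminus(\{a=b=0\}\cup\{c=d=0\})$, a $\mathbb P^3$ minus two lines (the locus of D-curves); (iii) $R_A=\{(\mathrm{diag}(t,t^{-1}),\mathrm{diag}(t^3,t^{-3}),1):t\in\mathbb C^*\}\cong\mathbb C^*$, and $Z_{R_A}^{ss}=\mathbb P\{ax_0^3y_0y_1^2+bx_1^3y_0^2y_1\}\smallsetminus(\{a=0\}\cup\{b=0\})$, a $\mathbb P^1$ minus two points (the locus of A-curves). Moreover $$R_D\subsetneq R_C,\qquad R_A\cap R_C=\{(I,I,1),(-I,-I,1)\},$$ $$G\cdot Z_{R_C}^{ss}\subsetneq G\cdot Z_{R_D}^{ss},\qquad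 G\cdot Z_{R_A}^{ss}\cap G\cdot Z_{R_D}^{ss}=\varnothing .$$ Finally, let $R$ be the identity component of the stabiliser of any strictly polystable point. Then $R$ has a maximal torus, and for every maximal torus $T_R$ of $R$ there is $g\in G$ such that either $gT_Rg^{-1}=R_D$ and $Z_{gRg^{-1}}^{ss}$ is contained in the $\mathbb P^3$ spanned by $x_0^3y_1^3,\ x_0^2x_1y_0y_1^2,\ x_0x_1^2y_0^2y_1,\ x_1^3y_0^3$, or $gT_Rg^{-1}=R_A$ and $Z_{gRg^{-1}}^{ss}$ is contained in the $\mathbb P^1$ spanned by $x_0^3y_0y_1^2,\ x_1^3y_0^2y_1$. -/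

import Mathlib

open MvPolynomial Matrix
open scoped LinearAlgebra.Projectivization MatrixGroups

namespace BidegreeThree

noncomputable section

/-! ### The group `G = (SL₂ × SL₂) ⋊ ℤ/2` -/

/-- `G⁰ = SL(2, ℂ) × SL(2, ℂ)`. -/
abbrev G0 : Type := SL(2, ℂ) × SL(2, ℂ)

/-- The homomorphism from `ℤ/2` determined by an element whose square is `1`. -/
def involutionHom {H : Type*} [Group H] (s : H) (hs : s * s = 1) :
    Multiplicative (ZMod 2) →* H :=
  MonoidHom.mk' (fun e => if e = 1 then 1 else s) (by
    have key : ∀ a b : Multiplicative (ZMod 2),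
        (a = 1 ∧ a * b = b) ∨ (b = 1 ∧ a * b = a) ∨ (a ≠ 1 ∧ b ≠ 1 ∧ a * b = 1) := by decide
    intro a b
    rcases key a b with ⟨h1, h2⟩ | ⟨h1, h2⟩ | ⟨h1, h2, h3⟩
    · simp [h1]
    · simp [h1]
    · simp [h1, h2, h3, hs])

/-- `ℤ/2` acts on `G⁰` by interchanging the two factors. -/
def swapAut : Multiplicative (ZMod 2) →* MulAut G0 :=
  involutionHom (MulEquiv.prodComm : SL(2, ℂ) × SL(2, ℂ) ≃* SL(2, ℂ) × SL(2, ℂ)) (by ext <;> rfl)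

/-- `G = (SL(2, ℂ) × SL(2, ℂ)) ⋊ ℤ/2`. -/
abbrev G : Type := G0 ⋊[swapAut] Multiplicative (ZMod 2)

/-- Index set of the coordinates: `Sum.inl i` stands for `x_i`, `Sum.inr i` for `y_i`. -/
abbrev Idx : Type := Fin 2 ⊕ Fin 2

/-- `(A, B)` acting on the points `(x, y)` of `ℂ² × ℂ²` by `(A x, B y)`. -/
def blockHom : G0 →* GL Idx ℂ where
  toFun A :=
    ⟨fromBlocks A.1.1 0 0 A.2.1, fromBlocks (A.1⁻¹).1 0 0 (A.2⁻¹).1,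
      by
        rw [fromBlocks_multiply]
        simp [Matrix.mul_adjugate],
      by
        rw [fromBlocks_multiply]
        simp [Matrix.adjugate_mul]⟩
  map_one' := by
    apply Units.ext
    simp
  map_mul' A B := by
    apply Units.ext
    simp [fromBlocks_multiply]

/-- The interchange `(x, y) ↦ (y, x)`. -/
def swapGL : GL Idx ℂ :=
  ⟨fromBlocks 0 1 1 0, fromBlocks 0 1 1 0, by simp [fromBlocks_multiply],
    by simp [fromBlocks_multiply]⟩

theorem swapGL_mul_self : swapGL * swapGL = 1 := by
  apply Units.ext
  simp [swapGL, fromBlocks_multiply]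

/-- The linear action of `G` on the space `ℂ² × ℂ²` of pairs `(x, y)`: the factors of `G⁰` act on
`x` and `y`, and the generator of `ℤ/2` interchanges `x` and `y`. This is a faithful
representation. -/
def toGL : G →* GL Idx ℂ :=
  SemidirectProduct.lift blockHom (involutionHom swapGL swapGL_mul_self) (by
    intro e
    apply MonoidHom.ext
    intro A
    by_cases he : e = 1
    · subst he
      simp
    · apply Units.ext
      have hinv : swapGL⁻¹ = swapGL := inv_eq_of_mul_eq_one_left swapGL_mul_self
      simp [swapAut, involutionHom, he, hinv]
      simp [swapGL, blockHom, fromBlocks_multiply])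

/-- The classical topology of the complex Lie group `G`. -/
instance : TopologicalSpace G := TopologicalSpace.induced toGL inferInstance

instance : IsTopologicalGroup G := topologicalGroup_induced toGL

/-! ### Forms of bidegree `(3, 3)` and the action of `G` on them -/

/-- The linear substitution `F ↦ F ∘ M`. -/
def linSubst (M : Matrix Idx Idx ℂ) : MvPolynomial Idx ℂ →ₐ[ℂ] MvPolynomial Idx ℂ :=
  aeval fun i => ∑ j, C (M i j) * X j

theorem linSubst_mul (M N : Matrix Idx Idx ℂ) (F : MvPolynomial Idx ℂ) :
    linSubst (M * N) F = linSubst N (linSubst M F) := by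
  have : linSubst (M * N) = (linSubst N).comp (linSubst M) := by
    apply MvPolynomial.algHom_ext
    intro i
    simp only [linSubst, aeval_X, AlgHom.comp_apply, map_sum, map_mul, algHom_C, algebraMap_eq,
      Finset.mul_sum, Matrix.mul_apply, Finset.sum_mul]
    rw [Finset.sum_comm]
    simp [mul_assoc]
  rw [this]
  rfl

theorem linSubst_one (F : MvPolynomial Idx ℂ) : linSubst 1 F = F := by
  have : linSubst 1 = AlgHom.id ℂ _ := by
    apply MvPolynomial.algHom_ext
    intro i
    simp [linSubst, Matrix.one_apply, apply_ite]
  rw [this]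
  rfl

/-- The bidegree: `x_0, x_1` have degree `(1, 0)` and `y_0, y_1` have degree `(0, 1)`. -/
def bideg : Idx → ℕ × ℕ := Sum.elim (fun _ => (1, 0)) (fun _ => (0, 1))

/-- `V = H⁰(ℙ¹ × ℙ¹, 𝒪(3, 3))`, the space of forms of bidegree `(3, 3)`
in `x_0, x_1; y_0, y_1`. -/
abbrev V : Type := weightedHomogeneousSubmodule ℂ bideg (3, 3)

theorem isWeightedHomogeneous_aeval {w w' : Idx → ℕ × ℕ} {m : ℕ × ℕ}
    {f : Idx → MvPolynomial Idx ℂ} (hf : ∀ i, IsWeightedHomogeneous w (f i) (w' i))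
    {F : MvPolynomial Idx ℂ} (hF : IsWeightedHomogeneous w' F m) :
    IsWeightedHomogeneous w (aeval f F) m := by
  rw [aeval_def, eval₂_eq']
  apply IsWeightedHomogeneous.sum
  intro d hd
  have h1 : Finsupp.weight w' d = m := hF (mem_support_iff.1 hd)
  have h2 := (isWeightedHomogeneous_C w (coeff d F)).mul
    (IsWeightedHomogeneous.prod Finset.univ (fun i => f i ^ d i) (fun i => d i • w' i)
      (fun i _ => (hf i).pow (d i)))
  have h3 : 0 + ∑ i, d i • w' i = m := by
    rw [← h1, Finsupp.weight_apply, Finsupp.sum_fintype _ _ (by simp), zero_add]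
  rw [h3] at h2
  exact h2

theorem linSubst_block_mem (A : G0) {F : MvPolynomial Idx ℂ}
    (hF : IsWeightedHomogeneous bideg F (3, 3)) :
    IsWeightedHomogeneous bideg (linSubst (blockHom A : Matrix Idx Idx ℂ) F) (3, 3) := by
  refine isWeightedHomogeneous_aeval (w' := bideg) ?_ hF
  intro i
  apply IsWeightedHomogeneous.sum
  intro j _
  have h := (isWeightedHomogeneous_C bideg ((blockHom A : Matrix Idx Idx ℂ) i j)).mul
    (isWeightedHomogeneous_X ℂ bideg j)
  rw [zero_add] at h
  rcases i with i | i <;> rcases j with j | j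
  · exact h
  · simpa [blockHom] using isWeightedHomogeneous_zero ℂ bideg (bideg (Sum.inl i))
  · simpa [blockHom] using isWeightedHomogeneous_zero ℂ bideg (bideg (Sum.inr i))
  · exact h

theorem linSubst_swap_mem {F : MvPolynomial Idx ℂ}
    (hF : IsWeightedHomogeneous bideg F (3, 3)) :
    IsWeightedHomogeneous bideg (linSubst (swapGL : Matrix Idx Idx ℂ) F) (3, 3) := by
  have hF' : IsWeightedHomogeneous (fun i => (bideg i).swap) F (3, 3) := by
    intro d hd
    have h := hF hd
    rw [Finsupp.weight_apply, Finsupp.sum_fintype _ _ (by simp)] at h ⊢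
    have h' := congrArg Prod.swap h
    simp [bideg] at h' ⊢
    exact h'
  refine isWeightedHomogeneous_aeval (w' := fun i => (bideg i).swap) ?_ hF'
  intro i
  apply IsWeightedHomogeneous.sum
  intro j _
  have h := (isWeightedHomogeneous_C bideg ((swapGL : Matrix Idx Idx ℂ) i j)).mul
    (isWeightedHomogeneous_X ℂ bideg j)
  rw [zero_add] at h
  rcases i with i | i <;> rcases j with j | j
  · simpa [swapGL] using isWeightedHomogeneous_zero ℂ bideg _
  · exact h
  · exact h
  · simpa [swapGL] using isWeightedHomogeneous_zero ℂ bideg _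

theorem linSubst_toGL_mem (g : G) {F : MvPolynomial Idx ℂ}
    (hF : IsWeightedHomogeneous bideg F (3, 3)) :
    IsWeightedHomogeneous bideg (linSubst (toGL g : Matrix Idx Idx ℂ) F) (3, 3) := by
  have hg : toGL g = blockHom g.left * involutionHom swapGL swapGL_mul_self g.right := rfl
  rw [hg, Units.val_mul, linSubst_mul]
  by_cases he : g.right = 1
  · simpa [he, linSubst_one] using linSubst_block_mem g.left hF
  · simpa [involutionHom, he] using linSubst_swap_mem (linSubst_block_mem g.left hF)

/-- `G` acts on forms by `g • F = F ∘ g⁻¹`, so that the curve of `g • F` is the image under `g` of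
the curve of `F`. -/
instance : DistribMulAction G V where
  smul g F := ⟨linSubst (toGL g⁻¹ : Matrix Idx Idx ℂ) F.1, linSubst_toGL_mem g⁻¹ F.2⟩
  one_smul F := by
    apply Subtype.ext
    change linSubst (toGL (1 : G)⁻¹ : Matrix Idx Idx ℂ) F.1 = F.1
    rw [inv_one, map_one, Units.val_one, linSubst_one]
  mul_smul g h F := by
    apply Subtype.ext
    change linSubst (toGL (g * h)⁻¹ : Matrix Idx Idx ℂ) F.1 =
      linSubst (toGL g⁻¹ : Matrix Idx Idx ℂ) (linSubst (toGL h⁻¹ : Matrix Idx Idx ℂ) F.1)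
    rw [_root_.mul_inv_rev, map_mul, Units.val_mul, linSubst_mul]
  smul_zero g := Subtype.ext (map_zero (linSubst (toGL g⁻¹ : Matrix Idx Idx ℂ)))
  smul_add g E F := Subtype.ext (map_add (linSubst (toGL g⁻¹ : Matrix Idx Idx ℂ)) E.1 F.1)

instance : SMulCommClass G ℂ V where
  smul_comm g c F := Subtype.ext (map_smul (linSubst (toGL g⁻¹ : Matrix Idx Idx ℂ)) c F.1)

/-- The topology of `V` given by the coefficients of a form. -/
instance : TopologicalSpace V :=
  TopologicalSpace.induced (fun F (m : Idx →₀ ℕ) => coeff m F.1) Pi.topologicalSpace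

/-- The linear system `X = ℙ H⁰(ℙ¹ × ℙ¹, 𝒪(3, 3))`, with the action of `G` induced from `V`. -/
abbrev XX : Type := ℙ ℂ V

/-- The classical topology of `X`: the quotient topology from `V ∖ {0}`. -/
instance : TopologicalSpace XX :=
  TopologicalSpace.coinduced (fun v : { v : V // v ≠ 0 } => Projectivization.mk ℂ v.1 v.2)
    inferInstance

/-! ### Geometric invariant theory -/

/-- The value at `F` of a polynomial function on `V`, that is, of a polynomial `f` in the
coefficients of `F`. -/
def evalForm (f : MvPolynomial (Idx →₀ ℕ) ℂ) (F : V) : ℂ := eval (fun m => coeff m F.1) f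

/-- The semistable locus `X^ss` of the linearised action on `X`: some `G`-invariant homogeneous
polynomial function on `V` of positive degree does not vanish at the point. -/
def semistable : Set XX :=
  {x | ∃ d : ℕ, 0 < d ∧ ∃ f : MvPolynomial (Idx →₀ ℕ) ℂ, f.IsHomogeneous d ∧
    (∀ (g : G) (F : V), evalForm f (g • F) = evalForm f F) ∧ evalForm f x.rep ≠ 0}

/-- Strictly polystable points: semistable points whose orbit is closed in `X^ss` and whose
stabiliser is infinite. -/
def IsStrictlyPolystable (x : XX) : Prop :=
  x ∈ semistable ∧
  IsClosed {y : semistable | (y : XX) ∈ MulAction.orbit G x} ∧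
  Infinite (MulAction.stabilizer G x)

/-- The connected component of the identity of a subgroup of `G`. -/
def identityComponent (H : Subgroup G) : Subgroup G :=
  (Subgroup.connectedComponentOfOne H).map H.subtype

/-- The conjugate `g H g⁻¹`. -/
def conjSubgroup (g : G) (H : Subgroup G) : Subgroup G := H.map (MulAut.conj g).toMonoidHom

/-- The family of the identity components of the stabilisers of the strictly polystable points. -/
def polystableStabilisers : Set (Subgroup G) :=
  {R | ∃ x : XX, IsStrictlyPolystable x ∧ R = identityComponent (MulAction.stabilizer G x)}

/-- `S` is a set of representatives for the conjugacy classes of identity components of stabilisers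
of strictly polystable points: it consists of such subgroups, and every such subgroup is conjugate
in `G` to exactly one member of `S`. -/
def IsIndexingSet (S : Set (Subgroup G)) : Prop :=
  S ⊆ polystableStabilisers ∧
  ∀ R ∈ polystableStabilisers, ∃! R', R' ∈ S ∧ ∃ g : G, conjSubgroup g R = R'

/-- The fixed locus `Z_R` of `R` in `X`. -/
def fixedLocus (R : Subgroup G) : Set XX := {x | ∀ r ∈ R, r • x = x}

/-- The semistable fixed locus `Z_R^ss`. -/
def ssFixedLocus (R : Subgroup G) : Set XX := {x | x ∈ semistable ∧ ∀ r ∈ R, r • x = x}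

/-- The union `G · Z` of the orbits of the points of `Z`. -/
def saturation (Z : Set XX) : Set XX := {x | ∃ g : G, ∃ z ∈ Z, x = g • z}

/-- `S` is an algebraic torus: the image of an injective homomorphism `(ℂˣ)ⁿ → G` of algebraic
groups, i.e. one whose matrix entries are Laurent polynomials in the coordinates of `(ℂˣ)ⁿ`. -/
def IsTorus (S : Subgroup G) : Prop :=
  ∃ (n : ℕ) (φ : (Fin n → ℂˣ) →* G), Function.Injective φ ∧ φ.range = S ∧
    ∀ i j : Idx, ∃ p : MvPolynomial (Fin n ⊕ Fin n) ℂ, ∀ t : Fin n → ℂˣ,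
      (toGL (φ t) : Matrix Idx Idx ℂ) i j =
        eval (Sum.elim (fun k => (t k : ℂ)) (fun k => ((t k)⁻¹ : ℂ))) p

/-- `S` is a maximal torus of `R`. -/
def IsMaximalTorus (R S : Subgroup G) : Prop :=
  Maximal (fun S' : Subgroup G => IsTorus S' ∧ S' ≤ R) S

/-! ### The three subgroups -/

/-- `diag(t, t⁻¹)`. -/
def diagSL : ℂˣ →* SL(2, ℂ) where
  toFun t := ⟨!![(t : ℂ), 0; 0, ((t⁻¹ : ℂˣ) : ℂ)], by simp [det_fin_two]⟩
  map_one' := by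
    ext i j
    fin_cases i <;> fin_cases j <;> simp
  map_mul' s t := by
    apply Subtype.ext
    change _ = !![(s : ℂ), 0; 0, ((s⁻¹ : ℂˣ) : ℂ)] * !![(t : ℂ), 0; 0, ((t⁻¹ : ℂˣ) : ℂ)]
    simp [mul_comm]

/-- `A ↦ (A, A, 1)`. -/
def diagonalHom : SL(2, ℂ) →* G :=
  SemidirectProduct.inl.comp ((MonoidHom.id SL(2, ℂ)).prod (MonoidHom.id SL(2, ℂ)))

/-- `t ↦ (diag(t, t⁻¹), diag(tᵏ, t⁻ᵏ), 1)`. -/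
def torusHom (k : ℕ) : ℂˣ →* G :=
  SemidirectProduct.inl.comp (diagSL.prod (diagSL.comp (powMonoidHom k)))

/-- `R_C`, the group `SL(2, ℂ)` diagonally embedded in `G⁰`. -/
def RC : Subgroup G := diagonalHom.range

/-- `R_D = {(diag(t, t⁻¹), diag(t, t⁻¹), 1)}`. -/
def RD : Subgroup G := (torusHom 1).range

/-- `R_A = {(diag(t, t⁻¹), diag(t³, t⁻³), 1)}`. -/
def RA : Subgroup G := (torusHom 3).range

/-! ### The three loci -/

/-- The variables `x_0, x_1`. -/
def xVar (i : Fin 2) : MvPolynomial Idx ℂ := X (Sum.inl i)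

/-- The variables `y_0, y_1`. -/
def yVar (i : Fin 2) : MvPolynomial Idx ℂ := X (Sum.inr i)

/-- The points of `X` that are represented by a (nonzero) form in the set `S`. -/
def projLocus (S : Set (MvPolynomial Idx ℂ)) : Set XX :=
  {p | ∃ (F : V) (hF : F ≠ 0), F.1 ∈ S ∧ p = Projectivization.mk ℂ F hF}

theorem isWeightedHomogeneous_x (i : Fin 2) : IsWeightedHomogeneous bideg (xVar i) (1, 0) :=
  isWeightedHomogeneous_X ℂ bideg (Sum.inl i)

theorem isWeightedHomogeneous_y (i : Fin 2) : IsWeightedHomogeneous bideg (yVar i) (0, 1) :=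
  isWeightedHomogeneous_X ℂ bideg (Sum.inr i)

/-- The form `(x_0 y_1 - x_1 y_0)³`. -/
def tripleConicForm : V :=
  ⟨(xVar 0 * yVar 1 - xVar 1 * yVar 0) ^ 3,
    (((isWeightedHomogeneous_x 0).mul (isWeightedHomogeneous_y 1)).sub
      ((isWeightedHomogeneous_x 1).mul (isWeightedHomogeneous_y 0))).pow 3⟩

theorem tripleConicForm_ne_zero : tripleConicForm ≠ 0 := by
  intro h
  have h1 : (xVar 0 * yVar 1 - xVar 1 * yVar 0) ^ 3 = (0 : MvPolynomial Idx ℂ) :=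
    congrArg Subtype.val h
  have h2 := congrArg (eval (Sum.elim ![1, 0] ![0, 1])) h1
  simp [xVar, yVar] at h2

/-- The triple conic `3C = {(x_0 y_1 - x_1 y_0)³ = 0}`. -/
def tripleConic : XX := Projectivization.mk ℂ tripleConicForm tripleConicForm_ne_zero

/-- The four monomials `x_0³y_1³, x_0²x_1y_0y_1², x_0x_1²y_0²y_1, x_1³y_0³`. -/
def monD : Fin 4 → MvPolynomial Idx ℂ :=
  ![xVar 0 ^ 3 * yVar 1 ^ 3, xVar 0 ^ 2 * xVar 1 * yVar 0 * yVar 1 ^ 2,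
    xVar 0 * xVar 1 ^ 2 * yVar 0 ^ 2 * yVar 1, xVar 1 ^ 3 * yVar 0 ^ 3]

/-- The two monomials `x_0³y_0y_1², x_1³y_0²y_1`. -/
def monA : Fin 2 → MvPolynomial Idx ℂ :=
  ![xVar 0 ^ 3 * yVar 0 * yVar 1 ^ 2, xVar 1 ^ 3 * yVar 0 ^ 2 * yVar 1]

/-- The `ℙ³ ⊂ X` spanned by the four monomials `monD`. -/
def spaceD : Set XX := projLocus (Submodule.span ℂ (Set.range monD))

/-- The `ℙ¹ ⊂ X` spanned by the two monomials `monA`. -/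
def spaceA : Set XX := projLocus (Submodule.span ℂ (Set.range monA))

/-- The locus of D-curves: the `ℙ³` with coordinates `(a : b : c : d)` minus the two lines
`a = b = 0` and `c = d = 0`. -/
def curvesD : Set XX :=
  spaceD \
    (projLocus {F | ∃ c d : ℂ, F = C c * monD 2 + C d * monD 3} ∪
      projLocus {F | ∃ a b : ℂ, F = C a * monD 0 + C b * monD 1})

/-- The locus of A-curves: the `ℙ¹` with coordinates `(a : b)` minus the two points
`a = 0` and `b = 0`. -/
def curvesA : Set XX :=
  spaceA \
    (projLocus {F | ∃ b : ℂ, F = C b * monA 1} ∪ projLocus {F | ∃ a : ℂ, F = C a * monA 0})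

end

end BidegreeThree

open BidegreeThree

/-!
Semistability is detected by three explicit invariants. A form of bidegree `(3, 3)` has a matrix of
coefficients, of size `4 × 4`. Its determinant, a quadratic polynomial and a further quartic
polynomial in its entries are invariant under unipotent elements and under transposition, which
generate `G`. A form at which one of them does not vanish is semistable
(`isSemistableForm_of_quadInv`, `isSemistableForm_of_det`, `isSemistableForm_of_quartInv`).
Conversely a form all of whose monomials have positive weight for a diagonal one-parameter subgroup
is unstable (`not_isSemistableForm_of_wt_pos`). Together the two criteria give the semistable fixed
loci of the three groups.

An orbit is shown to be closed by enclosing it in the image of a compact family of forms whose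
semistable members all lie in that orbit (`isClosed_orbit_of_family`): the cubes `P³` of forms of
bidegree `(1, 1)` for the triple conic, the products `P² Q` with `P`, `Q` orthogonal for the
polarised determinant for one D-curve, and the products of two linear forms in `y` and a form of
bidegree `(3, 1)` that restricts to cubes at their zeros for an A-curve. The identity component of
the stabiliser of each of these points is one of the three groups: the stabiliser of the triple
conic is computed directly, and the other stabilisers consist of monomial matrices, as they
normalise a torus, and contain that torus with finite index.

For the converse, let the stabiliser of a point be infinite. Being an algebraic set of matrices it
has a nonzero tangent vector (`exists_tangent_of_infinite`), so the form is an eigenvector of a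
nonzero element `(ξ, η)` of the Lie algebra `sl₂ × sl₂` (`exists_isInfStab_of_infinite`). After
conjugation both components are diagonal or nilpotent. If both are diagonal, the monomials of the
form lie on a line, and only the lines of the D-curves and of the A-curves give semistable forms. If
both are nilpotent and nonzero, a torus contracts the form to a D-curve. All other cases lead to
unstable forms. As the orbit is closed in the semistable locus, it contains a D-curve or an A-curve
(`IsStrictlyPolystable.meetsCurves`), whose stabilisers are known.

The three groups are not conjugate: one of them is not commutative, and the elements of one of the
other two have equal traces in the two factors. A torus inside the diagonal `SL(2, ℂ)` is
diagonalised by means of an element of order three, so that it is conjugate to a subgroup of `RD`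
(`exists_conjSubgroup_le_RD`).
-/

namespace BidegreeThree

noncomputable section

/-! ### Tangent vectors to infinite algebraic sets -/

/-- The point `p + ε η` with coordinates in the dual numbers. -/
def dualPoint {σ : Type*} (p η : σ → ℂ) : σ → DualNumber ℂ :=
  fun i => TrivSqZeroExt.inl (p i) + TrivSqZeroExt.inr (η i)

theorem fst_aeval_dualPoint {σ : Type*} (p η : σ → ℂ) (f : MvPolynomial σ ℂ) :
    (aeval (dualPoint p η) f).fst = eval p f := by
  induction f using MvPolynomial.induction_on with
  | C a => simp [TrivSqZeroExt.algebraMap_eq_inl]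
  | add f g hf hg => simp [hf, hg]
  | mul_X f i hf => simp [hf, dualPoint]

theorem snd_aeval_dualPoint {σ : Type*} [Fintype σ] (p η : σ → ℂ) (f : MvPolynomial σ ℂ) :
    (aeval (dualPoint p η) f).snd = ∑ i, η i * eval p (pderiv i f) := by
  classical
  induction f using MvPolynomial.induction_on with
  | C a => simp [TrivSqZeroExt.algebraMap_eq_inl]
  | add f g hf hg => simp [hf, hg, mul_add, Finset.sum_add_distrib]
  | mul_X f j hf =>
    have h1 : (aeval (dualPoint p η) (f * X j)).snd =
        eval p f * η j + (∑ i, η i * eval p (pderiv i f)) * p j := by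
      rw [map_mul, DualNumber.snd_mul, hf, fst_aeval_dualPoint]
      simp [dualPoint]
    rw [h1]
    simp only [Derivation.leibniz, smul_eq_mul, map_add, map_mul, eval_X, pderiv_X, mul_add,
      Finset.sum_add_distrib]
    congr 1
    · rw [Finset.sum_eq_single j]
      · simp; ring
      · intro b _ hb
        simp [hb.symm]
      · simp
    · rw [Finset.sum_mul]
      exact Finset.sum_congr rfl fun i _ => by ring

/-- First order Taylor expansion at a point, modulo the square of its maximal ideal. -/
theorem taylor_mem_sq {σ : Type*} [Fintype σ] (p : σ → ℂ) (f : MvPolynomial σ ℂ) :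
    f - C (eval p f) - ∑ i, C (eval p (pderiv i f)) * (X i - C (p i)) ∈
      (RingHom.ker (eval p)) ^ 2 := by
  classical
  have hX : ∀ i, X i - C (p i) ∈ RingHom.ker (eval p) := fun i => by simp [RingHom.mem_ker]
  induction f using MvPolynomial.induction_on with
  | C a => simp
  | add f g hf hg =>
    have := Ideal.add_mem _ hf hg
    convert this using 1
    simp only [map_add, add_mul, Finset.sum_add_distrib]
    ring
  | mul_X f j hf =>
    have h1 := Ideal.mul_mem_right (X j) _ hf
    have h2 : (∑ i, C (eval p (pderiv i f)) * (X i - C (p i))) * (X j - C (p j)) ∈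
        (RingHom.ker (eval p)) ^ 2 := by
      rw [pow_two]
      exact Ideal.mul_mem_mul (Ideal.sum_mem _ fun i _ => Ideal.mul_mem_left _ _ (hX i)) (hX j)
    convert Ideal.add_mem _ h1 h2 using 1
    have h3 : ∑ i, C (eval p (pderiv i (f * X j))) * (X i - C (p i)) =
        C (eval p f) * (X j - C (p j)) +
          C (p j) * ∑ i, C (eval p (pderiv i f)) * (X i - C (p i)) := by
      simp only [Derivation.leibniz, smul_eq_mul, map_add, map_mul, eval_X, pderiv_X, add_mul,
        Finset.sum_add_distrib, Finset.mul_sum]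
      congr 1
      · rw [Finset.sum_eq_single j]
        · simp
        · intro b _ hb
          simp [hb.symm]
        · simp
      · exact Finset.sum_congr rfl fun i _ => by ring
    rw [h3]
    simp only [map_mul, eval_X]
    ring

/-- If an algebraic set has no nonzero tangent vector at `p`, then the maximal ideal of `p` in the
coordinate ring is idempotent. -/
theorem ker_eval_le_of_no_tangent {σ : Type*} [Fintype σ] (I : Ideal (MvPolynomial σ ℂ))
    (p : σ → ℂ) (hp : p ∈ zeroLocus ℂ I)
    (h : ∀ η : σ → ℂ, (∀ f ∈ I, aeval (dualPoint p η) f = 0) → η = 0) :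
    RingHom.ker (eval p) ≤ (RingHom.ker (eval p)) ^ 2 ⊔ I := by
  classical
  let grad : MvPolynomial σ ℂ →ₗ[ℂ] (σ → ℂ) :=
    LinearMap.pi fun i => (aeval p).toLinearMap ∘ₗ (pderiv i : Derivation ℂ _ _).toLinearMap
  have hgrad : ∀ f i, grad f i = eval p (pderiv i f) := fun f i => by
    simp [grad]
  have htop : (I.restrictScalars ℂ).map grad = ⊤ := by
    by_contra hne
    obtain ⟨φ, hφ, hle⟩ := Submodule.exists_le_ker_of_lt_top _ (lt_top_iff_ne_top.2 hne)
    apply hφ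
    have hη := h (fun i => φ (Pi.single i 1)) (fun f hf => by
      apply TrivSqZeroExt.ext
      · rw [fst_aeval_dualPoint]
        simpa [aeval_eq_eval] using hp f hf
      · rw [snd_aeval_dualPoint]
        have h1 : φ (grad f) = 0 := hle (Submodule.mem_map_of_mem hf)
        rw [TrivSqZeroExt.snd_zero, ← h1, LinearMap.pi_apply_eq_sum_univ φ (grad f)]
        simp only [hgrad, smul_eq_mul]
        refine Finset.sum_congr rfl fun i _ => ?_
        rw [mul_comm]
        congr 2
        funext j
        simp [Pi.single_apply, eq_comm])
    ext i
    simpa using congrFun hη i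
  have hX : ∀ i, X i - C (p i) ∈ (RingHom.ker (eval p)) ^ 2 ⊔ I := by
    intro i
    obtain ⟨f, hf, hfi⟩ : (Pi.single i 1 : σ → ℂ) ∈ (I.restrictScalars ℂ).map grad := by
      rw [htop]; trivial
    have hfp : eval p f = 0 := by simpa [aeval_eq_eval] using hp f hf
    have ht := taylor_mem_sq p f
    have hs : ∑ k, C (eval p (pderiv k f)) * (X k - C (p k)) = X i - C (p i) := by
      simp only [← hgrad, hfi]
      rw [Finset.sum_eq_single i]
      · simp
      · intro b _ hb
        simp [hb]
      · simp
    rw [hs, hfp, map_zero, sub_zero] at ht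
    have := Ideal.sub_mem _ (Ideal.mem_sup_right (S := (RingHom.ker (eval p)) ^ 2) hf)
      (Ideal.mem_sup_left (T := I) ht)
    simpa using this
  intro f hf
  have ht := taylor_mem_sq p f
  rw [RingHom.mem_ker.1 hf, map_zero, sub_zero] at ht
  have := Ideal.add_mem _ (Ideal.mem_sup_left (T := I) ht)
    (Ideal.sum_mem _ fun i (_ : i ∈ Finset.univ) =>
      Ideal.mul_mem_left _ (C (eval p (pderiv i f))) (hX i))
  simpa using this

/-- An infinite algebraic set has a nonzero tangent vector at some point: otherwise every maximal
ideal of its coordinate ring is idempotent, and a Noetherian ring with this property is Artinian. -/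
theorem exists_tangent_of_infinite {σ : Type*} [Fintype σ] (I : Ideal (MvPolynomial σ ℂ))
    (hI : (zeroLocus ℂ I).Infinite) :
    ∃ p ∈ zeroLocus ℂ I, ∃ η : σ → ℂ, η ≠ 0 ∧ ∀ f ∈ I, aeval (dualPoint p η) f = 0 := by
  by_contra hcon
  push Not at hcon
  have hid : ∀ p ∈ zeroLocus ℂ I, RingHom.ker (eval p) ≤ (RingHom.ker (eval p)) ^ 2 ⊔ I := by
    intro p hp
    refine ker_eval_le_of_no_tangent I p hp fun η hη => ?_
    by_contra hne
    obtain ⟨f, hf, hf'⟩ := hcon p hp η hne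
    exact hf' (hη f hf)
  let A := MvPolynomial σ ℂ ⧸ I
  have hmax : ∀ M : Ideal A, M.IsMaximal → IsIdempotentElem M := by
    intro M hM
    have hM' : (M.comap (Ideal.Quotient.mk I)).IsMaximal :=
      Ideal.comap_isMaximal_of_surjective _ Ideal.Quotient.mk_surjective
    obtain ⟨p, hp⟩ := isMaximal_iff_eq_vanishingIdeal_singleton.1 hM'
    have hker : M.comap (Ideal.Quotient.mk I) = RingHom.ker (eval p) := by
      rw [hp]
      ext f
      simp [RingHom.mem_ker, aeval_eq_eval]
    have hIM : I ≤ RingHom.ker (eval p) := by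
      rw [← hker]
      intro f hf
      rw [Ideal.mem_comap, Ideal.Quotient.eq_zero_iff_mem.2 hf]
      exact M.zero_mem
    have hpI : p ∈ zeroLocus ℂ I := fun f hf => by
      have := hIM hf
      rwa [RingHom.mem_ker, ← aeval_eq_eval] at this
    have hMmap : M = (RingHom.ker (eval p)).map (Ideal.Quotient.mk I) := by
      rw [← hker, Ideal.map_comap_of_surjective _ Ideal.Quotient.mk_surjective]
    have h1 := Ideal.map_mono (f := Ideal.Quotient.mk I) (hid p hpI)
    rw [Ideal.map_sup, Ideal.map_pow, ← hMmap, Ideal.map_quotient_self, sup_bot_eq, pow_two] at h1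
    exact le_antisymm Ideal.mul_le_right h1
  have hdim : Ring.KrullDimLE 0 A := by
    refine Ring.KrullDimLE.mk₀ fun P hP => ?_
    obtain ⟨M, hM, hPM⟩ := Ideal.exists_le_maximal P hP.ne_top
    obtain ⟨e, he, heM⟩ :=
      (Ideal.isIdempotentElem_iff_of_fg M (IsNoetherian.noetherian M)).1 (hmax M hM)
    have heM' : e ∈ M := by rw [heM]; exact Ideal.mem_span_singleton_self e
    have hprod : e * (1 - e) ∈ P := by
      rw [mul_sub, mul_one, he.eq, sub_self]
      exact P.zero_mem
    rcases hP.mem_or_mem hprod with h | h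
    · have : M ≤ P := by
        rw [heM]
        exact (Ideal.span_singleton_le_iff_mem _).2 h
      rwa [le_antisymm hPM this]
    · exfalso
      apply hM.ne_top
      rw [Ideal.eq_top_iff_one]
      simpa using M.add_mem (hPM h) heM'
  have hart : IsArtinianRing A := isArtinianRing_iff_isNoetherianRing_krullDimLE_zero.2
    ⟨inferInstance, hdim⟩
  apply hI
  rw [← Set.finite_coe_iff]
  have hfin : Finite (PrimeSpectrum A) := inferInstance
  have hle : ∀ p : zeroLocus ℂ I, ∀ f ∈ I, eval p.1 f = 0 := fun p f hf => by
    simpa [aeval_eq_eval] using p.2 f hf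
  let Φ : zeroLocus ℂ I → PrimeSpectrum A := fun p =>
    ⟨RingHom.ker (Ideal.Quotient.lift I (eval p.1) (hle p)), RingHom.ker_isPrime _⟩
  have hΦ : Function.Injective Φ := by
    intro p q hpq
    apply Subtype.ext
    funext i
    have h1 : Ideal.Quotient.mk I (X i - C (p.1 i)) ∈ (Φ p).asIdeal := by
      simp [Φ, RingHom.mem_ker]
    rw [hpq] at h1
    have h2 : q.1 i - p.1 i = 0 := by simpa [Φ, RingHom.mem_ker] using h1
    exact (sub_eq_zero.1 h2).symm
  exact Finite.of_injective Φ hΦ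

/-! ### Coefficients and values of forms -/

/-- The exponent of the monomial `x_0^i x_1^(3-i) y_0^j y_1^(3-j)`. -/
def mon (i j : Fin 4) : Idx →₀ ℕ :=
  Finsupp.equivFunOnFinite.symm (Sum.elim ![(i : ℕ), 3 - i] ![(j : ℕ), 3 - j])

theorem weight_bideg (m : Idx →₀ ℕ) :
    Finsupp.weight bideg m =
      (m (Sum.inl 0) + m (Sum.inl 1), m (Sum.inr 0) + m (Sum.inr 1)) := by
  rw [Finsupp.weight_apply, Finsupp.sum_fintype _ _ (by simp)]
  ext <;> simp [bideg, Fintype.sum_sum_type, Fin.sum_univ_two]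

theorem weight_mon (i j : Fin 4) : Finsupp.weight bideg (mon i j) = (3, 3) := by
  rw [weight_bideg]
  simp only [mon, Finsupp.equivFunOnFinite_symm_apply_apply, Sum.elim_inl, Sum.elim_inr,
    cons_val_zero, cons_val_one, Prod.mk.injEq]
  omega

theorem eq_mon_of_weight {m : Idx →₀ ℕ} (h : Finsupp.weight bideg m = (3, 3)) :
    ∃ i j, m = mon i j := by
  rw [weight_bideg, Prod.mk.injEq] at h
  refine ⟨⟨m (Sum.inl 0), by omega⟩, ⟨m (Sum.inr 0), by omega⟩, ?_⟩
  ext k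
  rcases k with k | k <;> fin_cases k <;> simp [mon] <;> omega

theorem mon_injective {i j i' j' : Fin 4} (h : mon i j = mon i' j') : i = i' ∧ j = j' := by
  have h1 := DFunLike.congr_fun h (Sum.inl 0)
  have h2 := DFunLike.congr_fun h (Sum.inr 0)
  simp only [mon, Finsupp.equivFunOnFinite_symm_apply_apply, Sum.elim_inl, Sum.elim_inr,
    cons_val_zero] at h1 h2
  exact ⟨Fin.ext h1, Fin.ext h2⟩

/-- The coefficient of `x_0^i x_1^(3-i) y_0^j y_1^(3-j)`. -/
def cf (F : V) (i j : Fin 4) : ℂ := coeff (mon i j) F.1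

@[simp] theorem cf_smul (c : ℂ) (F : V) (i j : Fin 4) : cf (c • F) i j = c * cf F i j := by
  simp [cf]

@[simp] theorem cf_zero (i j : Fin 4) : cf 0 i j = 0 := by
  simp [cf]

theorem coeff_eq_zero_of_ne_mon (F : V) {m : Idx →₀ ℕ} (h : ∀ i j, m ≠ mon i j) :
    coeff m F.1 = 0 := by
  by_contra hne
  obtain ⟨i, j, hij⟩ := eq_mon_of_weight (F.2 hne)
  exact h i j hij

theorem ext_cf {F F' : V} (h : ∀ i j, cf F i j = cf F' i j) : F = F' := by
  apply Subtype.ext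
  ext m
  by_cases hm : ∃ i j, m = mon i j
  · obtain ⟨i, j, rfl⟩ := hm
    exact h i j
  · push Not at hm
    rw [coeff_eq_zero_of_ne_mon F hm, coeff_eq_zero_of_ne_mon F' hm]

theorem exists_cf_ne_zero {F : V} (h : F ≠ 0) : ∃ i j, cf F i j ≠ 0 := by
  by_contra hcon
  push Not at hcon
  exact h (ext_cf fun i j => by rw [hcon, cf_zero])

/-- The form with given coefficients. -/
def ofCf (a : Fin 4 → Fin 4 → ℂ) : V :=
  ⟨∑ i, ∑ j, monomial (mon i j) (a i j),
    Submodule.sum_mem _ fun i _ => Submodule.sum_mem _ fun j _ =>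
      isWeightedHomogeneous_monomial _ _ _ (weight_mon i j)⟩

@[simp] theorem cf_ofCf (a : Fin 4 → Fin 4 → ℂ) (i j : Fin 4) : cf (ofCf a) i j = a i j := by
  simp only [cf, ofCf, coeff_sum, coeff_monomial]
  rw [Finset.sum_eq_single i, Finset.sum_eq_single j]
  · simp
  · intro j' _ hj'
    exact if_neg fun h => hj' (mon_injective h).2
  · simp
  · intro i' _ hi'
    exact Finset.sum_eq_zero fun j' _ => if_neg fun h => hi' (mon_injective h).1
  · simp

theorem ofCf_cf (F : V) : ofCf (cf F) = F := ext_cf fun _ _ => cf_ofCf _ _ _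

theorem aeval_form {S : Type*} [CommRing S] [Algebra ℂ S] (z : Idx → S) (F : V) :
    aeval z F.1 = ∑ i : Fin 4, ∑ j : Fin 4, algebraMap ℂ S (cf F i j) *
      (z (Sum.inl 0) ^ (i : ℕ) * z (Sum.inl 1) ^ (3 - i : ℕ) *
        (z (Sum.inr 0) ^ (j : ℕ) * z (Sum.inr 1) ^ (3 - j : ℕ))) := by
  conv_lhs => rw [← ofCf_cf F]
  simp only [ofCf, map_sum, aeval_monomial]
  refine Finset.sum_congr rfl fun i _ => Finset.sum_congr rfl fun j _ => ?_
  rw [Finsupp.prod_fintype _ _ (by simp), Fintype.prod_sum_type, Fin.prod_univ_two,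
    Fin.prod_univ_two]
  simp [mon]

/-- The value of a form at the pair of vectors `(x, y)`. -/
def evalAt (F : V) (x y : Fin 2 → ℂ) : ℂ := eval (Sum.elim x y) F.1

theorem evalAt_eq (F : V) (x y : Fin 2 → ℂ) :
    evalAt F x y = ∑ i : Fin 4, ∑ j : Fin 4, cf F i j *
      (x 0 ^ (i : ℕ) * x 1 ^ (3 - i : ℕ) * (y 0 ^ (j : ℕ) * y 1 ^ (3 - j : ℕ))) := by
  have h := aeval_form (Sum.elim x y) F
  simpa [evalAt, aeval_eq_eval] using h

theorem ext_evalAt {F F' : V} (h : ∀ x y, evalAt F x y = evalAt F' x y) : F = F' := by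
  apply Subtype.ext
  apply MvPolynomial.funext
  intro z
  have := h (fun i => z (Sum.inl i)) (fun i => z (Sum.inr i))
  have hz : Sum.elim (fun i => z (Sum.inl i)) (fun i => z (Sum.inr i)) = z := by
    ext k; rcases k with k | k <;> rfl
  simpa only [evalAt, hz] using this

@[simp] theorem evalAt_smul (c : ℂ) (F : V) (x y : Fin 2 → ℂ) :
    evalAt (c • F) x y = c * evalAt F x y := by
  simp [evalAt]

theorem evalAt_ofCf (a : Fin 4 → Fin 4 → ℂ) (x y : Fin 2 → ℂ) :
    evalAt (ofCf a) x y = ∑ i : Fin 4, ∑ j : Fin 4, a i j *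
      (x 0 ^ (i : ℕ) * x 1 ^ (3 - i : ℕ) * (y 0 ^ (j : ℕ) * y 1 ^ (3 - j : ℕ))) := by
  simp [evalAt_eq]

theorem eq_ofCf_of_evalAt {F : V} {a : Fin 4 → Fin 4 → ℂ}
    (h : ∀ x y : Fin 2 → ℂ, evalAt F x y = ∑ i : Fin 4, ∑ j : Fin 4, a i j *
      (x 0 ^ (i : ℕ) * x 1 ^ (3 - i : ℕ) * (y 0 ^ (j : ℕ) * y 1 ^ (3 - j : ℕ)))) :
    F = ofCf a :=
  ext_evalAt fun x y => by rw [h, evalAt_ofCf]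

/-! ### The action on values -/

/-- The element `(A, B, 1)` of `G`. -/
def pair (A B : SL(2, ℂ)) : G := SemidirectProduct.inl (A, B)

/-- The element of `G` that interchanges the factors. -/
def sw : G := SemidirectProduct.inr (Multiplicative.ofAdd 1)

theorem pair_mul (A B A' B' : SL(2, ℂ)) : pair A B * pair A' B' = pair (A * A') (B * B') := by
  simp only [pair, ← map_mul, Prod.mk_mul_mk]

theorem pair_inv (A B : SL(2, ℂ)) : (pair A B)⁻¹ = pair A⁻¹ B⁻¹ := by
  simp only [pair, ← map_inv, Prod.inv_mk]

theorem pair_injective {A B A' B' : SL(2, ℂ)} (h : pair A B = pair A' B') : A = A' ∧ B = B' :=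
  Prod.ext_iff.1 (SemidirectProduct.inl_injective h)

theorem sw_mul_sw : sw * sw = 1 := by
  simp only [sw, ← map_mul]
  exact map_one _

theorem sw_inv : sw⁻¹ = sw := inv_eq_of_mul_eq_one_left sw_mul_sw

theorem toGL_pair (A B : SL(2, ℂ)) :
    (toGL (pair A B) : Matrix Idx Idx ℂ) = fromBlocks A.1 0 0 B.1 := by
  simp only [pair, toGL, SemidirectProduct.lift_inl]
  rfl

theorem toGL_sw : (toGL sw : Matrix Idx Idx ℂ) = fromBlocks 0 1 1 0 := by
  simp only [sw, toGL, SemidirectProduct.lift_inr]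
  have : involutionHom swapGL swapGL_mul_self (Multiplicative.ofAdd 1) = swapGL := by
    have : (Multiplicative.ofAdd (1 : ZMod 2)) ≠ 1 := by decide
    simp [involutionHom, this]
  rw [this]
  rfl

theorem eq_pair_or (g : G) : ∃ A B, g = pair A B ∨ g = pair A B * sw := by
  refine ⟨g.left.1, g.left.2, ?_⟩
  have key : ∀ e : Multiplicative (ZMod 2), e = 1 ∨ e = Multiplicative.ofAdd 1 := by decide
  have hg : g = SemidirectProduct.inl g.left * SemidirectProduct.inr g.right :=
    (SemidirectProduct.inl_left_mul_inr_right g).symm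
  rcases key g.right with h | h
  · left
    rw [h, map_one, mul_one] at hg
    exact hg
  · right
    rw [h] at hg
    exact hg

theorem sw_mul_pair (A B : SL(2, ℂ)) : sw * pair A B = pair B A * sw := by
  have h1 : (Multiplicative.ofAdd (1 : ZMod 2)) ≠ 1 := by decide
  have h2 : swapAut (Multiplicative.ofAdd 1) (A, B) = (B, A) := by
    simp [swapAut, involutionHom, h1]
  have h3 := SemidirectProduct.inl_aut (φ := swapAut) (Multiplicative.ofAdd 1) (A, B)
  rw [h2, map_inv SemidirectProduct.inr (Multiplicative.ofAdd (1 : ZMod 2))] at h3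
  have h4 : pair B A = sw * pair A B * sw⁻¹ := h3
  rw [h4, inv_mul_cancel_right]

theorem aeval_linSubst {S : Type*} [CommRing S] [Algebra ℂ S] (M : Matrix Idx Idx ℂ) (w : Idx → S)
    (F : MvPolynomial Idx ℂ) :
    aeval w (linSubst M F) = aeval (fun i => ∑ j, algebraMap ℂ S (M i j) * w j) F := by
  have : (aeval w).comp (linSubst M) =
      (aeval (fun i => ∑ j, algebraMap ℂ S (M i j) * w j) : MvPolynomial Idx ℂ →ₐ[ℂ] S) := by
    apply MvPolynomial.algHom_ext
    intro i
    simp [linSubst]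
  rw [← this]
  rfl

theorem eval_linSubst (M : Matrix Idx Idx ℂ) (z : Idx → ℂ) (F : MvPolynomial Idx ℂ) :
    eval z (linSubst M F) = eval (M *ᵥ z) F := by
  have h := aeval_linSubst M z F
  simp only [aeval_eq_eval] at h
  exact h

theorem smul_val (g : G) (F : V) :
    (g • F).1 = linSubst (toGL g⁻¹ : Matrix Idx Idx ℂ) F.1 := rfl

theorem evalAt_pair_smul (A B : SL(2, ℂ)) (F : V) (x y : Fin 2 → ℂ) :
    evalAt (pair A B • F) x y = evalAt F ((A⁻¹).1 *ᵥ x) ((B⁻¹).1 *ᵥ y) := by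
  rw [evalAt, smul_val, eval_linSubst, pair_inv, toGL_pair, fromBlocks_mulVec]
  simp [evalAt, Function.comp_def]

theorem evalAt_sw_smul (F : V) (x y : Fin 2 → ℂ) :
    evalAt (sw • F) x y = evalAt F y x := by
  rw [evalAt, smul_val, eval_linSubst, sw_inv, toGL_sw, fromBlocks_mulVec]
  simp [evalAt, Function.comp_def]

theorem smul_ne_zero_of (g : G) {F : V} (hF : F ≠ 0) : g • F ≠ 0 :=
  (smul_ne_zero_iff_ne g).2 hF

/-- The torus element `(diag(s, s⁻¹), diag(t, t⁻¹), 1)`. -/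
def tor (s t : ℂˣ) : G := pair (diagSL s) (diagSL t)

theorem diagSL_val (s : ℂˣ) : (diagSL s).1 = !![(s : ℂ), 0; 0, ((s⁻¹ : ℂˣ) : ℂ)] := rfl

theorem cf_tor_smul (s t : ℂˣ) (F : V) (i j : Fin 4) :
    cf (tor s t • F) i j = ((s⁻¹ : ℂˣ) : ℂ) ^ (i : ℕ) * (s : ℂ) ^ (3 - i : ℕ) *
      (((t⁻¹ : ℂˣ) : ℂ) ^ (j : ℕ) * (t : ℂ) ^ (3 - j : ℕ)) * cf F i j := by
  have h : tor s t • F = ofCf fun i j => ((s⁻¹ : ℂˣ) : ℂ) ^ (i : ℕ) * (s : ℂ) ^ (3 - i : ℕ) *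
      (((t⁻¹ : ℂˣ) : ℂ) ^ (j : ℕ) * (t : ℂ) ^ (3 - j : ℕ)) * cf F i j := by
    apply eq_ofCf_of_evalAt
    intro x y
    rw [tor, evalAt_pair_smul, ← map_inv, ← map_inv, evalAt_eq]
    refine Finset.sum_congr rfl fun i _ => Finset.sum_congr rfl fun j _ => ?_
    simp only [diagSL_val, mulVec, dotProduct, Fin.sum_univ_two,
      of_apply, cons_val_zero, cons_val_one, zero_mul, add_zero, zero_add, inv_inv, mul_pow,
      cons_val', cons_val_fin_one]
    ring
  rw [h, cf_ofCf]

/-! ### Topology of the space of forms, and limits along one-parameter subgroups -/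

theorem continuous_coeff (m : Idx →₀ ℕ) : Continuous fun F : V => coeff m F.1 :=
  (continuous_apply m).comp continuous_induced_dom

theorem continuous_cf (i j : Fin 4) : Continuous fun F : V => cf F i j := continuous_coeff _

theorem continuous_form_iff {Y : Type*} [TopologicalSpace Y] {φ : Y → V} :
    Continuous φ ↔ ∀ i j, Continuous fun y => cf (φ y) i j := by
  refine ⟨fun h i j => (continuous_cf i j).comp h, fun h => ?_⟩
  refine continuous_induced_rng.2 (continuous_pi fun m => ?_)
  by_cases hm : ∃ i j, m = mon i j
  · obtain ⟨i, j, rfl⟩ := hm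
    exact h i j
  · push Not at hm
    have : (fun y => coeff m (φ y).1) = fun _ => 0 :=
      _root_.funext fun y => coeff_eq_zero_of_ne_mon _ hm
    change Continuous fun y => coeff m (φ y).1
    rw [this]
    exact continuous_const

theorem tendsto_form_iff {Y : Type*} {l : Filter Y} {φ : Y → V} {F : V} :
    Filter.Tendsto φ l (nhds F) ↔
      ∀ i j, Filter.Tendsto (fun y => cf (φ y) i j) l (nhds (cf F i j)) := by
  refine ⟨fun h i j => ((continuous_cf i j).tendsto F).comp h, fun h => ?_⟩
  rw [nhds_induced, Filter.tendsto_comap_iff, tendsto_pi_nhds]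
  intro m
  by_cases hm : ∃ i j, m = mon i j
  · obtain ⟨i, j, rfl⟩ := hm
    exact h i j
  · push Not at hm
    simp only [Function.comp_def, coeff_eq_zero_of_ne_mon _ hm]
    exact tendsto_const_nhds

theorem continuous_evalForm (f : MvPolynomial (Idx →₀ ℕ) ℂ) : Continuous (evalForm f) :=
  (MvPolynomial.continuous_eval f).comp continuous_induced_dom

theorem evalForm_smul {f : MvPolynomial (Idx →₀ ℕ) ℂ} {d : ℕ} (hf : f.IsHomogeneous d) (c : ℂ)
    (F : V) : evalForm f (c • F) = c ^ d * evalForm f F := by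
  simp only [evalForm, eval_eq, Finset.mul_sum]
  refine Finset.sum_congr rfl fun m hm => ?_
  have hd : ∑ i ∈ m.support, m i = d := by
    have := hf (mem_support_iff.1 hm)
    rw [Finsupp.weight_apply, Finsupp.sum] at this
    simpa using this
  rw [← hd, ← Finset.prod_pow_eq_pow_sum]
  simp only [Submodule.coe_smul, coeff_smul, smul_eq_mul, mul_pow, Finset.prod_mul_distrib]
  ring

/-- Some homogeneous `G`-invariant of positive degree does not vanish at `F`. -/
def IsSemistableForm (F : V) : Prop :=
  ∃ d : ℕ, 0 < d ∧ ∃ f : MvPolynomial (Idx →₀ ℕ) ℂ, f.IsHomogeneous d ∧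
    (∀ (g : G) (F : V), evalForm f (g • F) = evalForm f F) ∧ evalForm f F ≠ 0

theorem isSemistableForm_smul_iff {c : ℂ} (hc : c ≠ 0) (F : V) :
    IsSemistableForm (c • F) ↔ IsSemistableForm F := by
  have key : ∀ (c : ℂ), c ≠ 0 → ∀ F : V, IsSemistableForm F → IsSemistableForm (c • F) := by
    rintro c hc F ⟨d, hd, f, hf, hinv, hne⟩
    exact ⟨d, hd, f, hf, hinv, by
      rw [evalForm_smul hf]; exact mul_ne_zero (pow_ne_zero _ hc) hne⟩
  refine ⟨fun h => ?_, key c hc F⟩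
  have := key c⁻¹ (inv_ne_zero hc) _ h
  rwa [smul_smul, inv_mul_cancel₀ hc, one_smul] at this

theorem isSemistableForm_group_smul_iff (g : G) (F : V) :
    IsSemistableForm (g • F) ↔ IsSemistableForm F := by
  constructor
  · rintro ⟨d, hd, f, hf, hinv, hne⟩
    exact ⟨d, hd, f, hf, hinv, by rwa [hinv] at hne⟩
  · rintro ⟨d, hd, f, hf, hinv, hne⟩
    exact ⟨d, hd, f, hf, hinv, by rwa [hinv]⟩

theorem mk_mem_semistable {F : V} (hF : F ≠ 0) :
    Projectivization.mk ℂ F hF ∈ semistable ↔ IsSemistableForm F := by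
  obtain ⟨a, ha⟩ := Projectivization.exists_smul_eq_mk_rep ℂ F hF
  change IsSemistableForm (Projectivization.mk ℂ F hF).rep ↔ _
  rw [← ha]
  exact isSemistableForm_smul_iff a.ne_zero F

theorem IsSemistableForm.ne_zero {F : V} (h : IsSemistableForm F) : F ≠ 0 := by
  rintro rfl
  obtain ⟨d, hd, f, hf, -, hne⟩ := h
  apply hne
  have := evalForm_smul hf 0 0
  rwa [zero_smul, zero_pow hd.ne', zero_mul] at this

/-- The weight of the monomial `x_0^i x_1^(3-i) y_0^j y_1^(3-j)` under the one-parameter subgroup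
with real exponents `p` and `q`. -/
def wt (p q : ℝ) (i j : Fin 4) : ℝ := p * (2 * (i : ℕ) - 3) + q * (2 * (j : ℕ) - 3)

/-- The unit `exp r` of `ℂ`. -/
def expUnit (r : ℝ) : ℂˣ := Units.mk0 (Complex.exp r) (Complex.exp_ne_zero _)

theorem cf_expUnit_smul (p q s : ℝ) (F : V) (i j : Fin 4) :
    cf (tor (expUnit (p * s)) (expUnit (q * s)) • F) i j =
      (Real.exp (-(wt p q i j * s)) : ℝ) * cf F i j := by
  have h : ∀ (r : ℝ) (i : Fin 4), (((expUnit r)⁻¹ : ℂˣ) : ℂ) ^ (i : ℕ) *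
      ((expUnit r : ℂˣ) : ℂ) ^ (3 - i : ℕ) = Complex.exp (-(r * (2 * (i : ℕ) - 3))) := by
    intro r i
    simp only [expUnit, Units.val_inv_eq_inv_val, Units.val_mk0, ← Complex.exp_neg,
      ← Complex.exp_nat_mul, ← Complex.exp_add]
    congr 1
    have : ((3 - i : ℕ) : ℂ) = 3 - (i : ℕ) := by
      rw [Nat.cast_sub (by omega)]; norm_num
    rw [this]
    ring
  rw [cf_tor_smul, h, h, ← Complex.exp_add]
  congr 1
  rw [Complex.ofReal_exp]
  congr 1
  simp only [wt]
  push_cast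
  ring

/-- If all monomials of `F` have nonnegative weight, the one-parameter subgroup contracts `F` to
its part of weight zero. -/
theorem tendsto_weightZeroPart {p q : ℝ} {F F₀ : V} (h : ∀ i j, cf F i j ≠ 0 → 0 ≤ wt p q i j)
    (h₀ : ∀ i j, cf F₀ i j = if wt p q i j = 0 then cf F i j else 0) :
    Filter.Tendsto (fun s : ℝ => tor (expUnit (p * s)) (expUnit (q * s)) • F) Filter.atTop
      (nhds F₀) := by
  rw [tendsto_form_iff]
  intro i j
  simp only [cf_expUnit_smul]
  rw [h₀]
  split_ifs with hw
  · simp [hw]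
  · by_cases hc : cf F i j = 0
    · simp [hc]
    · have hpos : 0 < wt p q i j := lt_of_le_of_ne (h i j hc) (Ne.symm hw)
      have h1 : Filter.Tendsto (fun s : ℝ => Real.exp (-(wt p q i j * s))) Filter.atTop
          (nhds 0) :=
        Real.tendsto_exp_neg_atTop_nhds_zero.comp (Filter.tendsto_id.const_mul_atTop hpos)
      have h2 := ((Complex.continuous_ofReal.tendsto 0).comp h1).mul_const (cf F i j)
      simpa using h2

theorem IsSemistableForm.weightZeroPart {p q : ℝ} {F F₀ : V} (hF : IsSemistableForm F)
    (h : ∀ i j, cf F i j ≠ 0 → 0 ≤ wt p q i j)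
    (h₀ : ∀ i j, cf F₀ i j = if wt p q i j = 0 then cf F i j else 0) : IsSemistableForm F₀ := by
  obtain ⟨d, hd, f, hf, hinv, hne⟩ := hF
  refine ⟨d, hd, f, hf, hinv, ?_⟩
  have h1 := ((continuous_evalForm f).tendsto F₀).comp (tendsto_weightZeroPart h h₀)
  have h2 : evalForm f ∘ (fun s : ℝ => tor (expUnit (p * s)) (expUnit (q * s)) • F) =
      fun _ => evalForm f F := _root_.funext fun s => hinv _ _
  rw [h2] at h1
  rwa [← tendsto_nhds_unique tendsto_const_nhds h1]

/-- The easy half of the numerical criterion: a form all of whose monomials have positive weight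
is not semistable. -/
theorem not_isSemistableForm_of_wt_pos (p q : ℝ) {F : V}
    (h : ∀ i j, cf F i j ≠ 0 → 0 < wt p q i j) : ¬ IsSemistableForm F := by
  intro hF
  refine (hF.weightZeroPart (F₀ := 0) (fun i j hij => (h i j hij).le) fun i j => ?_).ne_zero rfl
  rw [cf_zero]
  split_ifs with hw
  · by_contra hne
    exact (h i j (Ne.symm hne)).ne' hw
  · rfl

/-! ### Generators of the group -/

/-- The upper unipotent matrix with off-diagonal entry `s`. -/
def upper (s : ℂ) : SL(2, ℂ) := ⟨!![1, s; 0, 1], by simp [det_fin_two]⟩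

/-- The lower unipotent matrix with off-diagonal entry `s`. -/
def lower (s : ℂ) : SL(2, ℂ) := ⟨!![1, 0; s, 1], by simp [det_fin_two]⟩

theorem sl_inv (A : SL(2, ℂ)) : (A⁻¹).1 = !![A.1 1 1, -A.1 0 1; -A.1 1 0, A.1 0 0] :=
  adjugate_fin_two A.1

theorem sl_mul (A B : SL(2, ℂ)) : (A * B).1 = A.1 * B.1 := rfl

theorem sl_one : (1 : SL(2, ℂ)).1 = 1 := rfl

theorem sl_det (A : SL(2, ℂ)) : A.1 0 0 * A.1 1 1 - A.1 0 1 * A.1 1 0 = 1 := by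
  rw [← det_fin_two]
  exact A.2

theorem upper_inv (s : ℂ) : ((upper s)⁻¹).1 = !![1, -s; 0, 1] := by
  rw [sl_inv]
  simp [upper]

theorem lower_inv (s : ℂ) : ((lower s)⁻¹).1 = !![1, 0; -s, 1] := by
  rw [sl_inv]
  simp [lower]

/-- A matrix with nonzero lower left entry is the product of three elementary matrices, and any matrix
acquires such an entry after multiplication by an elementary one. -/
theorem exists_eq_elementary (A : SL(2, ℂ)) :
    ∃ a b c d : ℂ, A = upper a * lower b * upper c * lower d := by
  have key : ∀ A : SL(2, ℂ), A.1 1 0 ≠ 0 → ∃ a b c : ℂ, A = upper a * lower b * upper c := by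
    intro A hr
    have hdet := sl_det A
    refine ⟨(A.1 0 0 - 1) / A.1 1 0, A.1 1 0, (A.1 1 1 - 1) / A.1 1 0, ?_⟩
    apply Subtype.ext
    rw [sl_mul, sl_mul]
    ext i j
    fin_cases i <;> fin_cases j <;>
      simp [upper, lower, mul_apply, Fin.sum_univ_two] <;> field_simp <;>
      first | ring1 | linear_combination -hdet
  by_cases hr : A.1 1 0 = 0
  · have hdet := A.2
    rw [det_fin_two, hr, mul_zero, sub_zero] at hdet
    have hs : A.1 1 1 ≠ 0 := right_ne_zero_of_mul_eq_one hdet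
    obtain ⟨a, b, c, habc⟩ := key (A * lower 1) (by
      rw [sl_mul]
      simp [lower, mul_apply, Fin.sum_univ_two, hr, hs])
    refine ⟨a, b, c, -1, ?_⟩
    have h1 : lower 1 * lower (-1) = 1 := by
      apply Subtype.ext
      rw [sl_mul]
      ext i j
      fin_cases i <;> fin_cases j <;> simp [lower, mul_apply, Fin.sum_univ_two]
    rw [← habc, mul_assoc, h1, mul_one]
  · obtain ⟨a, b, c, habc⟩ := key A hr
    refine ⟨a, b, c, 0, ?_⟩
    have h1 : lower 0 = 1 := by
      apply Subtype.ext
      ext i j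
      fin_cases i <;> fin_cases j <;> simp [lower]
    rw [h1, mul_one, habc]

/-- The unipotent elements of the first factor together with the interchange generate `G`. -/
theorem eq_top_of_elementary (H : Subgroup G) (h1 : ∀ s, pair (upper s) 1 ∈ H)
    (h2 : ∀ s, pair (lower s) 1 ∈ H) (h3 : sw ∈ H) (g : G) : g ∈ H := by
  have hA : ∀ A, pair A 1 ∈ H := by
    intro A
    obtain ⟨a, b, c, d, rfl⟩ := exists_eq_elementary A
    have := H.mul_mem (H.mul_mem (H.mul_mem (h1 a) (h2 b)) (h1 c)) (h2 d)
    simpa [pair_mul] using this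
  have hB : ∀ B, pair 1 B ∈ H := by
    intro B
    have := H.mul_mem (H.mul_mem h3 (hA B)) h3
    rwa [sw_mul_pair, mul_assoc, sw_mul_sw, mul_one] at this
  have hAB : ∀ A B, pair A B ∈ H := by
    intro A B
    have := H.mul_mem (hA A) (hB B)
    simpa [pair_mul] using this
  obtain ⟨A, B, rfl | rfl⟩ := eq_pair_or g
  · exact hAB A B
  · exact H.mul_mem (hAB A B) h3

/-- The coefficients after the substitution `x_0 ↦ x_0 - s x_1`. -/
def upperCf {R : Type*} [CommRing R] (s : R) (a : Fin 4 → R) : Fin 4 → R :=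
  ![a 0 - s * a 1 + s ^ 2 * a 2 - s ^ 3 * a 3, a 1 - 2 * s * a 2 + 3 * s ^ 2 * a 3,
    a 2 - 3 * s * a 3, a 3]

/-- The coefficients after the substitution `x_1 ↦ x_1 - s x_0`. -/
def lowerCf {R : Type*} [CommRing R] (s : R) (a : Fin 4 → R) : Fin 4 → R :=
  ![a 0, a 1 - 3 * s * a 0, a 2 - 2 * s * a 1 + 3 * s ^ 2 * a 0,
    a 3 - s * a 2 + s ^ 2 * a 1 - s ^ 3 * a 0]

theorem cf_upper_smul (s : ℂ) (F : V) (i j : Fin 4) :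
    cf (pair (upper s) 1 • F) i j = upperCf s (fun k => cf F k j) i := by
  have h : pair (upper s) 1 • F = ofCf fun i j => upperCf s (fun k => cf F k j) i := by
    apply eq_ofCf_of_evalAt
    intro x y
    rw [evalAt_pair_smul, evalAt_eq, upper_inv]
    simp [mulVec, dotProduct, Fin.sum_univ_two, Fin.sum_univ_four, upperCf]
    ring
  rw [h, cf_ofCf]

theorem cf_lower_smul (s : ℂ) (F : V) (i j : Fin 4) :
    cf (pair (lower s) 1 • F) i j = lowerCf s (fun k => cf F k j) i := by
  have h : pair (lower s) 1 • F = ofCf fun i j => lowerCf s (fun k => cf F k j) i := by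
    apply eq_ofCf_of_evalAt
    intro x y
    rw [evalAt_pair_smul, evalAt_eq, lower_inv]
    simp [mulVec, dotProduct, Fin.sum_univ_two, Fin.sum_univ_four, lowerCf]
    ring
  rw [h, cf_ofCf]

theorem cf_sw_smul (F : V) (i j : Fin 4) : cf (sw • F) i j = cf F j i := by
  have h : sw • F = ofCf fun i j => cf F j i := by
    apply eq_ofCf_of_evalAt
    intro x y
    rw [evalAt_sw_smul, evalAt_eq, Finset.sum_comm]
    exact Finset.sum_congr rfl fun i _ => Finset.sum_congr rfl fun j _ => by ring
  rw [h, cf_ofCf]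

/-! ### Three invariants -/

theorem coeff_aeval_C_mul_X {σ : Type*} (c : ℂ) (P : MvPolynomial σ ℂ) (m : σ →₀ ℕ) :
    coeff m (aeval (fun i => C c * X i : σ → MvPolynomial σ ℂ) P) =
      c ^ (m.sum fun _ k => k) * coeff m P := by
  classical
  induction P using MvPolynomial.induction_on' with
  | monomial u a =>
    have h : aeval (fun i => C c * X i : σ → MvPolynomial σ ℂ) (monomial u a) =
        monomial u (a * c ^ (u.sum fun _ k => k)) := by
      rw [aeval_monomial, algebraMap_eq, monomial_eq (s := u), C_mul, mul_assoc]
      congr 1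
      simp only [Finsupp.prod, Finsupp.sum, mul_pow, Finset.prod_mul_distrib, map_pow,
        Finset.prod_pow_eq_pow_sum]
    rw [h, coeff_monomial, coeff_monomial]
    split_ifs with hu
    · rw [hu, mul_comm]
    · rw [mul_zero]
  | add P Q hP hQ => rw [map_add, coeff_add, coeff_add, hP, hQ, mul_add]

theorem isHomogeneous_of_eval_mul {σ : Type*} {P : MvPolynomial σ ℂ} {d : ℕ}
    (h : ∀ (c : ℂ) (a : σ → ℂ), eval (fun i => c * a i) P = c ^ d * eval a P) :
    P.IsHomogeneous d := by
  intro m hm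
  have h1 : aeval (fun i => C 2 * X i : σ → MvPolynomial σ ℂ) P = C (2 ^ d) * P := by
    apply MvPolynomial.funext
    intro a
    rw [map_mul, eval_C, ← h 2 a, ← aeval_eq_eval, ← AlgHom.comp_apply, ← aeval_eq_eval]
    congr 1
    apply MvPolynomial.algHom_ext
    simp
  have h2 := congrArg (coeff m) h1
  rw [coeff_aeval_C_mul_X, coeff_C_mul] at h2
  have h3 := mul_right_cancel₀ hm h2
  have h4 : (2 : ℕ) ^ (m.sum fun _ k => k) = 2 ^ d := by exact_mod_cast h3
  have h5 := Nat.pow_right_injective le_rfl h4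
  rw [Finsupp.weight_apply]
  simpa using h5

/-- A polynomial in the coefficients that is homogeneous and invariant under generators of `G`
detects semistability. -/
theorem isSemistableForm_of_invariant (P : MvPolynomial (Fin 4 × Fin 4) ℂ)
    (φ : (Fin 4 → Fin 4 → ℂ) → ℂ) (hφ : ∀ a, eval (fun k => a k.1 k.2) P = φ a)
    {d : ℕ} (hd : 0 < d) (hsmul : ∀ c a, φ (fun i j => c * a i j) = c ^ d * φ a)
    (hupper : ∀ s a, φ (fun i j => upperCf s (fun k => a k j) i) = φ a)
    (hlower : ∀ s a, φ (fun i j => lowerCf s (fun k => a k j) i) = φ a)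
    (hsw : ∀ a, φ (fun i j => a j i) = φ a) {F : V} (hF : φ (cf F) ≠ 0) :
    IsSemistableForm F := by
  have hP : P.IsHomogeneous d := isHomogeneous_of_eval_mul fun c a =>
    (hφ fun i j => c * a (i, j)).trans <|
      (hsmul c fun i j => a (i, j)).trans (congrArg _ (hφ fun i j => a (i, j)).symm)
  have hval : ∀ F, evalForm (rename (fun k => mon k.1 k.2) P) F = φ (cf F) := by
    intro F
    rw [evalForm, eval_rename, ← hφ]
    rfl
  refine ⟨d, hd, rename (fun k => mon k.1 k.2) P, hP.rename_isHomogeneous, ?_, ?_⟩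
  · let H : Subgroup G :=
      { carrier := {g | ∀ F, φ (cf (g • F)) = φ (cf F)}
        one_mem' := fun F => by rw [one_smul]
        mul_mem' := fun {g h} hg hh F => by rw [mul_smul, hg, hh]
        inv_mem' := fun {g} hg F => by rw [← hg, smul_inv_smul] }
    intro g F
    rw [hval, hval]
    refine eq_top_of_elementary H (fun s F => ?_) (fun s F => ?_) (fun F => ?_) g F
    · rw [← hupper s (cf F)]
      congr 1
      funext i j
      exact cf_upper_smul s F i j
    · rw [← hlower s (cf F)]
      congr 1
      funext i j
      exact cf_lower_smul s F i j
    · rw [← hsw (cf F)]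
      congr 1
      funext i j
      exact cf_sw_smul F i j
  · rwa [hval]

/-- The quadratic invariant: the product of the two invariant symplectic forms on cubics. -/
def quadInv {R : Type*} [CommRing R] (a : Fin 4 → Fin 4 → R) : R :=
  9 * a 3 3 * a 0 0 - 3 * a 3 2 * a 0 1 + 3 * a 3 1 * a 0 2 - 9 * a 3 0 * a 0 3 -
    3 * a 2 3 * a 1 0 + a 2 2 * a 1 1 - a 2 1 * a 1 2 + 3 * a 2 0 * a 1 3

theorem isSemistableForm_of_quadInv {F : V} (hF : quadInv (cf F) ≠ 0) : IsSemistableForm F := by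
  refine isSemistableForm_of_invariant (quadInv fun i j => X (i, j)) quadInv
    (fun a => by simp [quadInv]) (d := 2) two_pos (fun c a => ?_) (fun s a => ?_) (fun s a => ?_)
    (fun a => ?_) hF
  · simp only [quadInv]; ring
  · simp [quadInv, upperCf]; ring
  · simp [quadInv, lowerCf]; ring
  · simp only [quadInv]; ring

theorem isSemistableForm_of_det {F : V} (hF : (Matrix.of (cf F)).det ≠ 0) :
    IsSemistableForm F := by
  refine isSemistableForm_of_invariant (Matrix.of fun i j => X (i, j)).det
    (fun a => (Matrix.of a).det) (fun a => ?_) (d := 4) four_pos (fun c a => ?_) (fun s a => ?_)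
    (fun s a => ?_) (fun a => ?_) hF
  · rw [RingHom.map_det]
    congr 1
    ext i j
    simp
  · have : (Matrix.of fun i j => c * a i j) = c • Matrix.of a := by ext i j; simp
    rw [this, det_smul]
    simp
  · have : (Matrix.of fun i j => upperCf s (fun k => a k j) i) =
        !![1, -s, s ^ 2, -s ^ 3; 0, 1, -2 * s, 3 * s ^ 2; 0, 0, 1, -3 * s; 0, 0, 0, 1] *
          Matrix.of a := by
      ext i j
      fin_cases i <;> simp [upperCf, mul_apply, Fin.sum_univ_four] <;> ring
    rw [this, det_mul]
    simp [det_succ_row_zero, Fin.sum_univ_succ, Fin.succAbove]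
  · have : (Matrix.of fun i j => lowerCf s (fun k => a k j) i) =
        !![1, 0, 0, 0; -3 * s, 1, 0, 0; 3 * s ^ 2, -2 * s, 1, 0; -s ^ 3, s ^ 2, -s, 1] *
          Matrix.of a := by
      ext i j
      fin_cases i <;> simp [lowerCf, mul_apply, Fin.sum_univ_four] <;> ring
    rw [this, det_mul]
    simp [det_succ_row_zero, Fin.sum_univ_succ, Fin.succAbove]
  · exact det_transpose _

/-- The coefficients of the second transvectant of two cubics, as a functional of the products of
their coefficients. -/
def tr2 {R : Type*} [CommRing R] (k : Fin 3) (M : Fin 4 → Fin 4 → R) : R :=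
  ![3 * M 2 0 - 2 * M 1 1 + 3 * M 0 2, 9 * M 3 0 - M 2 1 - M 1 2 + 9 * M 0 3,
    3 * M 3 1 - 2 * M 2 2 + 3 * M 1 3] k

/-- The coefficients of the covariant of bidegree `(2, 2)`, the second transvectant of the form with
itself in both sets of variables. -/
def hess {R : Type*} [CommRing R] (a : Fin 4 → Fin 4 → R) (k l : Fin 3) : R :=
  tr2 l fun j q => tr2 k fun i p => a i j * a p q

/-- The quartic invariant: the discriminant form evaluated at the `(2, 2)`-covariant. -/
def quartInv {R : Type*} [CommRing R] (a : Fin 4 → Fin 4 → R) : R :=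
  8 * hess a 2 0 * hess a 0 2 + 8 * hess a 2 2 * hess a 0 0 - 4 * hess a 2 1 * hess a 0 1 -
    4 * hess a 1 2 * hess a 1 0 + hess a 1 1 ^ 2

theorem tr2_upper {R : Type*} [CommRing R] (s : R) (f g : Fin 4 → R) (k : Fin 3) :
    tr2 k (fun i p => upperCf s f i * upperCf s g p) =
      ![tr2 0 (fun i p => f i * g p) - s * tr2 1 (fun i p => f i * g p) +
          s ^ 2 * tr2 2 (fun i p => f i * g p),
        tr2 1 (fun i p => f i * g p) - 2 * s * tr2 2 (fun i p => f i * g p),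
        tr2 2 (fun i p => f i * g p)] k := by
  fin_cases k <;> simp [tr2, upperCf] <;> ring

theorem tr2_lower {R : Type*} [CommRing R] (s : R) (f g : Fin 4 → R) (k : Fin 3) :
    tr2 k (fun i p => lowerCf s f i * lowerCf s g p) =
      ![tr2 0 (fun i p => f i * g p),
        tr2 1 (fun i p => f i * g p) - 2 * s * tr2 0 (fun i p => f i * g p),
        tr2 2 (fun i p => f i * g p) - s * tr2 1 (fun i p => f i * g p) +
          s ^ 2 * tr2 0 (fun i p => f i * g p)] k := by
  fin_cases k <;> simp [tr2, lowerCf] <;> ring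

theorem tr2_linear {R : Type*} [CommRing R] (l : Fin 3) (M N P : Fin 4 → Fin 4 → R) (c d : R) :
    tr2 l (fun j q => M j q + c * N j q + d * P j q) = tr2 l M + c * tr2 l N + d * tr2 l P := by
  fin_cases l <;> simp [tr2] <;> ring

theorem hess_upper {R : Type*} [CommRing R] (s : R) (a : Fin 4 → Fin 4 → R) (k l : Fin 3) :
    hess (fun i j => upperCf s (fun k => a k j) i) k l =
      ![hess a 0 l - s * hess a 1 l + s ^ 2 * hess a 2 l, hess a 1 l - 2 * s * hess a 2 l,
        hess a 2 l] k := by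
  simp only [hess, tr2_upper]
  fin_cases k
  · have h := tr2_linear l (fun j q => tr2 0 fun i p => a i j * a p q)
      (fun j q => tr2 1 fun i p => a i j * a p q) (fun j q => tr2 2 fun i p => a i j * a p q)
      (-s) (s ^ 2)
    simpa [sub_eq_add_neg] using h
  · have h := tr2_linear l (fun j q => tr2 1 fun i p => a i j * a p q)
      (fun j q => tr2 2 fun i p => a i j * a p q) 0 (-(2 * s)) 0
    simpa [sub_eq_add_neg] using h
  · rfl

theorem hess_lower {R : Type*} [CommRing R] (s : R) (a : Fin 4 → Fin 4 → R) (k l : Fin 3) :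
    hess (fun i j => lowerCf s (fun k => a k j) i) k l =
      ![hess a 0 l, hess a 1 l - 2 * s * hess a 0 l,
        hess a 2 l - s * hess a 1 l + s ^ 2 * hess a 0 l] k := by
  simp only [hess, tr2_lower]
  fin_cases k
  · rfl
  · have h := tr2_linear l (fun j q => tr2 1 fun i p => a i j * a p q)
      (fun j q => tr2 0 fun i p => a i j * a p q) 0 (-(2 * s)) 0
    simpa [sub_eq_add_neg] using h
  · have h := tr2_linear l (fun j q => tr2 2 fun i p => a i j * a p q)
      (fun j q => tr2 1 fun i p => a i j * a p q) (fun j q => tr2 0 fun i p => a i j * a p q)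
      (-s) (s ^ 2)
    simpa [sub_eq_add_neg] using h

theorem hess_swap {R : Type*} [CommRing R] (a : Fin 4 → Fin 4 → R) (k l : Fin 3) :
    hess (fun i j => a j i) k l = hess a l k := by
  fin_cases k <;> fin_cases l <;> simp [hess, tr2] <;> ring

theorem hess_smul {R : Type*} [CommRing R] (c : R) (a : Fin 4 → Fin 4 → R) (k l : Fin 3) :
    hess (fun i j => c * a i j) k l = c ^ 2 * hess a k l := by
  fin_cases k <;> fin_cases l <;> simp [hess, tr2] <;> ring

theorem isSemistableForm_of_quartInv {F : V} (hF : quartInv (cf F) ≠ 0) : IsSemistableForm F := by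
  refine isSemistableForm_of_invariant (quartInv fun i j => X (i, j)) quartInv
    (fun a => by simp [quartInv, hess, tr2]) (d := 4) four_pos (fun c a => ?_) (fun s a => ?_)
    (fun s a => ?_) (fun a => ?_) hF
  · simp only [quartInv, hess_smul]; ring
  · simp [quartInv, hess_upper]; ring
  · simp [quartInv, hess_lower]; ring
  · simp only [quartInv, hess_swap]; ring

/-! ### The linear systems of the two families -/

theorem mk_eq_mk_iff_exists {F F' : V} (hF : F ≠ 0) (hF' : F' ≠ 0) :
    Projectivization.mk ℂ F hF = Projectivization.mk ℂ F' hF' ↔ ∃ c : ℂ, c ≠ 0 ∧ F = c • F' := by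
  rw [Projectivization.mk_eq_mk_iff']
  constructor
  · rintro ⟨c, hc⟩
    refine ⟨c, ?_, hc.symm⟩
    rintro rfl
    exact hF (by rw [← hc, zero_smul])
  · rintro ⟨c, -, hc⟩
    exact ⟨c, hc.symm⟩

theorem smul_mk_eq_iff (g : G) {F : V} (hF : F ≠ 0) :
    g • Projectivization.mk ℂ F hF = Projectivization.mk ℂ F hF ↔
      ∃ c : ℂ, c ≠ 0 ∧ g • F = c • F := by
  rw [Projectivization.smul_mk, mk_eq_mk_iff_exists]

/-- The form `a u³ + b u² v + c u v² + d v³` with `u = x_0 y_1` and `v = x_1 y_0`. -/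
def dForm (a b c d : ℂ) : V :=
  ofCf (Matrix.of.symm !![0, 0, 0, d; 0, 0, c, 0; 0, b, 0, 0; a, 0, 0, 0])

/-- The form `a x_0³ y_0 y_1² + b x_1³ y_0² y_1`. -/
def aForm (a b : ℂ) : V :=
  ofCf (Matrix.of.symm !![0, 0, b, 0; 0, 0, 0, 0; 0, 0, 0, 0; 0, a, 0, 0])

theorem cf_dForm (a b c d : ℂ) (i j : Fin 4) :
    cf (dForm a b c d) i j = !![0, 0, 0, d; 0, 0, c, 0; 0, b, 0, 0; a, 0, 0, 0] i j :=
  cf_ofCf _ _ _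

theorem cf_aForm (a b : ℂ) (i j : Fin 4) :
    cf (aForm a b) i j = !![0, 0, b, 0; 0, 0, 0, 0; 0, 0, 0, 0; 0, a, 0, 0] i j :=
  cf_ofCf _ _ _

theorem evalAt_dForm (a b c d : ℂ) (x y : Fin 2 → ℂ) :
    evalAt (dForm a b c d) x y = a * (x 0 * y 1) ^ 3 + b * (x 0 * y 1) ^ 2 * (x 1 * y 0) +
      c * (x 0 * y 1) * (x 1 * y 0) ^ 2 + d * (x 1 * y 0) ^ 3 := by
  rw [evalAt_eq]
  simp [cf_dForm, Fin.sum_univ_four]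
  ring

theorem evalAt_aForm (a b : ℂ) (x y : Fin 2 → ℂ) :
    evalAt (aForm a b) x y = a * (x 0 ^ 3 * y 0 * y 1 ^ 2) + b * (x 1 ^ 3 * y 0 ^ 2 * y 1) := by
  rw [evalAt_eq]
  simp [cf_aForm, Fin.sum_univ_four]
  ring

theorem val_eq_of_evalAt {F : V} {P : MvPolynomial Idx ℂ}
    (h : ∀ x y, evalAt F x y = eval (Sum.elim x y) P) : F.1 = P := by
  apply MvPolynomial.funext
  intro z
  have hz : Sum.elim (fun i => z (Sum.inl i)) (fun i => z (Sum.inr i)) = z := by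
    ext k; rcases k with k | k <;> rfl
  have := h (fun i => z (Sum.inl i)) (fun i => z (Sum.inr i))
  rwa [evalAt, hz] at this

theorem dForm_val (a b c d : ℂ) :
    (dForm a b c d).1 = C a * monD 0 + C b * monD 1 + C c * monD 2 + C d * monD 3 := by
  apply val_eq_of_evalAt
  intro x y
  rw [evalAt_dForm]
  simp [monD, xVar, yVar]
  ring

theorem aForm_val (a b : ℂ) : (aForm a b).1 = C a * monA 0 + C b * monA 1 := by
  apply val_eq_of_evalAt
  intro x y
  rw [evalAt_aForm]
  simp [monA, xVar, yVar]

theorem dForm_inj {a b c d a' b' c' d' : ℂ} (h : dForm a b c d = dForm a' b' c' d') :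
    a = a' ∧ b = b' ∧ c = c' ∧ d = d' := by
  have h' := fun i j => congrArg (fun F => cf F i j) h
  simp only [cf_dForm] at h'
  exact ⟨h' 3 0, h' 2 1, h' 1 2, h' 0 3⟩

theorem aForm_inj {a b a' b' : ℂ} (h : aForm a b = aForm a' b') : a = a' ∧ b = b' := by
  have h' := fun i j => congrArg (fun F => cf F i j) h
  simp only [cf_aForm] at h'
  exact ⟨h' 3 1, h' 0 2⟩

theorem smul_dForm (k a b c d : ℂ) : k • dForm a b c d = dForm (k * a) (k * b) (k * c) (k * d) :=
  ext_evalAt fun x y => by rw [evalAt_smul, evalAt_dForm, evalAt_dForm]; ring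

theorem smul_aForm (k a b : ℂ) : k • aForm a b = aForm (k * a) (k * b) :=
  ext_evalAt fun x y => by rw [evalAt_smul, evalAt_aForm, evalAt_aForm]; ring

theorem dForm_zero : dForm 0 0 0 0 = 0 := by
  have := smul_dForm 0 0 0 0 0
  simpa using this.symm

theorem aForm_zero : aForm 0 0 = 0 := by
  have := smul_aForm 0 0 0
  simpa using this.symm

theorem linearIndependent_monD : LinearIndependent ℂ monD := by
  rw [Fintype.linearIndependent_iff]
  intro g hg
  have h1 : (dForm (g 0) (g 1) (g 2) (g 3)).1 = 0 := by
    rw [dForm_val, ← hg]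
    simp [Fin.sum_univ_four, MvPolynomial.smul_eq_C_mul]
  have h2 := (Subtype.ext h1 : dForm (g 0) (g 1) (g 2) (g 3) = 0)
  rw [← dForm_zero] at h2
  obtain ⟨h3, h4, h5, h6⟩ := dForm_inj h2
  intro i
  fin_cases i <;> assumption

theorem linearIndependent_monA : LinearIndependent ℂ monA := by
  rw [Fintype.linearIndependent_iff]
  intro g hg
  have h1 : (aForm (g 0) (g 1)).1 = 0 := by
    rw [aForm_val, ← hg]
    simp [Fin.sum_univ_two, MvPolynomial.smul_eq_C_mul]
  have h2 := (Subtype.ext h1 : aForm (g 0) (g 1) = 0)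
  rw [← aForm_zero] at h2
  obtain ⟨h3, h4⟩ := aForm_inj h2
  intro i
  fin_cases i <;> assumption

theorem mem_span_monD {F : V} (hF : F.1 ∈ Submodule.span ℂ (Set.range monD)) :
    ∃ a b c d, F = dForm a b c d := by
  obtain ⟨k, hk⟩ := (Submodule.mem_span_range_iff_exists_fun ℂ).1 hF
  refine ⟨k 0, k 1, k 2, k 3, Subtype.ext ?_⟩
  rw [dForm_val, ← hk]
  simp [Fin.sum_univ_four, MvPolynomial.smul_eq_C_mul]

theorem mem_span_monA {F : V} (hF : F.1 ∈ Submodule.span ℂ (Set.range monA)) :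
    ∃ a b, F = aForm a b := by
  obtain ⟨k, hk⟩ := (Submodule.mem_span_range_iff_exists_fun ℂ).1 hF
  refine ⟨k 0, k 1, Subtype.ext ?_⟩
  rw [aForm_val, ← hk]
  simp [Fin.sum_univ_two, MvPolynomial.smul_eq_C_mul]

theorem mk_dForm_mem_spaceD {a b c d : ℂ} (h : dForm a b c d ≠ 0) :
    Projectivization.mk ℂ (dForm a b c d) h ∈ spaceD := by
  refine ⟨_, h, ?_, rfl⟩
  rw [dForm_val]
  simp only [← MvPolynomial.smul_eq_C_mul]
  have hm : ∀ k, monD k ∈ Submodule.span ℂ (Set.range monD) := fun k =>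
    Submodule.subset_span ⟨k, rfl⟩
  exact add_mem (add_mem (add_mem (Submodule.smul_mem _ _ (hm _)) (Submodule.smul_mem _ _ (hm _)))
    (Submodule.smul_mem _ _ (hm _))) (Submodule.smul_mem _ _ (hm _))

theorem mk_aForm_mem_spaceA {a b : ℂ} (h : aForm a b ≠ 0) :
    Projectivization.mk ℂ (aForm a b) h ∈ spaceA := by
  refine ⟨_, h, ?_, rfl⟩
  rw [aForm_val]
  simp only [← MvPolynomial.smul_eq_C_mul]
  have hm : ∀ k, monA k ∈ Submodule.span ℂ (Set.range monA) := fun k =>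
    Submodule.subset_span ⟨k, rfl⟩
  exact add_mem (Submodule.smul_mem _ _ (hm _)) (Submodule.smul_mem _ _ (hm _))

theorem mem_curvesD_iff {a b c d : ℂ} (h : dForm a b c d ≠ 0) :
    Projectivization.mk ℂ (dForm a b c d) h ∈ curvesD ↔ (a ≠ 0 ∨ b ≠ 0) ∧ (c ≠ 0 ∨ d ≠ 0) := by
  constructor
  · rintro ⟨-, hnot⟩
    rw [Set.mem_union, not_or] at hnot
    constructor
    · by_contra hcon
      push Not at hcon
      refine hnot.1 ⟨_, h, ⟨c, d, ?_⟩, rfl⟩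
      rw [dForm_val, hcon.1, hcon.2]
      simp
    · by_contra hcon
      push Not at hcon
      refine hnot.2 ⟨_, h, ⟨a, b, ?_⟩, rfl⟩
      rw [dForm_val, hcon.1, hcon.2]
      simp
  · rintro ⟨hab, hcd⟩
    refine ⟨mk_dForm_mem_spaceD h, ?_⟩
    rintro (⟨F, hF, ⟨c', d', hS⟩, heq⟩ | ⟨F, hF, ⟨a', b', hS⟩, heq⟩)
    · have hF' : F = dForm 0 0 c' d' := Subtype.ext (by rw [hS, dForm_val]; simp)
      obtain ⟨k, -, hk⟩ := (mk_eq_mk_iff_exists h hF).1 heq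
      rw [hF', smul_dForm] at hk
      obtain ⟨h1, h2, -, -⟩ := dForm_inj hk
      simp only [mul_zero] at h1 h2
      tauto
    · have hF' : F = dForm a' b' 0 0 := Subtype.ext (by rw [hS, dForm_val]; simp)
      obtain ⟨k, -, hk⟩ := (mk_eq_mk_iff_exists h hF).1 heq
      rw [hF', smul_dForm] at hk
      obtain ⟨-, -, h1, h2⟩ := dForm_inj hk
      simp only [mul_zero] at h1 h2
      tauto

theorem mem_curvesA_iff {a b : ℂ} (h : aForm a b ≠ 0) :
    Projectivization.mk ℂ (aForm a b) h ∈ curvesA ↔ a ≠ 0 ∧ b ≠ 0 := by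
  constructor
  · rintro ⟨-, hnot⟩
    rw [Set.mem_union, not_or] at hnot
    constructor
    · rintro rfl
      refine hnot.1 ⟨_, h, ⟨b, ?_⟩, rfl⟩
      rw [aForm_val]
      simp
    · rintro rfl
      refine hnot.2 ⟨_, h, ⟨a, ?_⟩, rfl⟩
      rw [aForm_val]
      simp
  · rintro ⟨ha, hb⟩
    refine ⟨mk_aForm_mem_spaceA h, ?_⟩
    rintro (⟨F, hF, ⟨b', hS⟩, heq⟩ | ⟨F, hF, ⟨a', hS⟩, heq⟩)
    · have hF' : F = aForm 0 b' := Subtype.ext (by rw [hS, aForm_val]; simp)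
      obtain ⟨k, -, hk⟩ := (mk_eq_mk_iff_exists h hF).1 heq
      rw [hF', smul_aForm] at hk
      have h1 := (aForm_inj hk).1
      simp only [mul_zero] at h1
      exact ha h1
    · have hF' : F = aForm a' 0 := Subtype.ext (by rw [hS, aForm_val]; simp)
      obtain ⟨k, -, hk⟩ := (mk_eq_mk_iff_exists h hF).1 heq
      rw [hF', smul_aForm] at hk
      have h1 := (aForm_inj hk).2
      simp only [mul_zero] at h1
      exact hb h1

theorem exists_of_mem_curvesD {x : XX} (hx : x ∈ curvesD) :
    ∃ a b c d, ∃ h : dForm a b c d ≠ 0, x = Projectivization.mk ℂ _ h ∧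
      (a ≠ 0 ∨ b ≠ 0) ∧ (c ≠ 0 ∨ d ≠ 0) := by
  obtain ⟨F, hF, hS, rfl⟩ := hx.1
  obtain ⟨a, b, c, d, rfl⟩ := mem_span_monD hS
  exact ⟨a, b, c, d, hF, rfl, (mem_curvesD_iff hF).1 hx⟩

theorem exists_of_mem_curvesA {x : XX} (hx : x ∈ curvesA) :
    ∃ a b, ∃ h : aForm a b ≠ 0, x = Projectivization.mk ℂ _ h ∧ a ≠ 0 ∧ b ≠ 0 := by
  obtain ⟨F, hF, hS, rfl⟩ := hx.1
  obtain ⟨a, b, rfl⟩ := mem_span_monA hS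
  exact ⟨a, b, hF, rfl, (mem_curvesA_iff hF).1 hx⟩

/-! ### Semistable fixed loci -/

theorem torusHom_apply (k : ℕ) (t : ℂˣ) : torusHom k t = tor t (t ^ k) := rfl

theorem evalAt_tor_smul (s t : ℂˣ) (F : V) (x y : Fin 2 → ℂ) :
    evalAt (tor s t • F) x y = evalAt F ![(s : ℂ)⁻¹ * x 0, s * x 1] ![(t : ℂ)⁻¹ * y 0, t * y 1] := by
  rw [tor, evalAt_pair_smul, ← map_inv, ← map_inv, diagSL_val, diagSL_val]
  congr 1 <;> ext i <;> fin_cases i <;> simp [mulVec, dotProduct, Fin.sum_univ_two]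

/-- The quadratic invariant does not vanish unless `9 a d + b c = 0`, the determinant does not vanish
unless `a b c d = 0`, and in the remaining cases the form is, up to the interchange of its two ends,
`b u² v + d v³` with `b d ≠ 0`, on which the quartic invariant does not vanish. -/
theorem isSemistableForm_dForm {a b c d : ℂ} (hab : a ≠ 0 ∨ b ≠ 0) (hcd : c ≠ 0 ∨ d ≠ 0) :
    IsSemistableForm (dForm a b c d) := by
  by_cases h1 : 9 * (a * d) + b * c = 0
  · by_cases h2 : a * d = 0
    · have h3 : b * c = 0 := by rw [h2, mul_zero, zero_add] at h1; exact h1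
      apply isSemistableForm_of_quartInv
      have h4 : quartInv (cf (dForm a b c d)) =
          576 * (a * c ^ 3 + b ^ 3 * d) + 2592 * (a * d) * (b * c) + 128 * (b * c) ^ 2 +
            (162 * (a * d) + 2 * (b * c)) ^ 2 := by
        simp [quartInv, hess, tr2, cf_dForm]
        ring
      rw [h4, h2, h3]
      rcases mul_eq_zero.1 h2 with rfl | rfl
      · have hb : b ≠ 0 := by simpa using hab
        have hc : c = 0 := by simpa [hb] using h3
        have hd : d ≠ 0 := by simpa [hc] using hcd
        simp [hb, hd]
      · have hc : c ≠ 0 := by simpa using hcd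
        have hb : b = 0 := by simpa [hc] using h3
        have ha : a ≠ 0 := by simpa [hb] using hab
        simp [ha, hc]
    · apply isSemistableForm_of_det
      have h3 : (Matrix.of (cf (dForm a b c d))).det = (a * d) * (b * c) := by
        have : Matrix.of (cf (dForm a b c d)) =
            !![0, 0, 0, d; 0, 0, c, 0; 0, b, 0, 0; a, 0, 0, 0] := by
          ext i j
          exact cf_dForm a b c d i j
        rw [this]
        simp [det_succ_row_zero, Fin.sum_univ_succ, Fin.succAbove]
        ring
      rw [h3, show b * c = -(9 * (a * d)) by linear_combination h1]
      simpa using h2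
  · apply isSemistableForm_of_quadInv
    have h2 : quadInv (cf (dForm a b c d)) = -(9 * (a * d) + b * c) := by
      simp [quadInv, cf_dForm]
      ring
    rw [h2]
    exact neg_ne_zero.2 h1

theorem isSemistableForm_aForm {a b : ℂ} (ha : a ≠ 0) (hb : b ≠ 0) :
    IsSemistableForm (aForm a b) := by
  apply isSemistableForm_of_quadInv
  have h2 : quadInv (cf (aForm a b)) = 3 * a * b := by
    simp [quadInv, cf_aForm]
  rw [h2]
  simp [ha, hb]

/-- All monomials of a form fixed up to scalars by the torus of weights `(1, k)` have the same
weight. -/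
theorem wt_eq_of_fixed {k : ℕ} {F : V} {c : ℂ} (h : torusHom k (expUnit 1) • F = c • F)
    {i j i' j' : Fin 4} (hij : cf F i j ≠ 0) (hij' : cf F i' j' ≠ 0) :
    wt 1 k i j = wt 1 k i' j' := by
  have hk : torusHom k (expUnit 1) = tor (expUnit (1 * 1)) (expUnit (k * 1)) := by
    rw [torusHom_apply, mul_one, mul_one]
    congr 1
    apply Units.ext
    simp [expUnit, ← Complex.exp_nat_mul]
  have h1 : ∀ i j, cf F i j ≠ 0 → ((Real.exp (-(wt 1 k i j * 1)) : ℝ) : ℂ) = c := by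
    intro i j hne
    have := congrArg (fun F => cf F i j) h
    simp only [hk] at this
    rw [cf_expUnit_smul, cf_smul] at this
    exact mul_right_cancel₀ hne this
  have h2 := (h1 i j hij).trans (h1 i' j' hij').symm
  have h3 := Real.exp_injective (Complex.ofReal_injective h2)
  linarith

theorem wt_eq_zero_of_fixed {k : ℕ} {F : V} (hF : IsSemistableForm F) {c : ℂ}
    (h : torusHom k (expUnit 1) • F = c • F) {i j : Fin 4} (hij : cf F i j ≠ 0) :
    wt 1 k i j = 0 := by
  by_contra hne
  rcases lt_or_gt_of_ne hne with hlt | hgt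
  · refine not_isSemistableForm_of_wt_pos (-1) (-k) (fun i' j' h' => ?_) hF
    have h1 := wt_eq_of_fixed h h' hij
    simp only [wt] at h1 hlt ⊢
    linarith
  · refine not_isSemistableForm_of_wt_pos 1 k (fun i' j' h' => ?_) hF
    have h1 := wt_eq_of_fixed h h' hij
    linarith

theorem eq_dForm_of_support {F : V} (h : ∀ i j, cf F i j ≠ 0 → (i : ℕ) + j = 3) :
    F = dForm (cf F 3 0) (cf F 2 1) (cf F 1 2) (cf F 0 3) := by
  apply ext_cf
  intro i j
  have h' : (i : ℕ) + j ≠ 3 → cf F i j = 0 := fun hne => by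
    by_contra hc
    exact hne (h i j hc)
  rw [cf_dForm]
  fin_cases i <;> fin_cases j <;> first | rfl | exact h' (by decide)

theorem eq_aForm_of_support {F : V}
    (h : ∀ i j, cf F i j ≠ 0 → (i = 3 ∧ j = 1) ∨ (i = 0 ∧ j = 2)) :
    F = aForm (cf F 3 1) (cf F 0 2) := by
  apply ext_cf
  intro i j
  have h' : ¬ ((i = 3 ∧ j = 1) ∨ (i = 0 ∧ j = 2)) → cf F i j = 0 := fun hne => by
    by_contra hc
    exact hne (h i j hc)
  rw [cf_aForm]
  fin_cases i <;> fin_cases j <;> first | rfl | exact h' (by decide)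

theorem support_of_wt_one {i j : Fin 4} (h : wt 1 (1 : ℕ) i j = 0) : (i : ℕ) + j = 3 := by
  have h1 : ((i : ℕ) : ℝ) + (j : ℕ) = 3 := by
    simp only [wt] at h
    push_cast at h
    linarith
  exact_mod_cast h1

theorem support_of_wt_three {i j : Fin 4} (h : wt 1 (3 : ℕ) i j = 0) :
    (i = 3 ∧ j = 1) ∨ (i = 0 ∧ j = 2) := by
  have h1 : ((i : ℕ) : ℝ) + 3 * (j : ℕ) = 6 := by
    simp only [wt] at h
    push_cast at h
    linarith
  have h2 : (i : ℕ) + 3 * (j : ℕ) = 6 := by exact_mod_cast h1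
  rw [Fin.ext_iff, Fin.ext_iff, Fin.ext_iff, Fin.ext_iff]
  change ((i : ℕ) = 3 ∧ (j : ℕ) = 1) ∨ ((i : ℕ) = 0 ∧ (j : ℕ) = 2)
  omega

theorem dForm_of_isSemistableForm {a b c d : ℂ} (h : IsSemistableForm (dForm a b c d)) :
    (a ≠ 0 ∨ b ≠ 0) ∧ (c ≠ 0 ∨ d ≠ 0) := by
  constructor
  · by_contra hcon
    push Not at hcon
    refine not_isSemistableForm_of_wt_pos (-1) 1 (fun i j hij => ?_) h
    rw [cf_dForm, hcon.1, hcon.2] at hij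
    fin_cases i <;> fin_cases j <;> simp at hij <;> norm_num [wt]
  · by_contra hcon
    push Not at hcon
    refine not_isSemistableForm_of_wt_pos 1 (-1) (fun i j hij => ?_) h
    rw [cf_dForm, hcon.1, hcon.2] at hij
    fin_cases i <;> fin_cases j <;> simp at hij <;> norm_num [wt]

theorem aForm_of_isSemistableForm {a b : ℂ} (h : IsSemistableForm (aForm a b)) :
    a ≠ 0 ∧ b ≠ 0 := by
  constructor
  · rintro rfl
    refine not_isSemistableForm_of_wt_pos (-1) 0 (fun i j hij => ?_) h
    rw [cf_aForm] at hij
    fin_cases i <;> fin_cases j <;> simp at hij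
    norm_num [wt]
  · rintro rfl
    refine not_isSemistableForm_of_wt_pos 1 0 (fun i j hij => ?_) h
    rw [cf_aForm] at hij
    fin_cases i <;> fin_cases j <;> simp at hij
    norm_num [wt]

theorem torusHom_one_smul_dForm (t : ℂˣ) (a b c d : ℂ) :
    torusHom 1 t • dForm a b c d = dForm a b c d := by
  apply ext_evalAt
  intro x y
  have ht : (t : ℂ) ≠ 0 := t.ne_zero
  rw [torusHom_apply, evalAt_tor_smul, evalAt_dForm, evalAt_dForm]
  simp
  field_simp

theorem torusHom_three_smul_aForm (t : ℂˣ) (a b : ℂ) :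
    torusHom 3 t • aForm a b = aForm a b := by
  apply ext_evalAt
  intro x y
  have ht : (t : ℂ) ≠ 0 := t.ne_zero
  rw [torusHom_apply, evalAt_tor_smul, evalAt_aForm, evalAt_aForm]
  simp
  field_simp

theorem ssFixedLocus_RD : ssFixedLocus RD = curvesD := by
  ext x
  constructor
  · induction x using Projectivization.ind with
    | h F hF =>
      rintro ⟨hss, hfix⟩
      rw [mk_mem_semistable] at hss
      obtain ⟨c, -, hc⟩ := (smul_mk_eq_iff _ hF).1 (hfix (torusHom 1 (expUnit 1)) ⟨_, rfl⟩)
      have hd := eq_dForm_of_support fun i j hij =>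
        support_of_wt_one (wt_eq_zero_of_fixed hss hc hij)
      generalize cf F 3 0 = a at hd
      generalize cf F 2 1 = b at hd
      generalize cf F 1 2 = c at hd
      generalize cf F 0 3 = d at hd
      subst hd
      exact (mem_curvesD_iff hF).2 (dForm_of_isSemistableForm hss)
  · intro hx
    obtain ⟨a, b, c, d, hF, rfl, hab, hcd⟩ := exists_of_mem_curvesD hx
    refine ⟨(mk_mem_semistable hF).2 (isSemistableForm_dForm hab hcd), ?_⟩
    rintro _ ⟨t, rfl⟩
    rw [smul_mk_eq_iff]
    exact ⟨1, one_ne_zero, by rw [torusHom_one_smul_dForm, one_smul]⟩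

theorem ssFixedLocus_RA : ssFixedLocus RA = curvesA := by
  ext x
  constructor
  · induction x using Projectivization.ind with
    | h F hF =>
      rintro ⟨hss, hfix⟩
      rw [mk_mem_semistable] at hss
      obtain ⟨c, -, hc⟩ := (smul_mk_eq_iff _ hF).1 (hfix (torusHom 3 (expUnit 1)) ⟨_, rfl⟩)
      have hd := eq_aForm_of_support fun i j hij =>
        support_of_wt_three (wt_eq_zero_of_fixed hss hc hij)
      generalize cf F 3 1 = a at hd
      generalize cf F 0 2 = b at hd
      subst hd
      exact (mem_curvesA_iff hF).2 (aForm_of_isSemistableForm hss)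
  · intro hx
    obtain ⟨a, b, hF, rfl, ha, hb⟩ := exists_of_mem_curvesA hx
    refine ⟨(mk_mem_semistable hF).2 (isSemistableForm_aForm ha hb), ?_⟩
    rintro _ ⟨t, rfl⟩
    rw [smul_mk_eq_iff]
    exact ⟨1, one_ne_zero, by rw [torusHom_three_smul_aForm, one_smul]⟩

theorem diagonalHom_apply (A : SL(2, ℂ)) : diagonalHom A = pair A A := rfl

theorem tripleConicForm_eq : tripleConicForm = dForm 1 (-3) 3 (-1) := by
  apply ext_evalAt
  intro x y
  rw [evalAt_dForm]
  simp [evalAt, tripleConicForm, xVar, yVar]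
  ring

theorem evalAt_tripleConicForm (x y : Fin 2 → ℂ) :
    evalAt tripleConicForm x y = (x 0 * y 1 - x 1 * y 0) ^ 3 := by
  simp [evalAt, tripleConicForm, xVar, yVar]

theorem diagonalHom_smul_tripleConicForm (A : SL(2, ℂ)) :
    diagonalHom A • tripleConicForm = tripleConicForm := by
  apply ext_evalAt
  intro x y
  rw [diagonalHom_apply, evalAt_pair_smul, evalAt_tripleConicForm, evalAt_tripleConicForm, sl_inv]
  have h := sl_det A
  simp only [mulVec, dotProduct, Fin.sum_univ_two, of_apply, cons_val_zero, cons_val_one,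
    cons_val', cons_val_fin_one]
  congr 1
  linear_combination (x 0 * y 1 - x 1 * y 0) * h

theorem RD_le_RC : RD ≤ RC := by
  rintro _ ⟨t, rfl⟩
  exact ⟨diagSL t, by rw [diagonalHom_apply, torusHom_apply, pow_one]; rfl⟩

/-- A point fixed by `RC` lies in the linear system of the D-curves, as it is fixed by the torus `RD`
and by the Weyl element; a unipotent element then fixes only the triple conic. -/
theorem fixedLocus_RC : fixedLocus RC = {tripleConic} := by
  ext x
  rw [Set.mem_singleton_iff]
  constructor
  · induction x using Projectivization.ind with
    | h F hF =>
      intro hfix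
      obtain ⟨c, -, hc⟩ := (smul_mk_eq_iff _ hF).1
        (hfix (torusHom 1 (expUnit 1)) (RD_le_RC ⟨_, rfl⟩))
      -- the Weyl element reverses the weights, so the common weight of all monomials is zero
      let w : SL(2, ℂ) := ⟨!![0, 1; -1, 0], by simp [det_fin_two]⟩
      obtain ⟨k, hk0, hk⟩ := (smul_mk_eq_iff _ hF).1 (hfix (diagonalHom w) ⟨_, rfl⟩)
      have hw : ∀ i j, cf (diagonalHom w • F) i j =
          (-1) ^ (i + j : ℕ) * cf F (Fin.rev i) (Fin.rev j) := by
        intro i j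
        have h : diagonalHom w • F = ofCf fun i j =>
            (-1) ^ (i + j : ℕ) * cf F (Fin.rev i) (Fin.rev j) := by
          apply eq_ofCf_of_evalAt
          intro x y
          rw [diagonalHom_apply, evalAt_pair_smul, evalAt_eq, sl_inv]
          simp [mulVec, dotProduct, Fin.sum_univ_two, Fin.sum_univ_four, w, Fin.rev]
          ring
        rw [h, cf_ofCf]
      have hsupp : ∀ i j, cf F i j ≠ 0 → (i : ℕ) + j = 3 := by
        intro i j hij
        have h1 : cf F (Fin.rev i) (Fin.rev j) ≠ 0 := by
          intro h0
          have h2 := hw i j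
          rw [hk, h0, mul_zero, cf_smul] at h2
          exact mul_ne_zero hk0 hij h2
        have h3 := wt_eq_of_fixed hc hij h1
        have hrev : ∀ i : Fin 4, ((Fin.rev i : ℕ) : ℝ) = 3 - (i : ℕ) := by
          intro i
          rw [Fin.val_rev, Nat.cast_sub (by omega)]
          push_cast
          ring
        simp only [wt, hrev] at h3
        have h4 : ((i : ℕ) : ℝ) + (j : ℕ) = 3 := by
          push_cast at h3
          linarith
        exact_mod_cast h4
      have hd := eq_dForm_of_support hsupp
      generalize cf F 3 0 = a at hd
      generalize cf F 2 1 = b at hd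
      generalize cf F 1 2 = c at hd
      generalize cf F 0 3 = d at hd
      subst hd
      obtain ⟨χ, hχ0, hχ⟩ := (smul_mk_eq_iff _ hF).1 (hfix (diagonalHom (upper (-1))) ⟨_, rfl⟩)
      -- invariance under the unipotent subgroup, at the points `(t, 1; 0, 1)`
      have key : ∀ t : ℂ, a * (t + 1) ^ 3 + b * (t + 1) ^ 2 + c * (t + 1) + d = χ * a * t ^ 3 := by
        intro t
        have := congrArg (fun F => evalAt F ![t, 1] ![0, 1]) hχ
        simp only [diagonalHom_apply, evalAt_pair_smul, evalAt_smul, evalAt_dForm,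
          upper_inv] at this
        simp [mulVec, dotProduct, Fin.sum_univ_two] at this
        linear_combination this
      have e0 := key 0
      have e1 := key 1
      have e2 := key (-1)
      have e3 := key (-2)
      have hd : d = -a := by linear_combination (e1 - 3 * e0 + 3 * e2 - e3) / 6 + e2
      have hb : b = -3 * a := by linear_combination (e1 - 2 * e0 + e2) / 2
      have hc' : c = 3 * a := by linear_combination e0 - hb - hd
      have ha : a ≠ 0 := by
        rintro rfl
        apply hF
        rw [hb, hc', hd]
        simpa using dForm_zero
      rw [tripleConic, mk_eq_mk_iff_exists]
      refine ⟨a, ha, ?_⟩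
      rw [tripleConicForm_eq, smul_dForm, hb, hc', hd]
      congr 1 <;> ring
  · rintro rfl
    rintro _ ⟨A, rfl⟩
    rw [tripleConic, smul_mk_eq_iff]
    exact ⟨1, one_ne_zero, by rw [diagonalHom_smul_tripleConicForm, one_smul]⟩

theorem isSemistableForm_tripleConicForm : IsSemistableForm tripleConicForm := by
  rw [tripleConicForm_eq]
  exact isSemistableForm_dForm (Or.inl one_ne_zero) (Or.inl (by norm_num))

theorem ssFixedLocus_RC : ssFixedLocus RC = {tripleConic} := by
  ext x
  constructor
  · rintro ⟨-, hx⟩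
    rw [← fixedLocus_RC]
    exact hx
  · rintro rfl
    refine ⟨(mk_mem_semistable _).2 isSemistableForm_tripleConicForm, ?_⟩
    have : tripleConic ∈ fixedLocus RC := by rw [fixedLocus_RC]; rfl
    exact this

theorem tripleConic_mem_curvesD : tripleConic ∈ curvesD := by
  rw [← ssFixedLocus_RD]
  have h : tripleConic ∈ ssFixedLocus RC := by rw [ssFixedLocus_RC]; rfl
  exact ⟨h.1, fun r hr => h.2 r (RD_le_RC hr)⟩

/-! ### Topology of the group and identity components -/

theorem continuous_entry (i j : Idx) : Continuous fun g : G => (toGL g : Matrix Idx Idx ℂ) i j :=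
  (Units.continuous_val.comp continuous_induced_dom).matrix_elem i j

theorem continuous_group_of_entries {Y : Type*} [TopologicalSpace Y] {φ : Y → G}
    (h : ∀ i j, Continuous fun y => (toGL (φ y) : Matrix Idx Idx ℂ) i j)
    (h' : ∀ i j, Continuous fun y => (toGL (φ y)⁻¹ : Matrix Idx Idx ℂ) i j) : Continuous φ := by
  rw [continuous_induced_rng, Units.continuous_iff]
  refine ⟨continuous_matrix h, continuous_matrix fun i j => ?_⟩
  have := h' i j
  simp only [map_inv] at this
  exact this

theorem continuous_pair {Y : Type*} [TopologicalSpace Y] {α β : Y → SL(2, ℂ)}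
    (hα : ∀ i j, Continuous fun y => (α y).1 i j) (hβ : ∀ i j, Continuous fun y => (β y).1 i j) :
    Continuous fun y => pair (α y) (β y) := by
  have hinv : ∀ {γ : Y → SL(2, ℂ)}, (∀ i j, Continuous fun y => (γ y).1 i j) →
      ∀ i j, Continuous fun y => ((γ y)⁻¹).1 i j := by
    intro γ hγ i j
    simp only [sl_inv]
    fin_cases i <;> fin_cases j <;> simp
    · exact hγ 1 1
    · exact (hγ 0 1).neg
    · exact (hγ 1 0).neg
    · exact hγ 0 0
  have key : ∀ {γ δ : Y → SL(2, ℂ)}, (∀ i j, Continuous fun y => (γ y).1 i j) →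
      (∀ i j, Continuous fun y => (δ y).1 i j) →
      ∀ i j, Continuous fun y => (toGL (pair (γ y) (δ y)) : Matrix Idx Idx ℂ) i j := by
    intro γ δ hγ hδ i j
    simp only [toGL_pair]
    rcases i with i | i <;> rcases j with j | j
    · exact hγ i j
    · exact continuous_const
    · exact continuous_const
    · exact hδ i j
  refine continuous_group_of_entries (key hα hβ) ?_
  simp only [pair_inv]
  exact key (hinv hα) (hinv hβ)

theorem identityComponent_le (H : Subgroup G) : identityComponent H ≤ H := by
  rintro _ ⟨h, -, rfl⟩
  exact h.2

theorem isPreconnected_identityComponent (H : Subgroup G) :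
    IsPreconnected (identityComponent H : Set G) := by
  have h : (identityComponent H : Set G) = Subtype.val '' connectedComponent (1 : H) := rfl
  rw [h]
  exact isPreconnected_connectedComponent.image _ continuous_subtype_val.continuousOn

theorem le_identityComponent {H K : Subgroup G} (hKH : K ≤ H) (hK : IsPreconnected (K : Set G)) :
    K ≤ identityComponent H := by
  intro k hk
  have h1 : IsPreconnected ((K.subgroupOf H : Subgroup H) : Set H) := by
    have h2 : (Subtype.val : H → G) '' ((K.subgroupOf H : Subgroup H) : Set H) = K := by
      ext x
      constructor
      · rintro ⟨y, hy, rfl⟩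
        exact hy
      · intro hx
        exact ⟨⟨x, hKH hx⟩, hx, rfl⟩
    refine (Topology.IsInducing.subtypeVal.isPreconnected_image).1 ?_
    convert hK using 1
    exact h2
  exact ⟨⟨k, hKH hk⟩, h1.subset_connectedComponent (one_mem _) hk, rfl⟩

/-- A closed subgroup of finite index is open, hence contains the identity component. -/
theorem identityComponent_le_of_finite_relIndex {H K : Subgroup G} (hK : IsClosed (K : Set G))
    (hfin : K.relIndex H ≠ 0) : identityComponent H ≤ K := by
  have h1 : IsClosed ((K.subgroupOf H : Subgroup H) : Set H) :=
    hK.preimage continuous_subtype_val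
  have h2 : (K.subgroupOf H).FiniteIndex := ⟨hfin⟩
  have h3 : IsClopen ((K.subgroupOf H : Subgroup H) : Set H) :=
    ⟨h1, (K.subgroupOf H).isOpen_of_isClosed_of_finiteIndex h1⟩
  rintro _ ⟨h, hh, rfl⟩
  exact h3.connectedComponent_subset (one_mem _) hh

/-- If the cosets of `K` in `H` are separated by a function with finite range, then `K` has finite
index in `H`. -/
theorem relIndex_ne_zero_of_finite {H K : Subgroup G} {ι : Type*} (S : Set ι) (hS : S.Finite)
    (φ : G → ι) (hφ : ∀ h ∈ H, φ h ∈ S)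
    (hsep : ∀ h ∈ H, ∀ h' ∈ H, φ h = φ h' → h⁻¹ * h' ∈ K) : K.relIndex H ≠ 0 := by
  have hfin : Finite (H ⧸ K.subgroupOf H) := by
    have := hS.to_subtype
    let ψ : H ⧸ K.subgroupOf H → S := fun q => ⟨φ q.out, hφ _ q.out.2⟩
    refine Finite.of_injective ψ fun q q' hqq => ?_
    have h1 := hsep _ q.out.2 _ q'.out.2 (congrArg Subtype.val hqq)
    rw [← Quotient.out_eq' q, ← Quotient.out_eq' q']
    exact QuotientGroup.eq.2 (Subgroup.mem_subgroupOf.2 h1)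
  exact (Subgroup.finiteIndex_of_finite_quotient (H := K.subgroupOf H)).index_ne_zero

theorem mem_conjSubgroup {g x : G} {H : Subgroup G} :
    x ∈ conjSubgroup g H ↔ g⁻¹ * x * g ∈ H := by
  constructor
  · rintro ⟨h, hh, rfl⟩
    change g⁻¹ * (g * h * g⁻¹) * g ∈ H
    have : g⁻¹ * (g * h * g⁻¹) * g = h := by group
    rw [this]
    exact hh
  · intro h
    refine ⟨_, h, ?_⟩
    change g * (g⁻¹ * x * g) * g⁻¹ = x
    group

theorem conjSubgroup_mul (g g' : G) (H : Subgroup G) :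
    conjSubgroup (g * g') H = conjSubgroup g (conjSubgroup g' H) := by
  ext x
  simp only [mem_conjSubgroup, _root_.mul_inv_rev, mul_assoc]

theorem conjSubgroup_one (H : Subgroup G) : conjSubgroup 1 H = H := by
  ext x
  simp [mem_conjSubgroup]

theorem conjSubgroup_inv_conjSubgroup (g : G) (H : Subgroup G) :
    conjSubgroup g⁻¹ (conjSubgroup g H) = H := by
  rw [← conjSubgroup_mul, inv_mul_cancel, conjSubgroup_one]

theorem conjSubgroup_mono (g : G) {H K : Subgroup G} (h : H ≤ K) :
    conjSubgroup g H ≤ conjSubgroup g K := Subgroup.map_mono h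

theorem isPreconnected_conjSubgroup (g : G) {H : Subgroup G} (h : IsPreconnected (H : Set G)) :
    IsPreconnected (conjSubgroup g H : Set G) := by
  refine h.image _ (Continuous.continuousOn ?_)
  change Continuous fun x => g * x * g⁻¹
  fun_prop

theorem identityComponent_conjSubgroup (g : G) (H : Subgroup G) :
    identityComponent (conjSubgroup g H) = conjSubgroup g (identityComponent H) := by
  have key : ∀ (g : G) (H : Subgroup G),
      conjSubgroup g (identityComponent H) ≤ identityComponent (conjSubgroup g H) := fun g H =>
    le_identityComponent (conjSubgroup_mono g (identityComponent_le H))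
      (isPreconnected_conjSubgroup g (isPreconnected_identityComponent H))
  refine le_antisymm ?_ (key g H)
  have h1 := conjSubgroup_mono g (key g⁻¹ (conjSubgroup g H))
  rw [conjSubgroup_inv_conjSubgroup, ← conjSubgroup_mul, mul_inv_cancel, conjSubgroup_one] at h1
  exact h1

theorem identityComponent_stabilizer_smul (g : G) (x : XX) :
    identityComponent (MulAction.stabilizer G (g • x)) =
      conjSubgroup g (identityComponent (MulAction.stabilizer G x)) := by
  rw [MulAction.stabilizer_smul_eq_stabilizer_map_conj]
  exact identityComponent_conjSubgroup g _

/-! ### Connectedness and closedness of the three subgroups -/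

theorem isPreconnected_range_torusHom (k : ℕ) :
    IsPreconnected ((torusHom k).range : Set G) := by
  let e : ℂ → ℂˣ := fun z => Units.mk0 (Complex.exp z) (Complex.exp_ne_zero z)
  have h1 : ((torusHom k).range : Set G) = Set.range fun z => torusHom k (e z) := by
    ext g
    constructor
    · rintro ⟨t, rfl⟩
      refine ⟨Complex.log t, ?_⟩
      have : e (Complex.log t) = t := Units.ext (Complex.exp_log t.ne_zero)
      simp only [this]
    · rintro ⟨z, rfl⟩
      exact ⟨_, rfl⟩
  have h2 : Continuous fun z => torusHom k (e z) := by
    change Continuous fun z => pair (diagSL (e z)) (diagSL (e z ^ k))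
    have hinv : ∀ z, ((e z)⁻¹ : ℂˣ).1 = Complex.exp (-z) := fun z => by
      simp [e, Complex.exp_neg]
    have hval : ∀ z, (e z).1 = Complex.exp z := fun z => rfl
    refine continuous_pair (fun i j => ?_) (fun i j => ?_) <;> simp only [diagSL_val] <;>
      fin_cases i <;> fin_cases j <;> simp [hinv, hval, ← inv_pow] <;> fun_prop
  rw [h1]
  exact isPreconnected_range h2

theorem isPreconnected_RD : IsPreconnected (RD : Set G) := isPreconnected_range_torusHom 1

theorem isPreconnected_RA : IsPreconnected (RA : Set G) := isPreconnected_range_torusHom 3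

theorem isPreconnected_RC : IsPreconnected (RC : Set G) := by
  have hu : Continuous fun s => diagonalHom (upper s) := by
    change Continuous fun s => pair (upper s) (upper s)
    refine continuous_pair (fun i j => ?_) (fun i j => ?_) <;> simp only [upper] <;>
      fin_cases i <;> fin_cases j <;> simp <;> fun_prop
  have hl : Continuous fun s => diagonalHom (lower s) := by
    change Continuous fun s => pair (lower s) (lower s)
    refine continuous_pair (fun i j => ?_) (fun i j => ?_) <;> simp only [lower] <;>
      fin_cases i <;> fin_cases j <;> simp <;> fun_prop
  have h1 : (RC : Set G) = Set.range fun p : ℂ × ℂ × ℂ × ℂ =>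
      diagonalHom (upper p.1) * diagonalHom (lower p.2.1) * diagonalHom (upper p.2.2.1) *
        diagonalHom (lower p.2.2.2) := by
    ext g
    constructor
    · rintro ⟨A, rfl⟩
      obtain ⟨a, b, c, d, rfl⟩ := exists_eq_elementary A
      exact ⟨(a, b, c, d), by simp only [map_mul]⟩
    · rintro ⟨p, rfl⟩
      exact ⟨upper p.1 * lower p.2.1 * upper p.2.2.1 * lower p.2.2.2, by simp only [map_mul]⟩
  rw [h1]
  refine isPreconnected_range ?_
  exact ((((hu.comp (by fun_prop)).mul (hl.comp (by fun_prop))).mul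
    (hu.comp (by fun_prop))).mul (hl.comp (by fun_prop)))

theorem toGL_pair_sw (A B : SL(2, ℂ)) :
    (toGL (pair A B * sw) : Matrix Idx Idx ℂ) = fromBlocks 0 A.1 B.1 0 := by
  rw [map_mul, Units.val_mul, toGL_pair, toGL_sw, fromBlocks_multiply]
  simp

theorem eq_pair_of_block {g : G}
    (h : ∀ i j, (toGL g : Matrix Idx Idx ℂ) (Sum.inl i) (Sum.inr j) = 0) :
    ∃ A B, g = pair A B := by
  obtain ⟨A, B, rfl | rfl⟩ := eq_pair_or g
  · exact ⟨A, B, rfl⟩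
  · exfalso
    rw [toGL_pair_sw] at h
    have h1 := sl_det A
    have h2 : ∀ i j, A.1 i j = 0 := h
    simp [h2] at h1

theorem exists_diagSL {A : SL(2, ℂ)} (h1 : A.1 0 1 = 0) (h2 : A.1 1 0 = 0) :
    ∃ s, A = diagSL s := by
  have hdet := sl_det A
  rw [h1, zero_mul, sub_zero] at hdet
  refine ⟨⟨A.1 0 0, A.1 1 1, hdet, by rwa [mul_comm]⟩, ?_⟩
  apply Subtype.ext
  rw [diagSL_val]
  ext i j
  fin_cases i <;> fin_cases j
  · rfl
  · exact h1
  · exact h2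
  · rfl

theorem isClosed_block :
    IsClosed {g : G | ∀ i j, (toGL g : Matrix Idx Idx ℂ) (Sum.inl i) (Sum.inr j) = 0} := by
  simp only [Set.ofPred_forall]
  exact isClosed_iInter fun i => isClosed_iInter fun j =>
    isClosed_eq (continuous_entry _ _) continuous_const

theorem isClosed_range_torusHom (k : ℕ) : IsClosed ((torusHom k).range : Set G) := by
  have h1 : ((torusHom k).range : Set G) =
      {g : G | ∀ i j, (toGL g : Matrix Idx Idx ℂ) (Sum.inl i) (Sum.inr j) = 0} ∩
      ({g : G | (toGL g : Matrix Idx Idx ℂ) (Sum.inl 0) (Sum.inl 1) = 0} ∩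
      ({g : G | (toGL g : Matrix Idx Idx ℂ) (Sum.inl 1) (Sum.inl 0) = 0} ∩
      ({g : G | (toGL g : Matrix Idx Idx ℂ) (Sum.inr 0) (Sum.inr 1) = 0} ∩
      ({g : G | (toGL g : Matrix Idx Idx ℂ) (Sum.inr 1) (Sum.inr 0) = 0} ∩
      {g : G | (toGL g : Matrix Idx Idx ℂ) (Sum.inr 0) (Sum.inr 0) =
        (toGL g : Matrix Idx Idx ℂ) (Sum.inl 0) (Sum.inl 0) ^ k})))) := by
    ext g
    constructor
    · rintro ⟨t, rfl⟩
      simp only [Set.mem_inter_iff, Set.mem_ofPred_eq, torusHom_apply, tor, toGL_pair, diagSL_val]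
      simp
    · rintro ⟨h0, h1, h2, h3, h4, h5⟩
      obtain ⟨A, B, rfl⟩ := eq_pair_of_block h0
      rw [Set.mem_ofPred_eq, toGL_pair] at h1 h2 h3 h4 h5
      obtain ⟨s, rfl⟩ := exists_diagSL h1 h2
      obtain ⟨t, rfl⟩ := exists_diagSL h3 h4
      have h6 : (t : ℂ) = (s : ℂ) ^ k := h5
      have h7 : t = s ^ k := Units.ext (by rw [h6, Units.val_pow_eq_pow_val])
      exact ⟨s, by rw [h7]; rfl⟩
  have hc : ∀ i j, IsClosed {g : G | (toGL g : Matrix Idx Idx ℂ) i j = 0} := fun i j =>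
    isClosed_eq (continuous_entry i j) continuous_const
  rw [h1]
  exact isClosed_block.inter ((hc _ _).inter ((hc _ _).inter ((hc _ _).inter ((hc _ _).inter
    (isClosed_eq (continuous_entry _ _) ((continuous_entry _ _).pow k))))))

theorem isClosed_RC : IsClosed (RC : Set G) := by
  have h1 : (RC : Set G) =
      {g : G | ∀ i j, (toGL g : Matrix Idx Idx ℂ) (Sum.inl i) (Sum.inr j) = 0} ∩
      {g : G | ∀ i j, (toGL g : Matrix Idx Idx ℂ) (Sum.inl i) (Sum.inl j) =
        (toGL g : Matrix Idx Idx ℂ) (Sum.inr i) (Sum.inr j)} := by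
    ext g
    constructor
    · rintro ⟨A, rfl⟩
      simp only [Set.mem_inter_iff, Set.mem_ofPred_eq, diagonalHom_apply, toGL_pair]
      simp
    · rintro ⟨h0, h1⟩
      obtain ⟨A, B, rfl⟩ := eq_pair_of_block h0
      rw [Set.mem_ofPred_eq, toGL_pair] at h1
      have h2 : A = B := Subtype.ext (by ext i j; exact h1 i j)
      exact ⟨A, by rw [h2]; rfl⟩
  rw [h1]
  refine isClosed_block.inter ?_
  simp only [Set.ofPred_forall]
  exact isClosed_iInter fun i => isClosed_iInter fun j =>
    isClosed_eq (continuous_entry _ _) (continuous_entry _ _)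

/-! ### Infinitesimal stabilisers -/

/-- The derivative of `F` along the linear vector field `ξ`, at the point `z`. -/
def lieAt (ξ : Matrix Idx Idx ℂ) (F : V) (z : Idx → ℂ) : ℂ :=
  (aeval (dualPoint z (ξ *ᵥ z)) F.1).snd

/-- The linear vector field `ξ` preserves the line spanned by `F`. -/
def IsInfStab (ξ : Matrix Idx Idx ℂ) (F : V) : Prop :=
  ∃ c : ℂ, ∀ z, lieAt ξ F z = c * eval z F.1

theorem matrix_dualPoint (M : Matrix Idx Idx ℂ) (p η : Idx → ℂ) :
    (fun i => ∑ j, algebraMap ℂ (DualNumber ℂ) (M i j) * dualPoint p η j) =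
      dualPoint (M *ᵥ p) (M *ᵥ η) := by
  funext i
  apply TrivSqZeroExt.ext
  · simp [dualPoint, mulVec, dotProduct, TrivSqZeroExt.algebraMap_eq_inl]
  · simp [dualPoint, mulVec, dotProduct, TrivSqZeroExt.algebraMap_eq_inl]

theorem toGL_inv_mul (g : G) :
    (toGL g⁻¹ : Matrix Idx Idx ℂ) * (toGL g : Matrix Idx Idx ℂ) = 1 := by
  rw [← Units.val_mul, ← map_mul, inv_mul_cancel, map_one, Units.val_one]

theorem IsInfStab.smul {ξ : Matrix Idx Idx ℂ} {F : V} (h : IsInfStab ξ F) (g : G) :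
    IsInfStab ((toGL g : Matrix Idx Idx ℂ) * ξ * (toGL g⁻¹ : Matrix Idx Idx ℂ)) (g • F) := by
  obtain ⟨c, hc⟩ := h
  refine ⟨c, fun z => ?_⟩
  rw [smul_val, eval_linSubst, ← hc, lieAt, lieAt, smul_val, aeval_linSubst, matrix_dualPoint]
  congr 4
  rw [mulVec_mulVec, mulVec_mulVec, ← mul_assoc, ← mul_assoc, toGL_inv_mul, one_mul]

theorem IsInfStab.of_smul_eq {ξ : Matrix Idx Idx ℂ} {F F' : V} {k : ℂ} (hk : k ≠ 0)
    (h : IsInfStab ξ F) (hF : F = k • F') : IsInfStab ξ F' := by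
  obtain ⟨c, hc⟩ := h
  refine ⟨c, fun z => ?_⟩
  have := hc z
  rw [hF] at this
  simp only [lieAt, Submodule.coe_smul, map_smul, TrivSqZeroExt.snd_smul, smul_eval,
    smul_eq_mul] at this
  apply mul_left_cancel₀ hk
  rw [lieAt, this]
  ring

/-- The action of the pair of traceless matrices `(a, b; c, -a)` and `(a', b'; c', -a')` on the
coefficients of a form. Coefficients with an index outside `0, …, 3` are multiplied by zero. -/
def lieCf (a b c a' b' c' : ℂ) (f : Fin 4 → Fin 4 → ℂ) (i j : Fin 4) : ℂ :=
  ((2 * (i : ℕ) - 3) * a + (2 * (j : ℕ) - 3) * a') * f i j +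
    ![1 * b * f 1 j, 2 * b * f 2 j, 3 * b * f 3 j, 0] i +
    ![0, 3 * c * f 0 j, 2 * c * f 1 j, 1 * c * f 2 j] i +
    ![1 * b' * f i 1, 2 * b' * f i 2, 3 * b' * f i 3, 0] j +
    ![0, 3 * c' * f i 0, 2 * c' * f i 1, 1 * c' * f i 2] j

theorem lieAt_eq (a b c a' b' c' : ℂ) (F : V) (x y : Fin 2 → ℂ) :
    lieAt (fromBlocks !![a, b; c, -a] 0 0 !![a', b'; c', -a']) F (Sum.elim x y) =
      evalAt (ofCf (lieCf a b c a' b' c' (cf F))) x y := by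
  rw [lieAt, aeval_form, evalAt_ofCf, fromBlocks_mulVec]
  simp [Fin.sum_univ_four, TrivSqZeroExt.algebraMap_eq_inl, dualPoint, dotProduct,
    Fin.sum_univ_two, lieCf, pow_succ, Function.comp_def]
  ring

theorem IsInfStab.lieCf_eq {a b c a' b' c' : ℂ} {F : V}
    (h : IsInfStab (fromBlocks !![a, b; c, -a] 0 0 !![a', b'; c', -a']) F) :
    ∃ k : ℂ, ∀ i j, lieCf a b c a' b' c' (cf F) i j = k * cf F i j := by
  obtain ⟨k, hk⟩ := h
  refine ⟨k, fun i j => ?_⟩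
  have h1 : ofCf (lieCf a b c a' b' c' (cf F)) = k • F := ext_evalAt fun x y => by
    rw [← lieAt_eq, hk, evalAt_smul]
    rfl
  have h2 := congrArg (fun F => cf F i j) h1
  simpa using h2

/-- The converse of `IsInfStab.lieCf_eq`. -/
theorem isInfStab_of_lieCf_eq {a b c a' b' c' : ℂ} {F : V} {k : ℂ}
    (h : ∀ i j, lieCf a b c a' b' c' (cf F) i j = k * cf F i j) :
    IsInfStab (fromBlocks !![a, b; c, -a] 0 0 !![a', b'; c', -a']) F := by
  refine ⟨k, fun z => ?_⟩
  have hz : Sum.elim (fun i => z (Sum.inl i)) (fun i => z (Sum.inr i)) = z := by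
    ext k; rcases k with k | k <;> rfl
  have h1 : ofCf (lieCf a b c a' b' c' (cf F)) = k • F := ext_cf fun i j => by
    rw [cf_ofCf, h, cf_smul]
  rw [← hz, lieAt_eq, h1, evalAt_smul]
  rfl

/-! ### Infinite stabilisers have nonzero infinitesimal stabilisers -/

/-- The subgroup `G⁰` has index two, so an infinite stabiliser meets it in an infinite group. -/
theorem infinite_pairs_of_infinite_stabilizer {x : XX}
    (h : Infinite (MulAction.stabilizer G x)) :
    {p : SL(2, ℂ) × SL(2, ℂ) | pair p.1 p.2 ∈ MulAction.stabilizer G x}.Infinite := by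
  intro hfin
  have h0 := hfin.image fun p => pair p.1 p.2
  have hS : ((MulAction.stabilizer G x : Subgroup G) : Set G).Finite := by
    by_cases hs : ∃ A B, pair A B * sw ∈ MulAction.stabilizer G x
    · obtain ⟨A, B, hAB⟩ := hs
      refine (h0.union (h0.image fun g => g * (pair A B * sw))).subset fun g hg => ?_
      obtain ⟨A', B', rfl | rfl⟩ := eq_pair_or g
      · exact Or.inl ⟨(A', B'), hg, rfl⟩
      · right
        have hmem := mul_mem hg (inv_mem hAB)
        have heq : pair A' B' * sw * (pair A B * sw)⁻¹ = pair (A' * A⁻¹) (B' * B⁻¹) := by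
          rw [_root_.mul_inv_rev, mul_assoc, mul_inv_cancel_left, pair_inv, pair_mul]
        rw [heq] at hmem
        refine ⟨_, ⟨(A' * A⁻¹, B' * B⁻¹), hmem, rfl⟩, ?_⟩
        change pair (A' * A⁻¹) (B' * B⁻¹) * (pair A B * sw) = _
        rw [← heq, inv_mul_cancel_right]
    · push Not at hs
      refine h0.subset fun g hg => ?_
      obtain ⟨A', B', rfl | rfl⟩ := eq_pair_or g
      · exact ⟨(A', B'), hg, rfl⟩
      · exact absurd hg (hs A' B')
  exact Set.infinite_coe_iff.1 h hS

theorem trace_sl_inv_mul (A : SL(2, ℂ)) (N : Matrix (Fin 2) (Fin 2) ℂ) :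
    ((A⁻¹).1 * N).trace =
      A.1 1 1 * N 0 0 - A.1 0 1 * N 1 0 - A.1 1 0 * N 0 1 + A.1 0 0 * N 1 1 := by
  rw [sl_inv, trace_fin_two]
  simp [mul_apply, Fin.sum_univ_two]
  ring

/-- A point of `X` with infinite stabiliser is fixed by a nonzero element of the Lie algebra
`sl₂ × sl₂`. -/
theorem exists_isInfStab_of_infinite {F : V} (hF : F ≠ 0)
    (h : Infinite (MulAction.stabilizer G (Projectivization.mk ℂ F hF))) :
    ∃ P Q : Matrix (Fin 2) (Fin 2) ℂ, P.trace = 0 ∧ Q.trace = 0 ∧ (P ≠ 0 ∨ Q ≠ 0) ∧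
      IsInfStab (fromBlocks P 0 0 Q) F := by
  set S : Set (SL(2, ℂ) × SL(2, ℂ)) :=
    {p | pair p.1 p.2 ∈ MulAction.stabilizer G (Projectivization.mk ℂ F hF)} with hS
  have hSinf : S.Infinite := infinite_pairs_of_infinite_stabilizer h
  let ψ : SL(2, ℂ) × SL(2, ℂ) → Idx × Idx → ℂ := fun p k => fromBlocks p.1.1 0 0 p.2.1 k.1 k.2
  have hψ : Function.Injective ψ := by
    intro p q hpq
    have h1 : fromBlocks p.1.1 0 0 p.2.1 = fromBlocks q.1.1 0 0 q.2.1 := by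
      ext i j
      exact congrFun hpq (i, j)
    rw [fromBlocks_inj] at h1
    exact Prod.ext (Subtype.ext h1.1) (Subtype.ext h1.2.2.2)
  let I : Ideal (MvPolynomial (Idx × Idx) ℂ) := vanishingIdeal ℂ (ψ '' S)
  have hZ : (zeroLocus ℂ I).Infinite := by
    refine (hSinf.image hψ.injOn).mono ?_
    intro p hp f hf
    exact hf p hp
  obtain ⟨p, -, η, hη0, hη⟩ := exists_tangent_of_infinite I hZ
  have hI : ∀ f : MvPolynomial (Idx × Idx) ℂ, (∀ s ∈ S, eval (ψ s) f = 0) → f ∈ I := by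
    rintro f hf _ ⟨s, hs, rfl⟩
    rw [aeval_eq_eval]
    exact hf s hs
  have hp0 : ∀ f ∈ I, eval p f = 0 := fun f hf => by
    rw [← fst_aeval_dualPoint p η f, hη f hf, TrivSqZeroExt.fst_zero]
  -- the off-diagonal blocks vanish
  have hoff : ∀ i j, (X (Sum.inl i, Sum.inr j) : MvPolynomial (Idx × Idx) ℂ) ∈ I := fun i j =>
    hI _ fun s _ => by simp [ψ]
  have hoff' : ∀ i j, (X (Sum.inr i, Sum.inl j) : MvPolynomial (Idx × Idx) ℂ) ∈ I := fun i j =>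
    hI _ fun s _ => by simp [ψ]
  -- the diagonal blocks have determinant one
  have hdet : ∀ e : Fin 2 → Idx, (e = Sum.inl ∨ e = Sum.inr) →
      (X (e 0, e 0) * X (e 1, e 1) - X (e 0, e 1) * X (e 1, e 0) - 1 :
        MvPolynomial (Idx × Idx) ℂ) ∈ I := by
    rintro e (rfl | rfl)
    · refine hI _ fun s _ => ?_
      have := sl_det s.1
      simp [ψ, this]
    · refine hI _ fun s _ => ?_
      have := sl_det s.2
      simp [ψ, this]
  -- the form is preserved up to a factor
  let Φ : (Idx → ℂ) → MvPolynomial (Idx × Idx) ℂ := fun z =>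
    aeval (fun i => ∑ j, X (i, j) * C (z j)) F.1
  have hΦ : ∀ z z₀, Φ z * C (eval z₀ F.1) - Φ z₀ * C (eval z F.1) ∈ I := by
    intro z z₀
    refine hI _ fun s hs => ?_
    have hev : ∀ z, eval (ψ s) (Φ z) = eval (fromBlocks s.1.1 0 0 s.2.1 *ᵥ z) F.1 := by
      intro z
      rw [← aeval_eq_eval, ← aeval_eq_eval]
      change (aeval (ψ s)) (aeval _ F.1) = _
      rw [← AlgHom.comp_apply, comp_aeval]
      congr 2
      funext i
      simp [ψ, mulVec, dotProduct]
    obtain ⟨c, -, hc⟩ := (smul_mk_eq_iff _ hF).1 ((MulAction.stabilizer G _).inv_mem hs)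
    have hval : ∀ z, eval (fromBlocks s.1.1 0 0 s.2.1 *ᵥ z) F.1 = c * eval z F.1 := by
      intro z
      have := congrArg (fun F => eval z F.1) hc
      simpa [smul_val, eval_linSubst, toGL_pair, -map_inv] using this
    simp only [map_sub, map_mul, eval_C, hev, hval]
    ring
  have hmat : ∀ e : Fin 2 → Idx, (e = Sum.inl ∨ e = Sum.inr) →
      ∃ A : SL(2, ℂ), ∀ i j, p (e i, e j) = A.1 i j := by
    intro e he
    have h1 := hp0 _ (hdet e he)
    refine ⟨⟨Matrix.of fun i j => p (e i, e j), ?_⟩, fun i j => rfl⟩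
    rw [det_fin_two]
    simp only [map_sub, map_mul, eval_X, map_one] at h1
    simpa [sub_eq_zero] using h1
  obtain ⟨A, hA⟩ := hmat Sum.inl (Or.inl rfl)
  obtain ⟨B, hB⟩ := hmat Sum.inr (Or.inr rfl)
  have hη12 : ∀ i j, η (Sum.inl i, Sum.inr j) = 0 := fun i j => by
    have := congrArg TrivSqZeroExt.snd (hη _ (hoff i j))
    simpa [dualPoint] using this
  have hη21 : ∀ i j, η (Sum.inr i, Sum.inl j) = 0 := fun i j => by
    have := congrArg TrivSqZeroExt.snd (hη _ (hoff' i j))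
    simpa [dualPoint] using this
  have hp12 : ∀ i j, p (Sum.inl i, Sum.inr j) = 0 := fun i j => by simpa using hp0 _ (hoff i j)
  have hp21 : ∀ i j, p (Sum.inr i, Sum.inl j) = 0 := fun i j => by simpa using hp0 _ (hoff' i j)
  let η₁ : Matrix (Fin 2) (Fin 2) ℂ := fun i j => η (Sum.inl i, Sum.inl j)
  let η₂ : Matrix (Fin 2) (Fin 2) ℂ := fun i j => η (Sum.inr i, Sum.inr j)
  have hpM : (Matrix.of fun i j => p (i, j)) = (toGL (pair A B) : Matrix Idx Idx ℂ) := by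
    rw [toGL_pair]
    ext i j
    rcases i with i | i <;> rcases j with j | j
    · exact hA i j
    · exact hp12 i j
    · exact hp21 i j
    · exact hB i j
  have hηM : (Matrix.of fun i j => η (i, j)) = fromBlocks η₁ 0 0 η₂ := by
    ext i j
    rcases i with i | i <;> rcases j with j | j
    · rfl
    · exact hη12 i j
    · exact hη21 i j
    · rfl
  have hAA : ∀ A : SL(2, ℂ), A.1 * (A⁻¹).1 = 1 := fun A => by
    rw [← sl_mul, mul_inv_cancel, sl_one]
  refine ⟨(A⁻¹).1 * η₁, (B⁻¹).1 * η₂, ?_, ?_, ?_, ?_⟩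
  · have := congrArg TrivSqZeroExt.snd (hη _ (hdet Sum.inl (Or.inl rfl)))
    simp [dualPoint, hA] at this
    rw [trace_sl_inv_mul]
    linear_combination this
  · have := congrArg TrivSqZeroExt.snd (hη _ (hdet Sum.inr (Or.inr rfl)))
    simp [dualPoint, hB] at this
    rw [trace_sl_inv_mul]
    linear_combination this
  · by_contra hcon
    push Not at hcon
    have h1 : η₁ = 0 := by
      rw [← one_mul η₁, ← hAA A, mul_assoc, hcon.1, mul_zero]
    have h2 : η₂ = 0 := by
      rw [← one_mul η₂, ← hAA B, mul_assoc, hcon.2, mul_zero]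
    apply hη0
    funext ⟨i, j⟩
    have := congrFun (congrFun hηM i) j
    rw [h1, h2] at this
    simpa using this
  · set ξ : Matrix Idx Idx ℂ := fromBlocks ((A⁻¹).1 * η₁) 0 0 ((B⁻¹).1 * η₂) with hξ
    set M : Matrix Idx Idx ℂ := (toGL (pair A B) : Matrix Idx Idx ℂ) with hM
    have hMξ : M * ξ = fromBlocks η₁ 0 0 η₂ := by
      rw [hM, hξ, toGL_pair, fromBlocks_multiply]
      simp only [mul_zero, zero_mul, add_zero, zero_add, ← mul_assoc, hAA, one_mul]
    obtain ⟨z₀, hz₀⟩ : ∃ z₀, eval z₀ F.1 ≠ 0 := by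
      by_contra hcon
      push Not at hcon
      exact hF (Subtype.ext (MvPolynomial.funext fun z => by simp [hcon z]))
    have hdual : ∀ z, aeval (dualPoint p η) (Φ z) = aeval (dualPoint z (ξ *ᵥ z)) (linSubst M F.1) := by
      intro z
      rw [aeval_linSubst, matrix_dualPoint, mulVec_mulVec, hMξ, ← hηM, ← hpM]
      change (aeval (dualPoint p η)) (aeval _ F.1) = _
      rw [← AlgHom.comp_apply, comp_aeval]
      congr 2
      funext i
      apply TrivSqZeroExt.ext
      · simp [dualPoint, mulVec, dotProduct, TrivSqZeroExt.algebraMap_eq_inl]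
      · simp [dualPoint, mulVec, dotProduct, TrivSqZeroExt.algebraMap_eq_inl,
          mul_comm]
    have hpev : ∀ z, eval p (Φ z) = eval (M *ᵥ z) F.1 := by
      intro z
      rw [← fst_aeval_dualPoint p η, hdual, fst_aeval_dualPoint, eval_linSubst]
    let c : ℂ := eval (M *ᵥ z₀) F.1 / eval z₀ F.1
    have hsmul : (pair A B)⁻¹ • F = c • F := by
      apply Subtype.ext
      apply MvPolynomial.funext
      intro z
      have h1 := hp0 _ (hΦ z z₀)
      simp only [map_sub, map_mul, eval_C, hpev] at h1
      rw [smul_val, eval_linSubst, inv_inv, ← hM]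
      simp only [Submodule.coe_smul, smul_eval, c]
      field_simp
      linear_combination h1
    have hc : c ≠ 0 := by
      intro h0
      rw [h0, zero_smul] at hsmul
      exact smul_ne_zero_of _ hF hsmul
    have hlin : linSubst M F.1 = c • F.1 := by
      have := congrArg Subtype.val hsmul
      rwa [smul_val, inv_inv] at this
    refine ⟨lieAt ξ F z₀ / eval z₀ F.1, fun z => ?_⟩
    have h1 := congrArg TrivSqZeroExt.snd (hη _ (hΦ z z₀))
    simp only [map_sub, map_mul, hdual, hlin, map_smul] at h1
    simp [TrivSqZeroExt.algebraMap_eq_inl] at h1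
    change c * (lieAt ξ F z * _) - c * (lieAt ξ F z₀ * _) = 0 at h1
    field_simp
    apply mul_left_cancel₀ hc
    linear_combination h1

/-! ### Identity components of stabilisers -/

theorem relIndex_ne_zero_of_cosets {H K : Subgroup G} (S : Set G) (hS : S.Finite)
    (h : ∀ g ∈ H, ∃ s ∈ S, s⁻¹ * g ∈ K) : K.relIndex H ≠ 0 := by
  classical
  choose! φ hφS hφ using h
  refine relIndex_ne_zero_of_finite S hS φ hφS fun g hg g' hg' heq => ?_
  have h1 := K.mul_mem (K.inv_mem (hφ g hg)) (hφ g' hg')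
  rw [heq] at h1
  convert h1 using 1
  group

/-- The matrix is diagonal or antidiagonal. -/
def IsMonomial (A : SL(2, ℂ)) : Prop := (A.1 0 1 = 0 ∧ A.1 1 0 = 0) ∨ (A.1 0 0 = 0 ∧ A.1 1 1 = 0)

theorem exists_diagSL_of_isMonomial {A A' : SL(2, ℂ)} (hA : IsMonomial A) (hA' : IsMonomial A')
    (h : A.1 0 1 = 0 ↔ A'.1 0 1 = 0) : ∃ s, A⁻¹ * A' = diagSL s := by
  have hd := sl_det A
  have hd' := sl_det A'
  apply exists_diagSL
  all_goals
    rw [sl_mul, sl_inv]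
    simp only [mul_apply, Fin.sum_univ_two, of_apply, cons_val', cons_val_zero, cons_val_one,
      cons_val_fin_one]
    rcases hA with ⟨h1, h2⟩ | ⟨h1, h2⟩ <;> rcases hA' with ⟨h3, h4⟩ | ⟨h3, h4⟩
    · simp [h1, h2, h3, h4]
    · have := h.1 h1
      simp [this, h3] at hd'
    · have := h.2 h3
      simp [this, h1] at hd
    · simp [h1, h2, h3, h4]

/-- The maximal torus of pairs of diagonal matrices. -/
def diagTorus : Subgroup G :=
  (SemidirectProduct.inl.comp (diagSL.prodMap diagSL) : ℂˣ × ℂˣ →* G).range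

theorem mem_diagTorus {g : G} : g ∈ diagTorus ↔ ∃ s t, g = tor s t := by
  constructor
  · rintro ⟨⟨s, t⟩, rfl⟩
    exact ⟨s, t, rfl⟩
  · rintro ⟨s, t, rfl⟩
    exact ⟨(s, t), rfl⟩

theorem pair_left (A B : SL(2, ℂ)) : (pair A B).left = (A, B) := rfl

theorem pair_right (A B : SL(2, ℂ)) : (pair A B).right = 1 := rfl

theorem pair_sw_left (A B : SL(2, ℂ)) : (pair A B * sw).left = (A, B) := by
  rw [SemidirectProduct.mul_left]
  have h : sw.left = 1 := rfl
  rw [h, map_one, mul_one]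
  rfl

theorem pair_sw_right (A B : SL(2, ℂ)) : (pair A B * sw).right = Multiplicative.ofAdd 1 := by
  rw [SemidirectProduct.mul_right]
  rfl

/-- A subgroup consisting of monomial elements, whose diagonal elements have, up to finitely many
possibilities, the weights `(1, k)`, has its identity component in the torus of weights `(1, k)`. -/
theorem identityComponent_le_torus {k : ℕ} {H : Subgroup G}
    (hmono : ∀ g ∈ H, IsMonomial g.left.1 ∧ IsMonomial g.left.2)
    (htor : ∀ s t, tor s t ∈ H → (((s ^ k * t⁻¹ : ℂˣ) : ℂ)) ^ 12 = 1) :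
    identityComponent H ≤ (torusHom k).range := by
  apply identityComponent_le_of_finite_relIndex (isClosed_range_torusHom k)
  refine Subgroup.relIndex_ne_zero_trans (K := H ⊓ diagTorus) ?_ ?_
  · have hfin : {z : ℂ | z ^ 12 = 1}.Finite := by
      have : {z : ℂ | z ^ 12 = 1} ⊆ ((Polynomial.X ^ 12 - Polynomial.C 1 :
          Polynomial ℂ).roots.toFinset : Set ℂ) := by
        intro z hz
        have hz' : z ^ 12 = 1 := hz
        have hne : (Polynomial.X ^ 12 - Polynomial.C 1 : Polynomial ℂ) ≠ 0 :=
          Polynomial.X_pow_sub_C_ne_zero (by norm_num) 1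
        rw [Finset.mem_coe, Multiset.mem_toFinset, Polynomial.mem_roots hne]
        simp [Polynomial.IsRoot, hz']
      exact (Finset.finite_toSet _).subset this
    refine relIndex_ne_zero_of_finite {z : ℂ | z ^ 12 = 1} hfin
      (fun g => g.left.1.1 0 0 ^ k * g.left.2.1 1 1) ?_ ?_
    · rintro g ⟨hg, hgT⟩
      obtain ⟨s, t, rfl⟩ := mem_diagTorus.1 hgT
      exact htor s t hg
    · rintro g ⟨hg, hgT⟩ g' ⟨hg', hgT'⟩ heq
      obtain ⟨s, t, rfl⟩ := mem_diagTorus.1 hgT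
      obtain ⟨s', t', rfl⟩ := mem_diagTorus.1 hgT'
      have h1 : s ^ k * t⁻¹ = s' ^ k * t'⁻¹ := Units.ext heq
      refine ⟨s⁻¹ * s', ?_⟩
      rw [torusHom_apply, tor, tor, tor, pair_inv, pair_mul, ← map_inv, ← map_inv, ← map_mul,
        ← map_mul]
      congr 2
      rw [mul_pow, inv_pow]
      have h2 : s' ^ k = s ^ k * t⁻¹ * t' := by rw [h1, inv_mul_cancel_right]
      rw [h2]
      group
  · classical
    refine relIndex_ne_zero_of_finite (ι := Multiplicative (ZMod 2) × Prop × Prop) Set.univ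
      Set.finite_univ (fun g => (g.right, g.left.1.1 0 1 = 0, g.left.2.1 0 1 = 0))
      (fun _ _ => Set.mem_univ _) ?_
    intro g hg g' hg' heq
    rw [Prod.mk.injEq, Prod.mk.injEq] at heq
    obtain ⟨h1, h2, h3⟩ := heq
    refine ⟨H.mul_mem (H.inv_mem hg) hg', ?_⟩
    have hm := hmono g hg
    have hm' := hmono g' hg'
    obtain ⟨s, hs⟩ := exists_diagSL_of_isMonomial hm.1 hm'.1 (iff_of_eq h2)
    obtain ⟨t, ht⟩ := exists_diagSL_of_isMonomial hm.2 hm'.2 (iff_of_eq h3)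
    have hne : (1 : Multiplicative (ZMod 2)) ≠ Multiplicative.ofAdd 1 := by decide
    obtain ⟨A, B, rfl | rfl⟩ := eq_pair_or g <;> obtain ⟨A', B', rfl | rfl⟩ := eq_pair_or g'
    · rw [pair_left, pair_left] at hs ht
      refine mem_diagTorus.2 ⟨s, t, ?_⟩
      rw [pair_inv, pair_mul, tor, ← hs, ← ht]
    · rw [pair_right, pair_sw_right] at h1
      exact absurd h1 hne
    · rw [pair_right, pair_sw_right] at h1
      exact absurd h1.symm hne
    · rw [pair_sw_left, pair_sw_left] at hs ht
      refine mem_diagTorus.2 ⟨t, s, ?_⟩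
      rw [tor, ← hs, ← ht, ← sw_mul_pair, ← sw_mul_pair, _root_.mul_inv_rev, sw_inv, pair_inv,
        mul_assoc, ← mul_assoc sw sw, sw_mul_sw, one_mul, pair_mul]

/-- The diagonal element `(diag(1, -1), diag(k, -k))` of the Lie algebra, as a vector field. -/
def torusField (k : ℂ) : Matrix Idx Idx ℂ :=
  fromBlocks !![1, 0; 0, -1] 0 0 !![k, 0; 0, -k]

theorem sl_conj_diag (A : SL(2, ℂ)) (k : ℂ) :
    A.1 * !![k, 0; 0, -k] * (A⁻¹).1 =
      !![k * (A.1 0 0 * A.1 1 1 + A.1 0 1 * A.1 1 0), -(2 * k) * (A.1 0 0 * A.1 0 1);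
        2 * k * (A.1 1 0 * A.1 1 1), -(k * (A.1 0 0 * A.1 1 1 + A.1 0 1 * A.1 1 0))] := by
  rw [sl_inv]
  ext i j
  fin_cases i <;> fin_cases j <;> simp [mul_apply, Fin.sum_univ_two] <;> ring

theorem isMonomial_of_products {A : SL(2, ℂ)} (h1 : A.1 0 0 * A.1 0 1 = 0)
    (h2 : A.1 1 0 * A.1 1 1 = 0) : IsMonomial A := by
  have hd := sl_det A
  rcases mul_eq_zero.1 h1 with h3 | h3 <;> rcases mul_eq_zero.1 h2 with h4 | h4
  · simp [h3, h4] at hd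
  · exact Or.inr ⟨h3, h4⟩
  · exact Or.inl ⟨h3, h4⟩
  · simp [h3, h4] at hd

/-- If the infinitesimal stabiliser of `F` is contained in the diagonal matrices, the stabiliser of
the line of `F` normalises the torus. -/
theorem isMonomial_of_mem_stabilizer {k : ℂ} (hk : k ≠ 0) {F : V} (hF : F ≠ 0)
    (h0 : IsInfStab (torusField k) F)
    (hdiag : ∀ a b c a' b' c' : ℂ,
      IsInfStab (fromBlocks !![a, b; c, -a] 0 0 !![a', b'; c', -a']) F →
        b = 0 ∧ c = 0 ∧ b' = 0 ∧ c' = 0)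
    {g : G} (hg : g ∈ MulAction.stabilizer G (Projectivization.mk ℂ F hF)) :
    IsMonomial g.left.1 ∧ IsMonomial g.left.2 := by
  obtain ⟨c, hc, hgF⟩ := (smul_mk_eq_iff g hF).1 hg
  have h1 := (h0.smul g).of_smul_eq hc hgF
  have key : ∀ (A B : SL(2, ℂ)) (k k' : ℂ), k ≠ 0 → k' ≠ 0 →
      IsInfStab (fromBlocks (A.1 * !![k, 0; 0, -k] * (A⁻¹).1) 0 0
        (B.1 * !![k', 0; 0, -k'] * (B⁻¹).1)) F → IsMonomial A ∧ IsMonomial B := by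
    intro A B k k' hk hk' h
    rw [sl_conj_diag, sl_conj_diag] at h
    obtain ⟨h2, h3, h4, h5⟩ := hdiag _ _ _ _ _ _ h
    constructor
    · exact isMonomial_of_products (by simpa [hk] using h2) (by simpa [hk] using h3)
    · exact isMonomial_of_products (by simpa [hk'] using h4) (by simpa [hk'] using h5)
  obtain ⟨A, B, rfl | rfl⟩ := eq_pair_or g
  · apply key A B 1 k one_ne_zero hk
    rw [pair_inv, toGL_pair, toGL_pair, torusField, fromBlocks_multiply, fromBlocks_multiply] at h1
    simpa only [mul_zero, zero_mul, add_zero, zero_add] using h1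
  · rw [pair_sw_left]
    apply key A B k 1 hk one_ne_zero
    have hinv : (pair A B * sw)⁻¹ = pair B⁻¹ A⁻¹ * sw := by
      rw [_root_.mul_inv_rev, sw_inv, pair_inv, sw_mul_pair]
    rw [hinv, toGL_pair_sw, toGL_pair_sw, torusField, fromBlocks_multiply,
      fromBlocks_multiply] at h1
    simpa only [mul_zero, zero_mul, add_zero, zero_add] using h1

theorem isInfStab_torusField_dForm (a b c d : ℂ) : IsInfStab (torusField 1) (dForm a b c d) := by
  refine isInfStab_of_lieCf_eq (k := 0) fun i j => ?_
  simp only [lieCf, cf_dForm]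
  fin_cases i <;> fin_cases j <;> norm_num

theorem isInfStab_torusField_aForm (a b : ℂ) : IsInfStab (torusField 3) (aForm a b) := by
  refine isInfStab_of_lieCf_eq (k := 0) fun i j => ?_
  simp only [lieCf, cf_aForm]
  fin_cases i <;> fin_cases j <;> norm_num

/-- If `q' ∂_u f + q ∂_v f = 0` for a semistable binary cubic `f`, in coordinates, then `f` is the
cube of a linear form, unless `q = q' = 0`. -/
theorem eq_zero_or_cube {a b c d q q' : ℂ} (hab : a ≠ 0 ∨ b ≠ 0) (hcd : c ≠ 0 ∨ d ≠ 0)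
    (h1 : q * b + 3 * q' * a = 0) (h2 : q * c + q' * b = 0) (h3 : 3 * q * d + q' * c = 0) :
    (q = 0 ∧ q' = 0) ∨ ∃ r, r ≠ 0 ∧ b = -3 * r * a ∧ c = 3 * r ^ 2 * a ∧ d = -r ^ 3 * a := by
  by_cases hq : q = 0
  · left
    refine ⟨hq, ?_⟩
    by_contra hq'
    subst hq
    have ha : a = 0 := by simpa [hq'] using h1
    have hb : b = 0 := by simpa [hq'] using h2
    tauto
  · by_cases hq' : q' = 0
    · exfalso
      subst hq'
      have hc : c = 0 := by simpa [hq] using h2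
      have hd : d = 0 := by simpa [hq] using h3
      tauto
    · right
      have hb : b = -3 * (q' / q) * a := by
        field_simp
        linear_combination h1
      have hc : c = 3 * (q' / q) ^ 2 * a := by
        have : c = -(q' / q) * b := by
          field_simp
          linear_combination h2
        rw [this, hb]
        ring
      refine ⟨q' / q, div_ne_zero hq' hq, hb, hc, ?_⟩
      have : d = -(q' / q) * c / 3 := by
        field_simp
        linear_combination h3
      rw [this, hc]
      ring

/-- A D-curve other than a conjugate of the triple conic is stabilised only by diagonal elements of the
Lie algebra. -/
theorem offdiag_eq_zero_dForm {a b c d : ℂ} (hab : a ≠ 0 ∨ b ≠ 0) (hcd : c ≠ 0 ∨ d ≠ 0)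
    (hcube : ¬ ∃ r, r ≠ 0 ∧ b = -3 * r * a ∧ c = 3 * r ^ 2 * a ∧ d = -r ^ 3 * a)
    (p q r p' q' r' : ℂ)
    (h : IsInfStab (fromBlocks !![p, q; r, -p] 0 0 !![p', q'; r', -p']) (dForm a b c d)) :
    q = 0 ∧ r = 0 ∧ q' = 0 ∧ r' = 0 := by
  obtain ⟨k, hk⟩ := h.lieCf_eq
  have e1 := hk 3 1
  have e2 := hk 2 2
  have e3 := hk 1 3
  have e4 := hk 2 0
  have e5 := hk 1 1
  have e6 := hk 0 2
  simp [lieCf, cf_dForm] at e1 e2 e3 e4 e5 e6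
  have h1 := (eq_zero_or_cube (q := r) (q' := r') hab hcd (by linear_combination e1)
    (by linear_combination e2 / 2) (by linear_combination e3)).resolve_right hcube
  have h2 := (eq_zero_or_cube (q := q') (q' := q) hab hcd (by linear_combination e4)
    (by linear_combination e5 / 2) (by linear_combination e6)).resolve_right hcube
  exact ⟨h2.2, h1.1, h2.1, h1.2⟩

theorem offdiag_eq_zero_aForm {a b : ℂ} (ha : a ≠ 0) (hb : b ≠ 0) (p q r p' q' r' : ℂ)
    (h : IsInfStab (fromBlocks !![p, q; r, -p] 0 0 !![p', q'; r', -p']) (aForm a b)) :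
    q = 0 ∧ r = 0 ∧ q' = 0 ∧ r' = 0 := by
  obtain ⟨k, hk⟩ := h.lieCf_eq
  have e1 := hk 2 1
  have e2 := hk 1 2
  have e3 := hk 3 2
  have e4 := hk 3 0
  simp [lieCf, cf_aForm, ha, hb] at e1 e2 e3 e4
  exact ⟨e1, e2, e4, e3⟩

theorem RD_le_stabilizer_dForm {a b c d : ℂ} (h : dForm a b c d ≠ 0) :
    RD ≤ MulAction.stabilizer G (Projectivization.mk ℂ _ h) := by
  rintro _ ⟨t, rfl⟩
  rw [MulAction.mem_stabilizer_iff, smul_mk_eq_iff]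
  exact ⟨1, one_ne_zero, by rw [torusHom_one_smul_dForm, one_smul]⟩

theorem RA_le_stabilizer_aForm {a b : ℂ} (h : aForm a b ≠ 0) :
    RA ≤ MulAction.stabilizer G (Projectivization.mk ℂ _ h) := by
  rintro _ ⟨t, rfl⟩
  rw [MulAction.mem_stabilizer_iff, smul_mk_eq_iff]
  exact ⟨1, one_ne_zero, by rw [torusHom_three_smul_aForm, one_smul]⟩

theorem tor_smul_dForm (s t : ℂˣ) (a b c d : ℂ) :
    tor s t • dForm a b c d = dForm (((s * t⁻¹ : ℂˣ) : ℂ)⁻¹ ^ 3 * a)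
      (((s * t⁻¹ : ℂˣ) : ℂ)⁻¹ * b) (((s * t⁻¹ : ℂˣ) : ℂ) * c)
      (((s * t⁻¹ : ℂˣ) : ℂ) ^ 3 * d) := by
  apply ext_evalAt
  intro x y
  have hs : (s : ℂ) ≠ 0 := s.ne_zero
  have ht : (t : ℂ) ≠ 0 := t.ne_zero
  rw [evalAt_tor_smul, evalAt_dForm, evalAt_dForm]
  simp only [Units.val_mul, Units.val_inv_eq_inv_val, cons_val_zero, cons_val_one]
  field_simp

theorem tor_smul_aForm (s t : ℂˣ) (a b : ℂ) :
    tor s t • aForm a b = aForm (((s ^ 3 * t⁻¹ : ℂˣ) : ℂ)⁻¹ * a) (((s ^ 3 * t⁻¹ : ℂˣ) : ℂ) * b) := by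
  apply ext_evalAt
  intro x y
  have hs : (s : ℂ) ≠ 0 := s.ne_zero
  have ht : (t : ℂ) ≠ 0 := t.ne_zero
  rw [evalAt_tor_smul, evalAt_aForm, evalAt_aForm]
  simp only [Units.val_mul, Units.val_inv_eq_inv_val, cons_val_zero, cons_val_one,
    Units.val_pow_eq_pow_val]
  field_simp

/-- The excluded forms `a (u - r v)³`, where `u = x₀ y₁` and `v = x₁ y₀`, are conjugate to multiples of
the form of the triple conic. -/
theorem identityComponent_stabilizer_dForm {a b c d : ℂ} (hF : dForm a b c d ≠ 0)
    (hab : a ≠ 0 ∨ b ≠ 0) (hcd : c ≠ 0 ∨ d ≠ 0)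
    (hcube : ¬ ∃ r, r ≠ 0 ∧ b = -3 * r * a ∧ c = 3 * r ^ 2 * a ∧ d = -r ^ 3 * a) :
    identityComponent (MulAction.stabilizer G (Projectivization.mk ℂ _ hF)) = RD := by
  refine le_antisymm ?_ (le_identityComponent (RD_le_stabilizer_dForm hF) isPreconnected_RD)
  refine identityComponent_le_torus (k := 1) (fun g hg => ?_) fun s t hst => ?_
  · exact isMonomial_of_mem_stabilizer one_ne_zero hF (isInfStab_torusField_dForm a b c d)
      (offdiag_eq_zero_dForm hab hcd hcube) hg
  · obtain ⟨k, hk0, hk⟩ := (smul_mk_eq_iff _ hF).1 hst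
    rw [tor_smul_dForm, smul_dForm] at hk
    obtain ⟨h1, h2, h3, h4⟩ := dForm_inj hk
    rw [pow_one]
    have hz : ((s * t⁻¹ : ℂˣ) : ℂ) ≠ 0 := (s * t⁻¹).ne_zero
    generalize ((s * t⁻¹ : ℂˣ) : ℂ) = z at *
    -- two of the characters of the torus take the same value
    have hk1 : k = z⁻¹ ^ 3 ∨ k = z⁻¹ := by
      rcases hab with ha | hb
      · exact Or.inl (mul_right_cancel₀ ha h1).symm
      · exact Or.inr (mul_right_cancel₀ hb h2).symm
    have hk2 : k = z ∨ k = z ^ 3 := by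
      rcases hcd with hc | hd
      · exact Or.inl (mul_right_cancel₀ hc h3).symm
      · exact Or.inr (mul_right_cancel₀ hd h4).symm
    rcases hk1 with rfl | rfl <;> rcases hk2 with h | h <;> field_simp at h
    · calc z ^ 12 = (z ^ 4) ^ 3 := by ring
        _ = 1 := by rw [← h]; norm_num
    · calc z ^ 12 = (z ^ 6) ^ 2 := by ring
        _ = 1 := by rw [← h]; norm_num
    · calc z ^ 12 = (z ^ 2) ^ 6 := by ring
        _ = 1 := by rw [← h]; norm_num
    · calc z ^ 12 = (z ^ 4) ^ 3 := by ring
        _ = 1 := by rw [← h]; norm_num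

theorem identityComponent_stabilizer_aForm {a b : ℂ} (hF : aForm a b ≠ 0) (ha : a ≠ 0)
    (hb : b ≠ 0) : identityComponent (MulAction.stabilizer G (Projectivization.mk ℂ _ hF)) = RA := by
  refine le_antisymm ?_ (le_identityComponent (RA_le_stabilizer_aForm hF) isPreconnected_RA)
  refine identityComponent_le_torus (k := 3) (fun g hg => ?_) fun s t hst => ?_
  · exact isMonomial_of_mem_stabilizer three_ne_zero hF (isInfStab_torusField_aForm a b)
      (offdiag_eq_zero_aForm ha hb) hg
  · obtain ⟨k, hk0, hk⟩ := (smul_mk_eq_iff _ hF).1 hst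
    rw [tor_smul_aForm, smul_aForm] at hk
    obtain ⟨h1, h2⟩ := aForm_inj hk
    have hz : ((s ^ 3 * t⁻¹ : ℂˣ) : ℂ) ≠ 0 := (s ^ 3 * t⁻¹).ne_zero
    generalize ((s ^ 3 * t⁻¹ : ℂˣ) : ℂ) = z at *
    have h3 := (mul_right_cancel₀ ha h1).trans (mul_right_cancel₀ hb h2).symm
    field_simp at h3
    calc z ^ 12 = (z ^ 2) ^ 6 := by ring
      _ = 1 := by rw [← h3]; norm_num

theorem exists_smul_eq_tripleConic {a b c d : ℂ} (hF : dForm a b c d ≠ 0)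
    (hcube : ∃ r, r ≠ 0 ∧ b = -3 * r * a ∧ c = 3 * r ^ 2 * a ∧ d = -r ^ 3 * a) :
    ∃ g : G, g • Projectivization.mk ℂ _ hF = tripleConic := by
  obtain ⟨r, hr, rfl, rfl, rfl⟩ := hcube
  obtain ⟨s, hs⟩ := IsAlgClosed.exists_pow_nat_eq r⁻¹ two_pos
  have hs0 : s ≠ 0 := by
    rintro rfl
    exact inv_ne_zero hr (by simpa using hs.symm)
  have ha : a ≠ 0 := by
    rintro rfl
    exact hF (by simpa using dForm_zero)
  refine ⟨tor (Units.mk0 s hs0) 1, ?_⟩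
  rw [Projectivization.smul_mk, tripleConic, mk_eq_mk_iff_exists]
  refine ⟨s⁻¹ ^ 3 * a, mul_ne_zero (pow_ne_zero _ (inv_ne_zero hs0)) ha, ?_⟩
  have hr' : r = (s ^ 2)⁻¹ := by rw [hs, inv_inv]
  rw [tor_smul_dForm, tripleConicForm_eq, smul_dForm, hr']
  simp only [Units.val_mk0, inv_one, mul_one]
  congr 1 <;> field_simp

/-- If the pair of `A` and `B` preserves the cube of `x₀ y₁ - x₁ y₀` up to a factor, then `A` and `B`
agree up to sign. -/
theorem eq_smul_of_wedge_cube {A B : SL(2, ℂ)} {c : ℂ}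
    (h : ∀ x y : Fin 2 → ℂ, ((A.1 *ᵥ x) 0 * (B.1 *ᵥ y) 1 - (A.1 *ᵥ x) 1 * (B.1 *ᵥ y) 0) ^ 3 =
      c * (x 0 * y 1 - x 1 * y 0) ^ 3) : B = A ∨ B = -A := by
  simp only [mulVec, dotProduct, Fin.sum_univ_two] at h
  have h00 := h ![1, 0] ![1, 0]
  have h11 := h ![0, 1] ![0, 1]
  have hs := h ![1, 1] ![1, 1]
  simp at h00 h11 hs
  set n := A.1 0 0 * B.1 1 1 - A.1 1 0 * B.1 0 1 with hn
  have hm : A.1 1 1 * B.1 0 0 - A.1 0 1 * B.1 1 0 = n := by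
    rw [hn]
    linear_combination h00 + h11 - hs
  have hA := sl_det A
  have hB := sl_det B
  have e00 : B.1 0 0 = n * A.1 0 0 := by
    rw [← hm]
    linear_combination -B.1 0 0 * hA + A.1 0 1 * h00
  have e10 : B.1 1 0 = n * A.1 1 0 := by
    rw [← hm]
    linear_combination -B.1 1 0 * hA + A.1 1 1 * h00
  have e01 : B.1 0 1 = n * A.1 0 1 := by
    rw [hn]
    linear_combination -B.1 0 1 * hA - A.1 0 0 * h11
  have e11 : B.1 1 1 = n * A.1 1 1 := by
    rw [hn]
    linear_combination -B.1 1 1 * hA - A.1 1 0 * h11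
  have hn2 : n ^ 2 = 1 := by
    rw [e00, e10, e01, e11] at hB
    linear_combination hB - n ^ 2 * hA
  have hn1 : n = 1 ∨ n = -1 := by
    rcases mul_eq_zero.1 (show (n - 1) * (n + 1) = 0 by linear_combination hn2) with h1 | h1
    · exact Or.inl (sub_eq_zero.1 h1)
    · exact Or.inr (eq_neg_of_add_eq_zero_left h1)
  rcases hn1 with h1 | h1
  · left
    apply Subtype.ext
    ext i j
    fin_cases i <;> fin_cases j <;> simp [e00, e10, e01, e11, h1]
  · right
    apply Subtype.ext
    ext i j
    fin_cases i <;> fin_cases j <;> simp [e00, e10, e01, e11, h1]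

theorem RC_le_stabilizer_tripleConic : RC ≤ MulAction.stabilizer G tripleConic := by
  have h : tripleConic ∈ fixedLocus RC := by rw [fixedLocus_RC]; rfl
  exact h

theorem identityComponent_stabilizer_tripleConic :
    identityComponent (MulAction.stabilizer G tripleConic) = RC := by
  refine le_antisymm ?_ (le_identityComponent RC_le_stabilizer_tripleConic isPreconnected_RC)
  apply identityComponent_le_of_finite_relIndex isClosed_RC
  have hsw : sw • tripleConicForm = (-1 : ℂ) • tripleConicForm := by
    apply ext_evalAt
    intro x y
    rw [evalAt_sw_smul, evalAt_smul, evalAt_tripleConicForm, evalAt_tripleConicForm]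
    ring
  have key : ∀ (A B : SL(2, ℂ)) (c : ℂ), pair A B • tripleConicForm = c • tripleConicForm →
      B = A ∨ B = -A := by
    intro A B c hc
    have h1 : B⁻¹ = A⁻¹ ∨ B⁻¹ = -A⁻¹ := by
      apply eq_smul_of_wedge_cube (c := c)
      intro x y
      have := congrArg (fun F => evalAt F x y) hc
      simpa only [evalAt_pair_smul, evalAt_smul, evalAt_tripleConicForm] using this
    rcases h1 with h1 | h1
    · exact Or.inl (inv_injective h1)
    · right
      rw [← inv_inv B, h1]
      apply inv_eq_of_mul_eq_one_left
      rw [neg_mul_neg, mul_inv_cancel]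
  refine relIndex_ne_zero_of_cosets {1, pair 1 (-1), sw, pair 1 (-1) * sw}
    (Set.toFinite _) fun g hg => ?_
  obtain ⟨c, hc0, hc⟩ := (smul_mk_eq_iff g tripleConicForm_ne_zero).1 hg
  obtain ⟨A, B, rfl | rfl⟩ := eq_pair_or g
  · rcases key A B c hc with rfl | rfl
    · exact ⟨1, by simp, B, by rw [inv_one, one_mul]; rfl⟩
    · refine ⟨pair 1 (-1), by simp, A, ?_⟩
      rw [eq_inv_mul_iff_mul_eq, diagonalHom_apply, pair_mul, one_mul, neg_mul, one_mul]
  · rw [mul_smul, hsw, smul_comm] at hc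
    have hc' : pair A B • tripleConicForm = (-c) • tripleConicForm := by
      refine ext_cf fun i j => ?_
      have h := congrArg (fun F => cf F i j) hc
      simp only [cf_smul] at h ⊢
      linear_combination -h
    rcases key A B _ hc' with rfl | rfl
    · refine ⟨sw, by simp, B, ?_⟩
      rw [eq_inv_mul_iff_mul_eq, diagonalHom_apply, sw_mul_pair]
    · refine ⟨pair 1 (-1) * sw, by simp, A, ?_⟩
      rw [eq_inv_mul_iff_mul_eq, diagonalHom_apply, mul_assoc, sw_mul_pair, ← mul_assoc, pair_mul,
        one_mul, neg_mul, one_mul]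

/-! ### The topology of `X` -/

/-- The point of `X` defined by a nonzero form. -/
def toXX (v : {v : V // v ≠ 0}) : XX := Projectivization.mk ℂ v.1 v.2

theorem continuous_toXX : Continuous toXX := continuous_coinduced_rng

/-- The squared Hermitian norm of the coefficient vector of a form. -/
def normSqForm (F : V) : ℂ := ∑ i, ∑ j, cf F i j * starRingEnd ℂ (cf F i j)

theorem normSqForm_ne_zero {F : V} (hF : F ≠ 0) : normSqForm F ≠ 0 := by
  obtain ⟨i, j, hij⟩ := exists_cf_ne_zero hF
  have h : normSqForm F = ((∑ i, ∑ j, Complex.normSq (cf F i j) : ℝ) : ℂ) := by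
    simp [normSqForm, Complex.mul_conj]
  rw [h, Complex.ofReal_ne_zero]
  apply ne_of_gt
  refine Finset.sum_pos' (fun _ _ => Finset.sum_nonneg fun _ _ => Complex.normSq_nonneg _)
    ⟨i, Finset.mem_univ _, Finset.sum_pos' (fun _ _ => Complex.normSq_nonneg _)
      ⟨j, Finset.mem_univ _, Complex.normSq_pos.2 hij⟩⟩

/-- The entries of the orthogonal projection onto the line spanned by `F`. -/
def projEntry (F : V) (a : (Fin 4 × Fin 4) × (Fin 4 × Fin 4)) : ℂ :=
  cf F a.1.1 a.1.2 * starRingEnd ℂ (cf F a.2.1 a.2.2) / normSqForm F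

theorem projEntry_smul {c : ℂ} (hc : c ≠ 0) (F : V) : projEntry (c • F) = projEntry F := by
  have hc' : starRingEnd ℂ c ≠ 0 := by simpa using hc
  have h : normSqForm (c • F) = (c * starRingEnd ℂ c) * normSqForm F := by
    simp only [normSqForm, cf_smul, map_mul, Finset.mul_sum]
    exact Finset.sum_congr rfl fun i _ => Finset.sum_congr rfl fun j _ => by ring
  funext a
  simp only [projEntry, cf_smul, map_mul, h]
  rw [← mul_div_mul_left _ (normSqForm F) (mul_ne_zero hc hc')]
  congr 1
  ring

theorem eq_smul_of_projEntry_eq {F F' : V} (hF : F ≠ 0) (hF' : F' ≠ 0)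
    (h : projEntry F = projEntry F') : ∃ c : ℂ, F = c • F' := by
  obtain ⟨i, j, hij⟩ := exists_cf_ne_zero hF
  have hij' : starRingEnd ℂ (cf F i j) ≠ 0 := by simpa using hij
  refine ⟨normSqForm F * starRingEnd ℂ (cf F' i j) / (normSqForm F' * starRingEnd ℂ (cf F i j)),
    ext_cf fun k l => ?_⟩
  have h1 := congrFun h ((k, l), (i, j))
  simp only [projEntry] at h1
  rw [div_eq_div_iff (normSqForm_ne_zero hF) (normSqForm_ne_zero hF')] at h1
  rw [cf_smul, div_mul_eq_mul_div, eq_div_iff (mul_ne_zero (normSqForm_ne_zero hF') hij')]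
  linear_combination h1

theorem continuous_projEntry :
    Continuous fun v : {v : V // v ≠ 0} => projEntry v.1 := by
  have hcf : ∀ i j, Continuous fun v : {v : V // v ≠ 0} => cf v.1 i j := fun i j =>
    (continuous_cf i j).comp continuous_subtype_val
  have hconj : ∀ i j, Continuous fun v : {v : V // v ≠ 0} => starRingEnd ℂ (cf v.1 i j) :=
    fun i j => Complex.continuous_conj.comp (hcf i j)
  refine continuous_pi fun a => ?_
  refine ((hcf _ _).mul (hconj _ _)).div ?_ fun v => normSqForm_ne_zero v.2
  exact continuous_finsetSum _ fun i _ => continuous_finsetSum _ fun j _ =>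
    (hcf i j).mul (hconj i j)

/-- Lines in `V` are separated by the orthogonal projections onto them. -/
instance : T2Space XX := by
  let Φ : XX → (Fin 4 × Fin 4) × (Fin 4 × Fin 4) → ℂ :=
    Projectivization.lift (fun v => projEntry v.1) (by
      rintro ⟨F, hF⟩ ⟨F', hF'⟩ t h
      have ht : t ≠ 0 := by
        rintro rfl
        exact hF (h.trans (zero_smul ℂ F'))
      change projEntry F = projEntry F'
      rw [show F = t • F' from h, projEntry_smul ht])
  refine T2Space.of_injective_continuous (f := Φ) ?_ (continuous_coinduced_dom.2 ?_)
  · intro x y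
    induction x using Projectivization.ind with
    | h F hF =>
      induction y using Projectivization.ind with
      | h F' hF' =>
        intro h
        obtain ⟨c, hc⟩ := eq_smul_of_projEntry_eq hF hF' h
        rw [Projectivization.mk_eq_mk_iff']
        exact ⟨c, hc.symm⟩
  · exact continuous_projEntry

theorem continuous_sw_smul : Continuous fun F : V => sw • F := by
  refine continuous_form_iff.2 fun i j => ?_
  simp only [cf_sw_smul]
  exact continuous_cf j i

/-! ### Closed orbits -/

/-- Compactness of the family gives closedness, because `X` is a Hausdorff space. -/
theorem isClosed_projective_image {K : Type*} [TopologicalSpace K] {S : Set K} (hS : IsCompact S)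
    {φ : K → V} (hφ : Continuous φ) (h0 : ∀ k ∈ S, φ k ≠ 0) :
    IsClosed {y : XX | ∃ k, ∃ hk : k ∈ S, y = Projectivization.mk ℂ (φ k) (h0 k hk)} := by
  have := isCompact_iff_compactSpace.1 hS
  have hcont : Continuous fun k : S => toXX ⟨φ k, h0 k k.2⟩ :=
    continuous_toXX.comp ((hφ.comp continuous_subtype_val).subtype_mk _)
  convert (isCompact_range hcont).isClosed using 1
  ext y
  constructor
  · rintro ⟨k, hk, rfl⟩
    exact ⟨⟨k, hk⟩, rfl⟩
  · rintro ⟨k, rfl⟩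
    exact ⟨k, k.2, rfl⟩

/-- If the `G⁰`-orbit of a line is contained in a compact family of lines, all of whose semistable
members lie in the `G`-orbit, then the `G`-orbit is closed in the semistable locus. -/
theorem isClosed_orbit_of_family {K : Type*} [TopologicalSpace K] {S : Set K} (hS : IsCompact S)
    {φ : K → V} (hφ : Continuous φ) (h0 : ∀ k ∈ S, φ k ≠ 0) {F : V} (hF : F ≠ 0)
    (horb : ∀ A B, ∃ k ∈ S, ∃ c : ℂ, pair A B • F = c • φ k)
    (hmem : ∀ k ∈ S, IsSemistableForm (φ k) → ∃ (g : G) (c : ℂ), φ k = c • g • F) :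
    IsClosed {y : semistable | (y : XX) ∈ MulAction.orbit G (Projectivization.mk ℂ F hF)} := by
  have h0' : ∀ k ∈ S, sw • φ k ≠ 0 := fun k hk => smul_ne_zero_of sw (h0 k hk)
  have hclosed := ((isClosed_projective_image hS hφ h0).union
    (isClosed_projective_image hS (continuous_sw_smul.comp hφ) h0')).preimage
    (continuous_subtype_val : Continuous (Subtype.val : semistable → XX))
  convert hclosed using 1
  ext ⟨y, hy⟩
  constructor
  · rintro ⟨g, rfl⟩
    have key : ∀ A B, ∃ k, ∃ hk : k ∈ S, pair A B • Projectivization.mk ℂ F hF =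
        Projectivization.mk ℂ (φ k) (h0 k hk) := by
      intro A B
      obtain ⟨k, hk, c, hc⟩ := horb A B
      refine ⟨k, hk, ?_⟩
      rw [Projectivization.smul_mk, Projectivization.mk_eq_mk_iff']
      exact ⟨c, hc.symm⟩
    obtain ⟨A, B, rfl | rfl⟩ := eq_pair_or g
    · exact Or.inl (key A B)
    · obtain ⟨k, hk, h⟩ := key B A
      refine Or.inr ⟨k, hk, ?_⟩
      change (pair A B * sw) • Projectivization.mk ℂ F hF = _
      rw [← sw_mul_pair, mul_smul, h, Projectivization.smul_mk]
      rfl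
  · have key : ∀ k, ∀ hk : k ∈ S, IsSemistableForm (φ k) →
        Projectivization.mk ℂ (φ k) (h0 k hk) ∈
          MulAction.orbit G (Projectivization.mk ℂ F hF) := by
      intro k hk hss
      obtain ⟨g, c, h⟩ := hmem k hk hss
      refine ⟨g, ?_⟩
      change g • Projectivization.mk ℂ F hF = _
      rw [Projectivization.smul_mk, eq_comm, Projectivization.mk_eq_mk_iff']
      exact ⟨c, h.symm⟩
    rintro (⟨k, hk, h⟩ | ⟨k, hk, h⟩)
    · change y = _ at h
      subst h
      exact key k hk ((mk_mem_semistable _).1 hy)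
    · change y = _ at h
      subst h
      have hss := (mk_mem_semistable _).1 hy
      have h1 := key k hk ((isSemistableForm_group_smul_iff sw _).1 hss)
      exact (MulAction.smul_orbit_subset sw _) ⟨_, h1, rfl⟩

/-- A map to `V` is continuous if the coefficients are. -/
theorem continuous_form_of_coeff {Y : Type*} [TopologicalSpace Y] {φ : Y → V}
    (h : ∀ m, Continuous fun y => coeff m (φ y).1) : Continuous φ :=
  continuous_induced_rng.2 (continuous_pi h)

theorem continuous_coeff_mul {Y : Type*} [TopologicalSpace Y] {φ ψ : Y → MvPolynomial Idx ℂ}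
    (hφ : ∀ m, Continuous fun y => coeff m (φ y)) (hψ : ∀ m, Continuous fun y => coeff m (ψ y))
    (m : Idx →₀ ℕ) : Continuous fun y => coeff m (φ y * ψ y) := by
  simp only [coeff_mul]
  exact continuous_finsetSum _ fun a _ => (hφ a.1).mul (hψ a.2)

theorem continuous_coeff_C_mul {Y : Type*} [TopologicalSpace Y] {c : Y → ℂ} (hc : Continuous c)
    (P : MvPolynomial Idx ℂ) (m : Idx →₀ ℕ) : Continuous fun y => coeff m (C (c y) * P) := by
  simp only [coeff_C_mul]
  exact hc.mul continuous_const

theorem continuous_coeff_add {Y : Type*} [TopologicalSpace Y] {φ ψ : Y → MvPolynomial Idx ℂ}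
    (hφ : ∀ m, Continuous fun y => coeff m (φ y)) (hψ : ∀ m, Continuous fun y => coeff m (ψ y))
    (m : Idx →₀ ℕ) : Continuous fun y => coeff m (φ y + ψ y) := by
  simp only [coeff_add]
  exact (hφ m).add (hψ m)

/-! ### Linear substitutions with arbitrary determinant -/

theorem exists_sl_of_det_ne_zero {M : Matrix (Fin 2) (Fin 2) ℂ} (hM : M.det ≠ 0) :
    ∃ (c : ℂ) (A : SL(2, ℂ)), c ≠ 0 ∧ M = c • (A⁻¹).1 := by
  obtain ⟨c, hc⟩ := IsAlgClosed.exists_pow_nat_eq M.det two_pos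
  have hc0 : c ≠ 0 := by
    rintro rfl
    exact hM (by simpa using hc.symm)
  let A : SL(2, ℂ) := ⟨c⁻¹ • M, by
    rw [det_smul, Fintype.card_fin, ← hc, inv_pow, inv_mul_cancel₀ (pow_ne_zero 2 hc0)]⟩
  refine ⟨c, A⁻¹, hc0, ?_⟩
  rw [inv_inv]
  exact (smul_inv_smul₀ hc0 M).symm

theorem evalAt_smul_smul (F : V) (r s : ℂ) (x y : Fin 2 → ℂ) :
    evalAt F (r • x) (s • y) = r ^ 3 * s ^ 3 * evalAt F x y := by
  simp only [evalAt_eq, Fin.sum_univ_four, Pi.smul_apply, smul_eq_mul]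
  norm_num
  ring

/-- Invertible linear substitutions act on `X` through `G`. -/
theorem exists_evalAt_mulVec {M N : Matrix (Fin 2) (Fin 2) ℂ} (hM : M.det ≠ 0) (hN : N.det ≠ 0) :
    ∃ (g : G) (c : ℂ), c ≠ 0 ∧
      ∀ F x y, evalAt F (M *ᵥ x) (N *ᵥ y) = c * evalAt (g • F) x y := by
  obtain ⟨r, A, hr, rfl⟩ := exists_sl_of_det_ne_zero hM
  obtain ⟨s, B, hs, rfl⟩ := exists_sl_of_det_ne_zero hN
  refine ⟨pair A B, r ^ 3 * s ^ 3, mul_ne_zero (pow_ne_zero _ hr) (pow_ne_zero _ hs),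
    fun F x y => ?_⟩
  rw [smul_mulVec, smul_mulVec, evalAt_smul_smul, evalAt_pair_smul]

theorem exists_smul_eq_of_evalAt {M N M' N' : Matrix (Fin 2) (Fin 2) ℂ} (hM : M.det ≠ 0)
    (hN : N.det ≠ 0) (hM' : M'.det ≠ 0) (hN' : N'.det ≠ 0) {F F' : V} {k : ℂ}
    (h : ∀ x y, evalAt F' (M' *ᵥ x) (N' *ᵥ y) = k * evalAt F (M *ᵥ x) (N *ᵥ y)) :
    ∃ (g : G) (c : ℂ), F' = c • g • F := by
  obtain ⟨g, c, -, hg⟩ := exists_evalAt_mulVec hM hN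
  obtain ⟨g', c', hc', hg'⟩ := exists_evalAt_mulVec hM' hN'
  refine ⟨g'⁻¹ * g, c'⁻¹ * k * c, ?_⟩
  have h2 : g' • F' = (c'⁻¹ * k * c) • g • F := by
    refine ext_evalAt fun x y => ?_
    have h1 := h x y
    rw [hg, hg'] at h1
    rw [evalAt_smul, mul_assoc, mul_assoc, ← h1, inv_mul_cancel_left₀ hc']
  rw [← smul_comm (g'⁻¹ * g), mul_smul, smul_comm g, ← h2, inv_smul_smul]

theorem isSemistableForm_of_evalAt {M N : Matrix (Fin 2) (Fin 2) ℂ} (hM : M.det ≠ 0)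
    (hN : N.det ≠ 0) {F : V} (hF : IsSemistableForm F) {a : Fin 4 → Fin 4 → ℂ}
    (h : ∀ x y : Fin 2 → ℂ, evalAt F (M *ᵥ x) (N *ᵥ y) = ∑ i : Fin 4, ∑ j : Fin 4, a i j *
      (x 0 ^ (i : ℕ) * x 1 ^ (3 - i : ℕ) * (y 0 ^ (j : ℕ) * y 1 ^ (3 - j : ℕ)))) :
    IsSemistableForm (ofCf a) := by
  obtain ⟨g, c, hc, hg⟩ := exists_evalAt_mulVec hM hN
  have : ofCf a = c • g • F := by
    apply ext_evalAt
    intro x y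
    rw [evalAt_ofCf, ← h, hg, evalAt_smul]
  rw [this, isSemistableForm_smul_iff hc, isSemistableForm_group_smul_iff]
  exact hF

theorem exists_norm_smul_eq_one {W : Type*} [NormedAddCommGroup W] [NormedSpace ℂ W] {w : W}
    (hw : w ≠ 0) : ∃ r : ℂ, r ≠ 0 ∧ ‖r • w‖ = 1 := by
  refine ⟨((‖w‖ : ℂ))⁻¹, inv_ne_zero (by simpa using hw), ?_⟩
  rw [norm_smul, norm_inv, Complex.norm_real, norm_norm, inv_mul_cancel₀ (norm_ne_zero_iff.2 hw)]

theorem exists_dual_vector {n : Fin 2 → ℂ} (hn : n ≠ 0) :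
    ∃ e : Fin 2 → ℂ, n 0 * e 0 + n 1 * e 1 = 1 := by
  by_cases h0 : n 0 = 0
  · have h1 : n 1 ≠ 0 := fun h1 => hn (by ext i; fin_cases i <;> assumption)
    exact ⟨![0, (n 1)⁻¹], by simp [h1]⟩
  · exact ⟨![(n 0)⁻¹, 0], by simp [h0]⟩

/-- The matrix with columns `e` and `(-n₁, n₀)`; it transforms the linear form `n` into the first
coordinate if `n · e = 1`. -/
def straighten (n e : Fin 2 → ℂ) : Matrix (Fin 2) (Fin 2) ℂ := !![e 0, -n 1; e 1, n 0]

theorem det_straighten {n e : Fin 2 → ℂ} (h : n 0 * e 0 + n 1 * e 1 = 1) :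
    (straighten n e).det ≠ 0 := by
  rw [straighten, det_fin_two_of, show e 0 * n 0 - -n 1 * e 1 = 1 by linear_combination h]
  exact one_ne_zero

theorem straighten_mulVec_zero (n e x : Fin 2 → ℂ) :
    (straighten n e *ᵥ x) 0 = e 0 * x 0 - n 1 * x 1 := by
  simp [straighten, mulVec, dotProduct, Fin.sum_univ_two]
  ring

theorem straighten_mulVec_one (n e x : Fin 2 → ℂ) :
    (straighten n e *ᵥ x) 1 = e 1 * x 0 + n 0 * x 1 := by
  simp [straighten, mulVec, dotProduct, Fin.sum_univ_two]

/-! ### The families that contain the orbits of the triple conic and of a D-curve -/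

/-- The bilinear form with matrix `P`. -/
def bilPoly (P : Fin 2 → Fin 2 → ℂ) : MvPolynomial Idx ℂ :=
  C (P 0 0) * (xVar 0 * yVar 0) + C (P 0 1) * (xVar 0 * yVar 1) +
    (C (P 1 0) * (xVar 1 * yVar 0) + C (P 1 1) * (xVar 1 * yVar 1))

/-- The values of the bilinear form with matrix `P`. -/
def bil (P : Fin 2 → Fin 2 → ℂ) (x y : Fin 2 → ℂ) : ℂ :=
  P 0 0 * (x 0 * y 0) + P 0 1 * (x 0 * y 1) + (P 1 0 * (x 1 * y 0) + P 1 1 * (x 1 * y 1))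

theorem eval_bilPoly (P : Fin 2 → Fin 2 → ℂ) (x y : Fin 2 → ℂ) :
    eval (Sum.elim x y) (bilPoly P) = bil P x y := by
  simp [bilPoly, bil, xVar, yVar]

theorem bilPoly_ne_zero {P : Fin 2 → Fin 2 → ℂ} (hP : P ≠ 0) : bilPoly P ≠ 0 := by
  intro h
  have h1 : ∀ x y, bil P x y = 0 := fun x y => by rw [← eval_bilPoly, h, map_zero]
  apply hP
  ext i j
  fin_cases i <;> fin_cases j
  · simpa [bil] using h1 ![1, 0] ![1, 0]
  · simpa [bil] using h1 ![1, 0] ![0, 1]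
  · simpa [bil] using h1 ![0, 1] ![1, 0]
  · simpa [bil] using h1 ![0, 1] ![0, 1]

theorem isWeightedHomogeneous_C_mul {P : MvPolynomial Idx ℂ} {d : ℕ × ℕ}
    (hP : IsWeightedHomogeneous bideg P d) (c : ℂ) : IsWeightedHomogeneous bideg (C c * P) d := by
  simpa using (isWeightedHomogeneous_C bideg c).mul hP

theorem isWeightedHomogeneous_bilPoly (P : Fin 2 → Fin 2 → ℂ) :
    IsWeightedHomogeneous bideg (bilPoly P) (1, 1) := by
  have h : ∀ i j (c : ℂ), IsWeightedHomogeneous bideg (C c * (xVar i * yVar j)) (1, 1) :=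
    fun i j c => isWeightedHomogeneous_C_mul
      ((isWeightedHomogeneous_x i).mul (isWeightedHomogeneous_y j)) c
  exact ((h 0 0 _).add (h 0 1 _)).add ((h 1 0 _).add (h 1 1 _))

/-- The form `P² Q`, for bilinear forms `P` and `Q`. -/
def bilForm (p : (Fin 2 → Fin 2 → ℂ) × (Fin 2 → Fin 2 → ℂ)) : V :=
  ⟨bilPoly p.1 * bilPoly p.1 * bilPoly p.2,
    ((isWeightedHomogeneous_bilPoly p.1).mul (isWeightedHomogeneous_bilPoly p.1)).mul
      (isWeightedHomogeneous_bilPoly p.2)⟩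

theorem evalAt_bilForm (P Q : Fin 2 → Fin 2 → ℂ) (x y : Fin 2 → ℂ) :
    evalAt (bilForm (P, Q)) x y = bil P x y ^ 2 * bil Q x y := by
  simp only [evalAt, bilForm, map_mul, eval_bilPoly]
  ring

theorem bilForm_ne_zero {P Q : Fin 2 → Fin 2 → ℂ} (hP : P ≠ 0) (hQ : Q ≠ 0) :
    bilForm (P, Q) ≠ 0 := fun h =>
  mul_ne_zero (mul_ne_zero (bilPoly_ne_zero hP) (bilPoly_ne_zero hP)) (bilPoly_ne_zero hQ)
    (congrArg Subtype.val h)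

theorem continuous_bilForm : Continuous bilForm := by
  have h : ∀ {Y : Type} [TopologicalSpace Y] {f : Y → Fin 2 → Fin 2 → ℂ}, Continuous f →
      ∀ m, Continuous fun y => coeff m (bilPoly (f y)) := by
    intro Y _ f hf
    have hij : ∀ i j, Continuous fun y => f y i j := fun i j =>
      (continuous_apply j).comp ((continuous_apply i).comp hf)
    exact continuous_coeff_add
      (continuous_coeff_add (continuous_coeff_C_mul (hij 0 0) _)
        (continuous_coeff_C_mul (hij 0 1) _))
      (continuous_coeff_add (continuous_coeff_C_mul (hij 1 0) _)
        (continuous_coeff_C_mul (hij 1 1) _))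
  exact continuous_form_of_coeff (continuous_coeff_mul
    (continuous_coeff_mul (h continuous_fst) (h continuous_fst)) (h continuous_snd))

/-- The polarisation of the determinant. -/
def polarDet (P Q : Fin 2 → Fin 2 → ℂ) : ℂ :=
  P 0 0 * Q 1 1 + P 1 1 * Q 0 0 - P 0 1 * Q 1 0 - P 1 0 * Q 0 1

theorem exists_rank_one {P : Fin 2 → Fin 2 → ℂ} (hP : P ≠ 0)
    (hdet : P 0 0 * P 1 1 - P 0 1 * P 1 0 = 0) :
    ∃ u v : Fin 2 → ℂ, u ≠ 0 ∧ v ≠ 0 ∧ ∀ i j, P i j = u i * v j := by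
  by_cases h0 : P 0 = 0
  · refine ⟨![0, 1], P 1, fun h => by simpa using congrFun h 1, fun h1 => hP ?_, ?_⟩
    · ext i j
      fin_cases i
      · exact congrFun h0 j
      · exact congrFun h1 j
    · intro i j
      fin_cases i
      · simp [h0]
      · simp
  · obtain ⟨e, he⟩ := exists_dual_vector h0
    refine ⟨![1, P 1 0 * e 0 + P 1 1 * e 1], P 0, fun h => by simpa using congrFun h 0, h0, ?_⟩
    intro i j
    fin_cases i
    · simp
    · fin_cases j <;> simp
      · linear_combination -P 1 0 * he - e 1 * hdet
      · linear_combination -P 1 1 * he + e 0 * hdet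

/-- If `P` is degenerate, it can be transformed into `x₀ y₀`, and then the coefficient of `x₁ y₁` in `Q`
vanishes by the orthogonality of `P` and `Q`. -/
theorem not_isSemistableForm_bilForm_of_det {P Q : Fin 2 → Fin 2 → ℂ} (hP : P ≠ 0)
    (hdet : P 0 0 * P 1 1 - P 0 1 * P 1 0 = 0) (hpol : polarDet P Q = 0) :
    ¬ IsSemistableForm (bilForm (P, Q)) := by
  obtain ⟨u, v, hu, hv, huv⟩ := exists_rank_one hP hdet
  obtain ⟨e, he⟩ := exists_dual_vector hu
  obtain ⟨f, hf⟩ := exists_dual_vector hv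
  intro hss
  have h := isSemistableForm_of_evalAt (det_straighten he) (det_straighten hf) hss
    (a := Matrix.of.symm !![0, 0, 0, 0; 0, 0, 0, 0; 0, 0, 0, bil Q ![-u 1, u 0] f;
      0, 0, bil Q e ![-v 1, v 0], bil Q e f]) (by
    intro x y
    have h1 : bil P (straighten u e *ᵥ x) (straighten v f *ᵥ y) = x 0 * y 0 := by
      simp only [bil, straighten_mulVec_zero, straighten_mulVec_one, huv]
      linear_combination (v 0 * f 0 + v 1 * f 1) * x 0 * y 0 * he + x 0 * y 0 * hf
    have h2 : bil Q (straighten u e *ᵥ x) (straighten v f *ᵥ y) =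
        bil Q e f * (x 0 * y 0) + bil Q e ![-v 1, v 0] * (x 0 * y 1) +
          bil Q ![-u 1, u 0] f * (x 1 * y 0) := by
      simp only [polarDet, huv] at hpol
      simp only [bil, straighten_mulVec_zero, straighten_mulVec_one, cons_val_zero, cons_val_one]
      linear_combination x 1 * y 1 * hpol
    rw [evalAt_bilForm, h1, h2]
    simp [Fin.sum_univ_four]
    ring)
  refine not_isSemistableForm_of_wt_pos 1 1 (fun i j hij => ?_) h
  rw [cf_ofCf] at hij
  fin_cases i <;> fin_cases j <;> first | exact absurd rfl hij | (norm_num [wt])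

/-- The substitution in `y` that transforms the bilinear form `x₀ y₁ - x₁ y₀` into `P`. -/
def toWedge (P : Fin 2 → Fin 2 → ℂ) : Matrix (Fin 2) (Fin 2) ℂ :=
  !![-P 1 0, -P 1 1; P 0 0, P 0 1]

theorem det_toWedge (P : Fin 2 → Fin 2 → ℂ) :
    (toWedge P).det = P 0 0 * P 1 1 - P 0 1 * P 1 0 := by
  rw [toWedge, det_fin_two_of]
  ring

theorem bil_eq_wedge (P : Fin 2 → Fin 2 → ℂ) (x y : Fin 2 → ℂ) :
    bil P x y = x 0 * (toWedge P *ᵥ y) 1 - x 1 * (toWedge P *ᵥ y) 0 := by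
  simp [toWedge, bil, mulVec, dotProduct, Fin.sum_univ_two]
  ring

/-- The compact family consists of the cubes `P³` of bilinear forms; `P³` is unstable if `P` is
degenerate, and in the orbit of the triple conic otherwise. -/
theorem isClosed_orbit_tripleConic :
    IsClosed {y : semistable | (y : XX) ∈ MulAction.orbit G tripleConic} := by
  refine isClosed_orbit_of_family (isCompact_sphere (0 : Fin 2 → Fin 2 → ℂ) 1)
    (φ := fun P => bilForm (P, P)) (continuous_bilForm.comp (continuous_id.prodMk continuous_id))
    ?_ tripleConicForm_ne_zero ?_ ?_
  · intro P hP
    have hP0 : P ≠ 0 := ne_zero_of_mem_unit_sphere ⟨P, hP⟩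
    exact bilForm_ne_zero hP0 hP0
  · intro A B
    set P : Fin 2 → Fin 2 → ℂ := fun i j =>
      (A⁻¹).1 0 i * (B⁻¹).1 1 j - (A⁻¹).1 1 i * (B⁻¹).1 0 j with hP
    have hP0 : P ≠ 0 := by
      intro h
      have hd : P 0 0 * P 1 1 - P 0 1 * P 1 0 = 1 := by
        simp only [hP]
        linear_combination ((B⁻¹).1 0 0 * (B⁻¹).1 1 1 - (B⁻¹).1 0 1 * (B⁻¹).1 1 0) * sl_det A⁻¹ +
          sl_det B⁻¹
      simp [h] at hd
    obtain ⟨r, hr, hr1⟩ := exists_norm_smul_eq_one hP0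
    refine ⟨r • P, by simpa using hr1, (r ^ 3)⁻¹, ext_evalAt fun x y => ?_⟩
    rw [evalAt_pair_smul, evalAt_smul, evalAt_bilForm, evalAt_tripleConicForm]
    simp only [bil, Pi.smul_apply, smul_eq_mul, hP, mulVec, dotProduct, Fin.sum_univ_two]
    field_simp
    ring
  · intro P hP hss
    have hP0 : P ≠ 0 := ne_zero_of_mem_unit_sphere ⟨P, hP⟩
    have hdet : P 0 0 * P 1 1 - P 0 1 * P 1 0 ≠ 0 := fun h =>
      not_isSemistableForm_bilForm_of_det hP0 h
        (by simp only [polarDet]; linear_combination 2 * h) hss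
    refine exists_smul_eq_of_evalAt (M := 1) (N := toWedge P) (M' := 1) (N' := 1) (k := 1)
      (by simp) (by rwa [det_toWedge]) (by simp) (by simp) fun x y => ?_
    rw [one_mulVec, one_mulVec, evalAt_bilForm, evalAt_tripleConicForm, bil_eq_wedge]
    ring

/-- A binary quadratic form is the product of two linear forms. -/
theorem exists_factorization (a b d : ℂ) :
    ∃ l m : Fin 2 → ℂ, a = l 0 * m 0 ∧ 2 * b = l 0 * m 1 + l 1 * m 0 ∧ d = l 1 * m 1 := by
  by_cases ha : a = 0
  · exact ⟨![0, 1], ![2 * b, d], by simp [ha], by simp, by simp⟩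
  · obtain ⟨s, hs⟩ := IsAlgClosed.exists_pow_nat_eq (b ^ 2 - a * d) two_pos
    refine ⟨![1, (b + s) / a], ![a, b - s], by simp, ?_, ?_⟩
    · simp only [cons_val_zero, cons_val_one]
      field_simp
      ring
    · simp only [cons_val_one, cons_val_zero]
      field_simp
      linear_combination hs

/-- A nondegenerate `P` can be transformed into `x₀ y₁ - x₁ y₀`. Then `Q` is a symmetric bilinear form,
the polarisation of a binary quadratic form: if this is a square, `P² Q` is unstable, and otherwise
its two linear factors can be taken as coordinates. -/
theorem exists_smul_eq_bilForm {P Q : Fin 2 → Fin 2 → ℂ} (hP : P ≠ 0) (hpol : polarDet P Q = 0)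
    (hss : IsSemistableForm (bilForm (P, Q))) :
    ∃ (g : G) (c : ℂ), bilForm (P, Q) = c • g • dForm 1 (-1) (-1) 1 := by
  have hdet : P 0 0 * P 1 1 - P 0 1 * P 1 0 ≠ 0 := fun h =>
    not_isSemistableForm_bilForm_of_det hP h hpol hss
  set δ := P 0 0 * P 1 1 - P 0 1 * P 1 0 with hδ
  have hN : (toWedge P).det ≠ 0 := by rwa [det_toWedge]
  -- in terms of `z = toWedge P *ᵥ y` the form `Q` becomes symmetric, with matrix `(a, b; b, d)`
  obtain ⟨a, ha⟩ : ∃ a, a = (Q 0 0 * P 0 1 - Q 0 1 * P 0 0) / δ := ⟨_, rfl⟩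
  obtain ⟨b, hb⟩ : ∃ b, b = (Q 0 0 * P 1 1 - Q 0 1 * P 1 0) / δ := ⟨_, rfl⟩
  obtain ⟨d, hd⟩ : ∃ d, d = (Q 1 0 * P 1 1 - Q 1 1 * P 1 0) / δ := ⟨_, rfl⟩
  rw [eq_div_iff hdet] at ha hb hd
  have hQ : ∀ x y, bil Q x y = bil ![![a, b], ![b, d]] x (toWedge P *ᵥ y) := by
    intro x y
    apply mul_left_cancel₀ hdet
    simp only [bil, toWedge, mulVec, dotProduct, Fin.sum_univ_two, of_apply, cons_val_zero,
      cons_val_one]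
    simp only [polarDet] at hpol
    linear_combination bil Q x y * hδ - x 0 * (-P 1 0 * y 0 + -P 1 1 * y 1) * ha -
      (x 0 * (P 0 0 * y 0 + P 0 1 * y 1) + x 1 * (-P 1 0 * y 0 + -P 1 1 * y 1)) * hb -
      x 1 * (P 0 0 * y 0 + P 0 1 * y 1) * hd - x 1 * (-P 1 0 * y 0 + -P 1 1 * y 1) * hpol
  obtain ⟨l, m, h1, h2, h3⟩ := exists_factorization a b d
  by_cases hlm : l 0 * m 1 - l 1 * m 0 = 0
  · exfalso
    have hsq : b ^ 2 = a * d := by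
      linear_combination (2 * b + l 0 * m 1 + l 1 * m 0) / 4 * h2 - d * h1 - l 0 * m 0 * h3 +
        (l 0 * m 1 - l 1 * m 0) / 4 * hlm
    obtain ⟨n, hn, κ, hκ1, hκ2, hκ3⟩ : ∃ n : Fin 2 → ℂ, n ≠ 0 ∧ ∃ κ : ℂ,
        a = κ * n 0 ^ 2 ∧ b = κ * (n 0 * n 1) ∧ d = κ * n 1 ^ 2 := by
      by_cases ha0 : a = 0
      · have hb0 : b = 0 := by simpa [ha0] using hsq
        exact ⟨![0, 1], fun h => by simpa using congrFun h 1, d, by simp [ha0], by simp [hb0],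
          by simp⟩
      · refine ⟨![1, b / a], fun h => by simpa using congrFun h 0, a, by simp, ?_, ?_⟩
        · simp only [cons_val_zero, cons_val_one]
          field_simp
        · simp only [cons_val_one, cons_val_zero]
          field_simp
          linear_combination -hsq
    obtain ⟨e, he⟩ := exists_dual_vector hn
    have hM := det_straighten he
    have h := isSemistableForm_of_evalAt (N := (toWedge P)⁻¹ * straighten n e) hM (by
      rw [det_mul]
      exact mul_ne_zero ((isUnit_nonsing_inv_det _ hN.isUnit).ne_zero) hM) hss
      (a := Matrix.of.symm !![0, 0, 0, 0; 0, 0, 0, κ; 0, 0, -2 * κ, 0; 0, κ, 0, 0]) (by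
      intro x y
      rw [evalAt_bilForm, bil_eq_wedge, hQ, mulVec_mulVec, mul_nonsing_inv_cancel_left _ _
        hN.isUnit]
      have e1 : (straighten n e *ᵥ x) 0 * (straighten n e *ᵥ y) 1 -
          (straighten n e *ᵥ x) 1 * (straighten n e *ᵥ y) 0 = x 0 * y 1 - x 1 * y 0 := by
        simp only [straighten_mulVec_zero, straighten_mulVec_one]
        linear_combination (x 0 * y 1 - x 1 * y 0) * he
      have e2 : bil ![![a, b], ![b, d]] (straighten n e *ᵥ x) (straighten n e *ᵥ y) =
          κ * (x 0 * y 0) := by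
        simp only [bil, straighten_mulVec_zero, straighten_mulVec_one, cons_val_zero, cons_val_one]
        rw [hκ1, hκ2, hκ3]
        linear_combination κ * (x 0 * y 0) * (n 0 * e 0 + n 1 * e 1 + 1) * he
      rw [e1, e2]
      simp [Fin.sum_univ_four]
      ring)
    refine not_isSemistableForm_of_wt_pos 1 1 (fun i j hij => ?_) h
    rw [cf_ofCf] at hij
    fin_cases i <;> fin_cases j <;> first | exact absurd rfl hij | (norm_num [wt])
  · have hL : (!![l 0, l 1; m 0, m 1] : Matrix (Fin 2) (Fin 2) ℂ).det ≠ 0 := by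
      rwa [det_fin_two_of]
    refine exists_smul_eq_of_evalAt (M := !![l 0, l 1; m 0, m 1])
      (N := !![l 0, l 1; m 0, m 1] * toWedge P) (M' := 1) (N' := 1)
      (k := (2 * (l 0 * m 1 - l 1 * m 0) ^ 2)⁻¹) hL (by rw [det_mul]; exact mul_ne_zero hL hN)
      (by simp) (by simp) fun x y => ?_
    rw [one_mulVec, one_mulVec, evalAt_bilForm, bil_eq_wedge, hQ, ← mulVec_mulVec, evalAt_dForm]
    generalize toWedge P *ᵥ y = z
    rw [eq_inv_mul_iff_mul_eq₀ (mul_ne_zero two_ne_zero (pow_ne_zero 2 hlm))]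
    simp [bil, mulVec, dotProduct, Fin.sum_univ_two]
    have hb : b = (l 0 * m 1 + l 1 * m 0) / 2 := by rw [← h2]; ring
    rw [h1, h3, hb]
    ring

/-- The closed orbit of the D-curve `(u - v)² (u + v)`, where `u = x₀ y₁` and `v = x₁ y₀`. The compact
family consists of the products `P² Q` of bilinear forms whose polarised determinant vanishes. -/
theorem isClosed_orbit_dForm (h0 : dForm 1 (-1) (-1) 1 ≠ 0) :
    IsClosed {y : semistable | (y : XX) ∈ MulAction.orbit G (Projectivization.mk ℂ _ h0)} := by
  have hpolc : Continuous fun p : (Fin 2 → Fin 2 → ℂ) × (Fin 2 → Fin 2 → ℂ) =>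
      polarDet p.1 p.2 := by
    unfold polarDet
    fun_prop
  refine isClosed_orbit_of_family (S := (Metric.sphere (0 : Fin 2 → Fin 2 → ℂ) 1 ×ˢ
      Metric.sphere (0 : Fin 2 → Fin 2 → ℂ) 1) ∩ {p | polarDet p.1 p.2 = 0})
    (((isCompact_sphere _ _).prod (isCompact_sphere _ _)).inter_right
      (isClosed_eq hpolc continuous_const)) continuous_bilForm ?_ h0 ?_ ?_
  · rintro ⟨P, Q⟩ ⟨⟨hP, hQ⟩, -⟩
    exact bilForm_ne_zero (ne_zero_of_mem_unit_sphere ⟨P, hP⟩) (ne_zero_of_mem_unit_sphere ⟨Q, hQ⟩)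
  · intro A B
    set P : Fin 2 → Fin 2 → ℂ := fun i j =>
      (A⁻¹).1 0 i * (B⁻¹).1 1 j - (A⁻¹).1 1 i * (B⁻¹).1 0 j with hP
    set Q : Fin 2 → Fin 2 → ℂ := fun i j =>
      (A⁻¹).1 0 i * (B⁻¹).1 1 j + (A⁻¹).1 1 i * (B⁻¹).1 0 j with hQ
    have hP0 : P ≠ 0 := by
      intro h
      have hd : P 0 0 * P 1 1 - P 0 1 * P 1 0 = 1 := by
        simp only [hP]
        linear_combination ((B⁻¹).1 0 0 * (B⁻¹).1 1 1 - (B⁻¹).1 0 1 * (B⁻¹).1 1 0) * sl_det A⁻¹ +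
          sl_det B⁻¹
      simp [h] at hd
    have hQ0 : Q ≠ 0 := by
      intro h
      have hd : Q 0 0 * Q 1 1 - Q 0 1 * Q 1 0 = -1 := by
        simp only [hQ]
        linear_combination -((B⁻¹).1 0 0 * (B⁻¹).1 1 1 - (B⁻¹).1 0 1 * (B⁻¹).1 1 0) * sl_det A⁻¹ -
          sl_det B⁻¹
      simp [h] at hd
    obtain ⟨r, hr, hr1⟩ := exists_norm_smul_eq_one hP0
    obtain ⟨s, hs, hs1⟩ := exists_norm_smul_eq_one hQ0
    refine ⟨(r • P, s • Q), ⟨⟨by simpa using hr1, by simpa using hs1⟩, ?_⟩, (r ^ 2 * s)⁻¹,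
      ext_evalAt fun x y => ?_⟩
    · simp only [Set.mem_ofPred_eq, polarDet, Pi.smul_apply, smul_eq_mul, hP, hQ]
      ring
    · rw [evalAt_pair_smul, evalAt_smul, evalAt_bilForm, evalAt_dForm]
      simp only [bil, Pi.smul_apply, smul_eq_mul, hP, hQ, mulVec, dotProduct, Fin.sum_univ_two]
      field_simp
      ring
  · rintro ⟨P, Q⟩ ⟨⟨hP, -⟩, hpol⟩ hss
    exact exists_smul_eq_bilForm (ne_zero_of_mem_unit_sphere ⟨P, hP⟩) hpol hss

/-! ### The family that contains the orbit of an A-curve -/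

/-- The linear form in `y` with coefficients `L`. -/
def linPoly (L : Fin 2 → ℂ) : MvPolynomial Idx ℂ := C (L 0) * yVar 0 + C (L 1) * yVar 1

/-- The form of bidegree `(3, 1)` with coefficients `c`. -/
def cubPoly (c : Fin 4 → Fin 2 → ℂ) : MvPolynomial Idx ℂ :=
  ((C (c 0 0) * (xVar 1 ^ 3 * yVar 0) + C (c 0 1) * (xVar 1 ^ 3 * yVar 1)) +
    (C (c 1 0) * (xVar 0 * xVar 1 ^ 2 * yVar 0) + C (c 1 1) * (xVar 0 * xVar 1 ^ 2 * yVar 1))) +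
  ((C (c 2 0) * (xVar 0 ^ 2 * xVar 1 * yVar 0) + C (c 2 1) * (xVar 0 ^ 2 * xVar 1 * yVar 1)) +
    (C (c 3 0) * (xVar 0 ^ 3 * yVar 0) + C (c 3 1) * (xVar 0 ^ 3 * yVar 1)))

/-- The values of a binary cubic form. -/
def cubic (c : Fin 4 → ℂ) (x : Fin 2 → ℂ) : ℂ :=
  c 0 * x 1 ^ 3 + c 1 * (x 0 * x 1 ^ 2) + (c 2 * (x 0 ^ 2 * x 1) + c 3 * x 0 ^ 3)

theorem eval_linPoly (L x y : Fin 2 → ℂ) :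
    eval (Sum.elim x y) (linPoly L) = L 0 * y 0 + L 1 * y 1 := by
  simp [linPoly, yVar]

theorem eval_cubPoly (c : Fin 4 → Fin 2 → ℂ) (x y : Fin 2 → ℂ) :
    eval (Sum.elim x y) (cubPoly c) =
      cubic (fun i => c i 0) x * y 0 + cubic (fun i => c i 1) x * y 1 := by
  simp [cubPoly, cubic, xVar, yVar]
  ring

theorem linPoly_ne_zero {L : Fin 2 → ℂ} (hL : L ≠ 0) : linPoly L ≠ 0 := by
  intro h
  have h1 : ∀ y : Fin 2 → ℂ, L 0 * y 0 + L 1 * y 1 = 0 := fun y => by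
    rw [← eval_linPoly L 0 y, h, map_zero]
  apply hL
  ext i
  fin_cases i
  · simpa using h1 ![1, 0]
  · simpa using h1 ![0, 1]

theorem cubic_eq_zero {c : Fin 4 → ℂ} (h : ∀ x, cubic c x = 0) : c = 0 := by
  have h0 := h ![0, 1]
  have h1 := h ![1, 0]
  have h2 := h ![1, 1]
  have h3 := h ![1, -1]
  simp [cubic] at h0 h1 h2 h3
  ext i
  fin_cases i <;> simp
  · exact h0
  · linear_combination (h2 + h3) / 2 - h1
  · linear_combination (h2 - h3) / 2 - h0
  · exact h1

theorem cubPoly_ne_zero {c : Fin 4 → Fin 2 → ℂ} (hc : c ≠ 0) : cubPoly c ≠ 0 := by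
  intro h
  have h1 : ∀ x y : Fin 2 → ℂ, cubic (fun i => c i 0) x * y 0 + cubic (fun i => c i 1) x * y 1 = 0 :=
    fun x y => by rw [← eval_cubPoly, h, map_zero]
  have h2 := cubic_eq_zero fun x => by simpa using h1 x ![1, 0]
  have h3 := cubic_eq_zero fun x => by simpa using h1 x ![0, 1]
  apply hc
  ext i j
  fin_cases j
  · exact congrFun h2 i
  · exact congrFun h3 i

theorem isWeightedHomogeneous_linPoly (L : Fin 2 → ℂ) :
    IsWeightedHomogeneous bideg (linPoly L) (0, 1) :=
  (isWeightedHomogeneous_C_mul (isWeightedHomogeneous_y 0) _).add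
    (isWeightedHomogeneous_C_mul (isWeightedHomogeneous_y 1) _)

theorem isWeightedHomogeneous_cubPoly (c : Fin 4 → Fin 2 → ℂ) :
    IsWeightedHomogeneous bideg (cubPoly c) (3, 1) := by
  have h0 : ∀ j, IsWeightedHomogeneous bideg (xVar 1 ^ 3 * yVar j) (3, 1) := fun j =>
    ((isWeightedHomogeneous_x 1).pow 3).mul (isWeightedHomogeneous_y j)
  have h1 : ∀ j, IsWeightedHomogeneous bideg (xVar 0 * xVar 1 ^ 2 * yVar j) (3, 1) := fun j =>
    ((isWeightedHomogeneous_x 0).mul ((isWeightedHomogeneous_x 1).pow 2)).mul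
      (isWeightedHomogeneous_y j)
  have h2 : ∀ j, IsWeightedHomogeneous bideg (xVar 0 ^ 2 * xVar 1 * yVar j) (3, 1) := fun j =>
    (((isWeightedHomogeneous_x 0).pow 2).mul (isWeightedHomogeneous_x 1)).mul
      (isWeightedHomogeneous_y j)
  have h3 : ∀ j, IsWeightedHomogeneous bideg (xVar 0 ^ 3 * yVar j) (3, 1) := fun j =>
    ((isWeightedHomogeneous_x 0).pow 3).mul (isWeightedHomogeneous_y j)
  exact ((((isWeightedHomogeneous_C_mul (h0 0) _).add (isWeightedHomogeneous_C_mul (h0 1) _)).add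
    ((isWeightedHomogeneous_C_mul (h1 0) _).add (isWeightedHomogeneous_C_mul (h1 1) _))).add
    (((isWeightedHomogeneous_C_mul (h2 0) _).add (isWeightedHomogeneous_C_mul (h2 1) _)).add
    ((isWeightedHomogeneous_C_mul (h3 0) _).add (isWeightedHomogeneous_C_mul (h3 1) _))))

/-- The form `L L' E`, for linear forms `L` and `L'` in `y` and a form `E` of bidegree `(3, 1)`. -/
def linLinCub (p : (Fin 2 → ℂ) × (Fin 2 → ℂ) × (Fin 4 → Fin 2 → ℂ)) : V :=
  ⟨linPoly p.1 * linPoly p.2.1 * cubPoly p.2.2,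
    ((isWeightedHomogeneous_linPoly p.1).mul (isWeightedHomogeneous_linPoly p.2.1)).mul
      (isWeightedHomogeneous_cubPoly p.2.2)⟩

theorem evalAt_linLinCub (L L' : Fin 2 → ℂ) (c : Fin 4 → Fin 2 → ℂ) (x y : Fin 2 → ℂ) :
    evalAt (linLinCub (L, L', c)) x y = (L 0 * y 0 + L 1 * y 1) * (L' 0 * y 0 + L' 1 * y 1) *
      (cubic (fun i => c i 0) x * y 0 + cubic (fun i => c i 1) x * y 1) := by
  simp only [evalAt, linLinCub, map_mul, eval_linPoly, eval_cubPoly]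

theorem continuous_linLinCub : Continuous linLinCub := by
  have h1 : ∀ {Y : Type} [TopologicalSpace Y] {f : Y → Fin 2 → ℂ}, Continuous f →
      ∀ m, Continuous fun y => coeff m (linPoly (f y)) := by
    intro Y _ f hf
    exact continuous_coeff_add (continuous_coeff_C_mul ((continuous_apply 0).comp hf) _)
      (continuous_coeff_C_mul ((continuous_apply 1).comp hf) _)
  have h2 : ∀ {Y : Type} [TopologicalSpace Y] {f : Y → Fin 4 → Fin 2 → ℂ}, Continuous f →
      ∀ m, Continuous fun y => coeff m (cubPoly (f y)) := by
    intro Y _ f hf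
    have h : ∀ i (P P' : MvPolynomial Idx ℂ) m,
        Continuous fun y => coeff m (C (f y i 0) * P + C (f y i 1) * P') := fun i P P' =>
      have hi := (continuous_apply i).comp hf
      continuous_coeff_add (continuous_coeff_C_mul ((continuous_apply 0).comp hi) _)
        (continuous_coeff_C_mul ((continuous_apply 1).comp hi) _)
    exact continuous_coeff_add (continuous_coeff_add (h 0 _ _) (h 1 _ _))
      (continuous_coeff_add (h 2 _ _) (h 3 _ _))
  exact continuous_form_of_coeff (continuous_coeff_mul
    (continuous_coeff_mul (h1 continuous_fst) (h1 (continuous_fst.comp continuous_snd)))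
    (h2 (continuous_snd.comp continuous_snd)))

/-- The equations that hold for the coefficients of the cube of a linear form. -/
def IsCube (c : Fin 4 → ℂ) : Prop :=
  3 * (c 3 * c 1) = c 2 ^ 2 ∧ 3 * (c 2 * c 0) = c 1 ^ 2 ∧ 9 * (c 3 * c 0) = c 2 * c 1

theorem IsCube.exists_cube {c : Fin 4 → ℂ} (h : IsCube c) :
    ∃ l : Fin 2 → ℂ, ∀ x, cubic c x = (l 0 * x 0 + l 1 * x 1) ^ 3 := by
  obtain ⟨h1, h2, h3⟩ := h
  by_cases h0 : c 3 = 0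
  · obtain ⟨r, hr⟩ := IsAlgClosed.exists_pow_nat_eq (c 0) three_pos
    have hc2 : c 2 = 0 := by simpa [h0] using h1.symm
    have hc1 : c 1 = 0 := by simpa [hc2] using h2.symm
    refine ⟨![0, r], fun x => ?_⟩
    simp [cubic, h0, hc1, hc2, ← hr]
    ring
  · obtain ⟨r, hr⟩ := IsAlgClosed.exists_pow_nat_eq (c 3) three_pos
    have hr0 : r ≠ 0 := by
      rintro rfl
      exact h0 (by simpa using hr.symm)
    rw [← hr] at h1 h3
    have hc1 : c 1 = c 2 ^ 2 / (3 * r ^ 3) := by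
      field_simp
      linear_combination h1
    have hc0 : c 0 = c 2 ^ 3 / (27 * r ^ 6) := by
      rw [hc1] at h3
      field_simp at h3 ⊢
      linear_combination h3
    refine ⟨![r, c 2 / (3 * r ^ 2)], fun x => ?_⟩
    simp only [cubic, cons_val_zero, cons_val_one, hc1, hc0, ← hr]
    field_simp
    ring

/-- The cubic form in `x` obtained from a form of bidegree `(3, 1)` by inserting for `y` the zero
`(L₁, -L₀)` of the linear form `L`. -/
def restrictCub (c : Fin 4 → Fin 2 → ℂ) (L : Fin 2 → ℂ) (i : Fin 4) : ℂ :=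
  c i 0 * L 1 - c i 1 * L 0

theorem cubic_restrictCub (c : Fin 4 → Fin 2 → ℂ) (L x : Fin 2 → ℂ) :
    cubic (restrictCub c L) x =
      cubic (fun i => c i 0) x * L 1 - cubic (fun i => c i 1) x * L 0 := by
  simp only [cubic, restrictCub]
  ring

theorem not_isSemistableForm_linLinCub_of_parallel {L L' : Fin 2 → ℂ} {c : Fin 4 → Fin 2 → ℂ}
    (hL : L ≠ 0) (hpar : L 0 * L' 1 - L 1 * L' 0 = 0) :
    ¬ IsSemistableForm (linLinCub (L, L', c)) := by
  obtain ⟨e, he⟩ := exists_dual_vector hL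
  intro hss
  set k := L' 0 * e 0 + L' 1 * e 1 with hk
  have h := isSemistableForm_of_evalAt (M := 1) (by simp) (det_straighten he) hss
    (a := fun i j => if j = 3 then k * (c i 0 * e 0 + c i 1 * e 1) else
      if j = 2 then -k * restrictCub c L i else 0) (by
    intro x y
    have h1 : L 0 * (straighten L e *ᵥ y) 0 + L 1 * (straighten L e *ᵥ y) 1 = y 0 := by
      rw [straighten_mulVec_zero, straighten_mulVec_one]
      linear_combination y 0 * he
    have h2 : L' 0 * (straighten L e *ᵥ y) 0 + L' 1 * (straighten L e *ᵥ y) 1 = k * y 0 := by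
      rw [straighten_mulVec_zero, straighten_mulVec_one, hk]
      linear_combination y 1 * hpar
    rw [one_mulVec, evalAt_linLinCub, h1, h2, straighten_mulVec_zero, straighten_mulVec_one]
    simp [Fin.sum_univ_four, cubic, restrictCub]
    ring)
  refine not_isSemistableForm_of_wt_pos 0 1 (fun i j hij => ?_) h
  rw [cf_ofCf] at hij
  fin_cases j <;> first | exact absurd rfl hij | (norm_num [wt])

theorem exists_smul_eq_linLinCub {L L' : Fin 2 → ℂ} {c : Fin 4 → Fin 2 → ℂ} (hL : L ≠ 0)
    (hc : IsCube (restrictCub c L)) (hc' : IsCube (restrictCub c L'))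
    (hss : IsSemistableForm (linLinCub (L, L', c))) :
    ∃ (g : G) (k : ℂ), linLinCub (L, L', c) = k • g • aForm 1 1 := by
  have hdet : L 0 * L' 1 - L 1 * L' 0 ≠ 0 := fun h =>
    not_isSemistableForm_linLinCub_of_parallel hL h hss
  set δ := L 0 * L' 1 - L 1 * L' 0 with hδ
  obtain ⟨l, hl⟩ := hc.exists_cube
  obtain ⟨m, hm⟩ := hc'.exists_cube
  have hN : (!![L' 1, L 1; -L' 0, -L 0] : Matrix (Fin 2) (Fin 2) ℂ).det ≠ 0 := by
    rw [det_fin_two_of, show L' 1 * -L 0 - L 1 * -L' 0 = -δ by rw [hδ]; ring]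
    exact neg_ne_zero.2 hdet
  -- the columns of the substitution in `y` are the zeros of `L'` and of `L`
  have key : ∀ x y, evalAt (linLinCub (L, L', c)) x (!![L' 1, L 1; -L' 0, -L 0] *ᵥ y) =
      -δ ^ 2 * (y 0 * y 1 * ((m 0 * x 0 + m 1 * x 1) ^ 3 * y 0 +
        (l 0 * x 0 + l 1 * x 1) ^ 3 * y 1)) := by
    intro x y
    rw [evalAt_linLinCub, ← hl, ← hm, cubic_restrictCub, cubic_restrictCub]
    simp only [mulVec, dotProduct, Fin.sum_univ_two, of_apply, cons_val_zero, cons_val_one, hδ]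
    ring
  by_cases hlm : l 0 * m 1 - l 1 * m 0 = 0
  · exfalso
    obtain ⟨n, hn, s, t, hs, ht⟩ : ∃ n : Fin 2 → ℂ, n ≠ 0 ∧ ∃ s t : ℂ, l = s • n ∧ m = t • n := by
      by_cases hl0 : l = 0
      · by_cases hm0 : m = 0
        · exact ⟨![1, 0], fun h => by simpa using congrFun h 0, 0, 0, by simpa using hl0,
            by simpa using hm0⟩
        · exact ⟨m, hm0, 0, 1, by simpa using hl0, by simp⟩
      · obtain ⟨e, he⟩ := exists_dual_vector hl0
        refine ⟨l, hl0, 1, m 0 * e 0 + m 1 * e 1, by simp, ?_⟩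
        ext i
        fin_cases i <;> simp
        · linear_combination -m 0 * he - e 1 * hlm
        · linear_combination -m 1 * he + e 0 * hlm
    obtain ⟨e, he⟩ := exists_dual_vector hn
    have h := isSemistableForm_of_evalAt (det_straighten he) hN hss
      (a := Matrix.of.symm !![0, 0, 0, 0; 0, 0, 0, 0; 0, 0, 0, 0;
        0, -δ ^ 2 * s ^ 3, -δ ^ 2 * t ^ 3, 0]) (by
      intro x y
      have h1 : n 0 * (straighten n e *ᵥ x) 0 + n 1 * (straighten n e *ᵥ x) 1 = x 0 := by
        rw [straighten_mulVec_zero, straighten_mulVec_one]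
        linear_combination x 0 * he
      have h2 : l 0 * (straighten n e *ᵥ x) 0 + l 1 * (straighten n e *ᵥ x) 1 = s * x 0 := by
        rw [← h1, hs]
        simp only [Pi.smul_apply, smul_eq_mul]
        ring
      have h3 : m 0 * (straighten n e *ᵥ x) 0 + m 1 * (straighten n e *ᵥ x) 1 = t * x 0 := by
        rw [← h1, ht]
        simp only [Pi.smul_apply, smul_eq_mul]
        ring
      rw [key, h2, h3]
      simp [Fin.sum_univ_four]
      ring)
    refine not_isSemistableForm_of_wt_pos 1 0 (fun i j hij => ?_) h
    rw [cf_ofCf] at hij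
    fin_cases i <;> fin_cases j <;> first | exact absurd rfl hij | (norm_num [wt])
  · refine exists_smul_eq_of_evalAt (M := !![l 0, l 1; m 0, m 1]) (N := 1) (M' := 1)
      (N' := !![L' 1, L 1; -L' 0, -L 0]) (k := -δ ^ 2) (by rwa [det_fin_two_of]) (by simp) (by simp)
      hN fun x y => ?_
    rw [one_mulVec, one_mulVec, key, evalAt_aForm]
    simp only [mulVec, dotProduct, Fin.sum_univ_two, of_apply, cons_val_zero, cons_val_one]
    ring

/-- The compact family consists of the products `L L' E` for which `E` restricts to cubes of linear
forms in `x` at the zeros of `L` and of `L'`. -/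
theorem isClosed_orbit_aForm (h0 : aForm 1 1 ≠ 0) :
    IsClosed {y : semistable | (y : XX) ∈ MulAction.orbit G (Projectivization.mk ℂ _ h0)} := by
  have hclosed : IsClosed {p : (Fin 2 → ℂ) × (Fin 2 → ℂ) × (Fin 4 → Fin 2 → ℂ) |
      IsCube (restrictCub p.2.2 p.1) ∧ IsCube (restrictCub p.2.2 p.2.1)} := by
    have h : ∀ f : (Fin 2 → ℂ) × (Fin 2 → ℂ) × (Fin 4 → Fin 2 → ℂ) → Fin 4 → ℂ, Continuous f →
        IsClosed {p | IsCube (f p)} := by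
      intro f hf
      exact (isClosed_eq (by fun_prop) (by fun_prop)).inter
        ((isClosed_eq (by fun_prop) (by fun_prop)).inter
          (isClosed_eq (by fun_prop) (by fun_prop)))
    exact (h _ (by unfold restrictCub; fun_prop)).inter (h _ (by unfold restrictCub; fun_prop))
  refine isClosed_orbit_of_family (S := (Metric.sphere (0 : Fin 2 → ℂ) 1 ×ˢ
      (Metric.sphere (0 : Fin 2 → ℂ) 1 ×ˢ Metric.sphere (0 : Fin 4 → Fin 2 → ℂ) 1)) ∩
      {p | IsCube (restrictCub p.2.2 p.1) ∧ IsCube (restrictCub p.2.2 p.2.1)})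
    (((isCompact_sphere _ _).prod ((isCompact_sphere _ _).prod (isCompact_sphere _ _))).inter_right
      hclosed) continuous_linLinCub ?_ h0 ?_ ?_
  · rintro ⟨L, L', c⟩ ⟨⟨hL, hL', hc⟩, -⟩ h
    exact mul_ne_zero (mul_ne_zero (linPoly_ne_zero (ne_zero_of_mem_unit_sphere ⟨L, hL⟩))
      (linPoly_ne_zero (ne_zero_of_mem_unit_sphere ⟨L', hL'⟩)))
      (cubPoly_ne_zero (ne_zero_of_mem_unit_sphere ⟨c, hc⟩)) (congrArg Subtype.val h)
  · intro A B
    have hA := sl_det A⁻¹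
    have hB := sl_det B⁻¹
    set a := (A⁻¹).1 with ha
    set b := (B⁻¹).1 with hb
    -- the coefficients of the cubes of the rows of `A⁻¹`
    obtain ⟨u, hu⟩ : ∃ u : Fin 2 → Fin 4 → ℂ, u = fun r =>
      ![a r 1 ^ 3, 3 * a r 0 * a r 1 ^ 2, 3 * a r 0 ^ 2 * a r 1, a r 0 ^ 3] := ⟨_, rfl⟩
    obtain ⟨c, hc⟩ : ∃ c : Fin 4 → Fin 2 → ℂ, c = fun i j => u 0 i * b 1 j + u 1 i * b 0 j :=
      ⟨_, rfl⟩
    have hL : b 0 ≠ 0 := fun h => by simp [h] at hB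
    have hL' : b 1 ≠ 0 := fun h => by simp [h] at hB
    have hr : ∀ i, restrictCub c (b 0) i = -u 0 i := fun i => by
      simp only [restrictCub, hc]
      linear_combination -u 0 i * hB
    have hr' : ∀ i, restrictCub c (b 1) i = u 1 i := fun i => by
      simp only [restrictCub, hc]
      linear_combination u 1 i * hB
    have hc0 : c ≠ 0 := by
      intro h
      have h1 := hr 0
      have h2 := hr 3
      simp [restrictCub, h, hu] at h1 h2
      simp [h1, h2] at hA
    obtain ⟨r, hr0, hr1⟩ := exists_norm_smul_eq_one hL
    obtain ⟨s, hs0, hs1⟩ := exists_norm_smul_eq_one hL'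
    obtain ⟨t, ht0, ht1⟩ := exists_norm_smul_eq_one hc0
    have hscale : ∀ (k : ℂ) (L : Fin 2 → ℂ), restrictCub (t • c) (k • L) =
        fun i => t * k * restrictCub c L i := by
      intro k L
      ext i
      simp only [restrictCub, Pi.smul_apply, smul_eq_mul]
      ring
    refine ⟨(r • b 0, s • b 1, t • c), ⟨⟨by simpa using hr1, by simpa using hs1,
      by simpa using ht1⟩, ?_, ?_⟩, (r * s * t)⁻¹, ext_evalAt fun x y => ?_⟩
    · rw [hscale]
      simp only [IsCube, hr, hu, cons_val]
      refine ⟨?_, ?_, ?_⟩ <;> ring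
    · rw [hscale]
      simp only [IsCube, hr', hu, cons_val]
      refine ⟨?_, ?_, ?_⟩ <;> ring
    · rw [evalAt_pair_smul, evalAt_smul, evalAt_linLinCub, evalAt_aForm]
      simp only [cubic, Pi.smul_apply, smul_eq_mul, hc, hu, mulVec, dotProduct, Fin.sum_univ_two,
        cons_val, ← ha, ← hb]
      field_simp
      ring
  · rintro ⟨L, L', c⟩ ⟨⟨hL, -, -⟩, hc, hc'⟩ hss
    exact exists_smul_eq_linLinCub (ne_zero_of_mem_unit_sphere ⟨L, hL⟩) hc hc' hss

/-! ### Strictly polystable points -/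

theorem diagSL_injective : Function.Injective diagSL := by
  intro s t h
  have h1 := congrArg (fun A : SL(2, ℂ) => A.1 0 0) h
  apply Units.ext
  simpa [diagSL_val] using h1

theorem torusHom_injective (k : ℕ) : Function.Injective (torusHom k) := by
  intro s t h
  rw [torusHom_apply, torusHom_apply] at h
  exact diagSL_injective (pair_injective h).1

theorem diagonalHom_injective : Function.Injective diagonalHom := fun _ _ h =>
  (pair_injective h).1

theorem infinite_of_range_torusHom_le {k : ℕ} {H : Subgroup G} (h : (torusHom k).range ≤ H) :
    Infinite H := by
  have h1 : Infinite ℂˣ := by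
    refine Infinite.of_injective (fun r : ℝ => expUnit r) fun r s hrs => ?_
    have h2 := congrArg (fun u : ℂˣ => (u : ℂ)) hrs
    have h3 : Complex.exp r = Complex.exp s := h2
    rw [← Complex.ofReal_exp, ← Complex.ofReal_exp, Complex.ofReal_inj] at h3
    exact Real.exp_injective h3
  exact Infinite.of_injective (fun t => (⟨torusHom k t, h ⟨t, rfl⟩⟩ : H)) fun s t hst =>
    torusHom_injective k (congrArg Subtype.val hst)

theorem isStrictlyPolystable_tripleConic : IsStrictlyPolystable tripleConic :=
  ⟨(mk_mem_semistable _).2 isSemistableForm_tripleConicForm, isClosed_orbit_tripleConic,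
    infinite_of_range_torusHom_le (RD_le_RC.trans RC_le_stabilizer_tripleConic)⟩

theorem RC_mem_polystableStabilisers : RC ∈ polystableStabilisers :=
  ⟨_, isStrictlyPolystable_tripleConic, identityComponent_stabilizer_tripleConic.symm⟩

theorem RD_mem_polystableStabilisers : RD ∈ polystableStabilisers := by
  have hss : IsSemistableForm (dForm 1 (-1) (-1) 1) :=
    isSemistableForm_dForm (Or.inl one_ne_zero) (Or.inr one_ne_zero)
  refine ⟨Projectivization.mk ℂ _ hss.ne_zero, ⟨(mk_mem_semistable _).2 hss,
    isClosed_orbit_dForm _, infinite_of_range_torusHom_le (RD_le_stabilizer_dForm _)⟩,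
    (identityComponent_stabilizer_dForm _ (Or.inl one_ne_zero) (Or.inr one_ne_zero) ?_).symm⟩
  rintro ⟨r, hr, h1, h2, h3⟩
  have h4 : r = 1 / 3 := by linear_combination h1 / 3
  rw [h4] at h2
  norm_num at h2

theorem RA_mem_polystableStabilisers : RA ∈ polystableStabilisers := by
  have hss : IsSemistableForm (aForm 1 1) := isSemistableForm_aForm one_ne_zero one_ne_zero
  exact ⟨Projectivization.mk ℂ _ hss.ne_zero, ⟨(mk_mem_semistable _).2 hss,
    isClosed_orbit_aForm _, infinite_of_range_torusHom_le (RA_le_stabilizer_aForm _)⟩,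
    (identityComponent_stabilizer_aForm _ one_ne_zero one_ne_zero).symm⟩

/-! ### Normal forms for elements of the Lie algebra `sl₂` -/

theorem exists_sl_conj_upper_triangular {P : Matrix (Fin 2) (Fin 2) ℂ} (hP : P.trace = 0) :
    ∃ (A : SL(2, ℂ)) (α β : ℂ), A.1 * P * (A⁻¹).1 = !![α, β; 0, -α] := by
  rw [trace_fin_two] at hP
  obtain ⟨α, hα⟩ := IsAlgClosed.exists_pow_nat_eq (P 0 0 ^ 2 + P 0 1 * P 1 0) two_pos
  -- an eigenvector for `α`, a square root of `-det P`
  obtain ⟨v, hv, hv0, hv1⟩ : ∃ v : Fin 2 → ℂ, v ≠ 0 ∧ P 0 0 * v 0 + P 0 1 * v 1 = α * v 0 ∧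
      P 1 0 * v 0 + P 1 1 * v 1 = α * v 1 := by
    by_cases h1 : (![P 0 1, α - P 0 0] : Fin 2 → ℂ) = 0
    · have e1 : P 0 1 = 0 := by simpa using congrFun h1 0
      have e2 : α - P 0 0 = 0 := by simpa using congrFun h1 1
      by_cases h2 : (![α + P 0 0, P 1 0] : Fin 2 → ℂ) = 0
      · have e3 : α + P 0 0 = 0 := by simpa using congrFun h2 0
        have e4 : P 1 0 = 0 := by simpa using congrFun h2 1
        refine ⟨![1, 0], fun h => by simpa using congrFun h 0, ?_, ?_⟩
        · simp
          linear_combination -e2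
        · simp [e4]
      · refine ⟨_, h2, ?_, ?_⟩ <;> simp
        · linear_combination -hα
        · linear_combination P 1 0 * hP
    · refine ⟨_, h1, ?_, ?_⟩ <;> simp
      · ring
      · linear_combination -hα + (α - P 0 0) * hP
  obtain ⟨e, he⟩ := exists_dual_vector hv
  let A : SL(2, ℂ) := ⟨!![e 0, e 1; -v 1, v 0], by rw [det_fin_two_of]; linear_combination he⟩
  have hA : A.1 = !![e 0, e 1; -v 1, v 0] := rfl
  refine ⟨A, α, (A.1 * P * (A⁻¹).1) 0 1, ?_⟩
  rw [sl_inv, hA]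
  ext i j
  fin_cases i <;> fin_cases j <;> simp [mul_apply, Fin.sum_univ_two, vecMul, dotProduct]
  · linear_combination e 0 * hv0 + e 1 * hv1 + α * he
  · linear_combination v 0 * hv1 - v 1 * hv0
  · linear_combination (v 0 * e 0 + v 1 * e 1) * hP - e 0 * hv0 - e 1 * hv1 - α * he

/-- An element of `sl₂` is conjugate to a diagonal or to a strictly upper triangular matrix. -/
theorem exists_sl_conj_normal_form {P : Matrix (Fin 2) (Fin 2) ℂ} (hP : P.trace = 0) :
    ∃ (A : SL(2, ℂ)) (α β : ℂ), A.1 * P * (A⁻¹).1 = !![α, β; 0, -α] ∧ (α = 0 ∨ β = 0) := by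
  obtain ⟨A, α, β, h⟩ := exists_sl_conj_upper_triangular hP
  by_cases hα : α = 0
  · exact ⟨A, α, β, h, Or.inl hα⟩
  · refine ⟨upper (β / (2 * α)) * A, α, 0, ?_, Or.inr rfl⟩
    rw [_root_.mul_inv_rev, sl_mul, sl_mul, upper_inv]
    calc (upper (β / (2 * α))).1 * A.1 * P * ((A⁻¹).1 * !![1, -(β / (2 * α)); 0, 1])
        = (upper (β / (2 * α))).1 * (A.1 * P * (A⁻¹).1) * !![1, -(β / (2 * α)); 0, 1] := by
          simp only [Matrix.mul_assoc]
      _ = _ := by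
          rw [h, upper]
          ext i j
          fin_cases i <;> fin_cases j <;> simp [mul_apply, Fin.sum_univ_two]
          field_simp
          ring

/-! ### Forms with a nontrivial infinitesimal stabiliser -/

/-- The Weyl element of `SL₂`. -/
def weyl : SL(2, ℂ) := ⟨!![0, 1; -1, 0], by simp [det_fin_two]⟩

theorem cf_weyl_smul (F : V) (i j : Fin 4) :
    cf (pair 1 weyl • F) i j = (-1) ^ (3 - j : ℕ) * cf F i j.rev := by
  have h : pair 1 weyl • F = ofCf fun i j => (-1) ^ (3 - j : ℕ) * cf F i j.rev := by
    apply eq_ofCf_of_evalAt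
    intro x y
    rw [evalAt_pair_smul, inv_one, sl_one, one_mulVec, sl_inv, evalAt_eq]
    simp [weyl, mulVec, dotProduct, Fin.sum_univ_two, Fin.sum_univ_four, Fin.rev]
    ring
  rw [h, cf_ofCf]

theorem mk_mem_curvesD_of_support {F : V} (hF : F ≠ 0) (hss : IsSemistableForm F)
    (h : ∀ i j, cf F i j ≠ 0 → (i : ℕ) + j = 3) : Projectivization.mk ℂ F hF ∈ curvesD := by
  obtain ⟨a, b, c, d, rfl⟩ : ∃ a b c d, F = dForm a b c d := ⟨_, _, _, _, eq_dForm_of_support h⟩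
  exact (mem_curvesD_iff hF).2 (dForm_of_isSemistableForm hss)

theorem mk_mem_curvesA_of_support {F : V} (hF : F ≠ 0) (hss : IsSemistableForm F)
    (h : ∀ i j, cf F i j ≠ 0 → (i = 3 ∧ j = 1) ∨ (i = 0 ∧ j = 2)) :
    Projectivization.mk ℂ F hF ∈ curvesA := by
  obtain ⟨a, b, rfl⟩ : ∃ a b, F = aForm a b := ⟨_, _, eq_aForm_of_support h⟩
  exact (mem_curvesA_iff hF).2 (aForm_of_isSemistableForm hss)

/-- The exponents on the line through the centre of the square of exponents and one given exponent
are, up to the symmetries of the square, among the exponents of the D-curves or of the A-curves. -/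
theorem exponents_on_line (i₀ j₀ : Fin 4) :
    (∀ i j : Fin 4, (2 * (i : ℤ) - 3) * (2 * (j₀ : ℤ) - 3) = (2 * (i₀ : ℤ) - 3) * (2 * (j : ℤ) - 3) →
      (i : ℕ) + j = 3) ∨
    (∀ i j : Fin 4, (2 * (i : ℤ) - 3) * (2 * (j₀ : ℤ) - 3) = (2 * (i₀ : ℤ) - 3) * (2 * (j : ℤ) - 3) →
      i = j) ∨
    (∀ i j : Fin 4, (2 * (i : ℤ) - 3) * (2 * (j₀ : ℤ) - 3) = (2 * (i₀ : ℤ) - 3) * (2 * (j : ℤ) - 3) →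
      (i = 3 ∧ j = 1) ∨ (i = 0 ∧ j = 2)) ∨
    (∀ i j : Fin 4, (2 * (i : ℤ) - 3) * (2 * (j₀ : ℤ) - 3) = (2 * (i₀ : ℤ) - 3) * (2 * (j : ℤ) - 3) →
      (i = 3 ∧ j = 2) ∨ (i = 0 ∧ j = 1)) ∨
    (∀ i j : Fin 4, (2 * (i : ℤ) - 3) * (2 * (j₀ : ℤ) - 3) = (2 * (i₀ : ℤ) - 3) * (2 * (j : ℤ) - 3) →
      (i = 1 ∧ j = 3) ∨ (i = 2 ∧ j = 0)) ∨
    (∀ i j : Fin 4, (2 * (i : ℤ) - 3) * (2 * (j₀ : ℤ) - 3) = (2 * (i₀ : ℤ) - 3) * (2 * (j : ℤ) - 3) →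
      (i = 2 ∧ j = 3) ∨ (i = 1 ∧ j = 0)) := by
  revert i₀ j₀
  decide

/-- The orbit of `x` contains a D-curve or an A-curve. -/
def MeetsCurves (x : XX) : Prop := ∃ g : G, g • x ∈ curvesD ∨ g • x ∈ curvesA

theorem MeetsCurves.of_smul {g : G} {x : XX} (h : MeetsCurves (g • x)) : MeetsCurves x := by
  obtain ⟨g', h⟩ := h
  exact ⟨g' * g, by rwa [mul_smul]⟩

/-- A form that is an eigenvector with nonzero eigenvalue of a diagonal element of the Lie algebra is
unstable: the real or the imaginary part of the weight gives a destabilising one-parameter subgroup. -/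
theorem not_isSemistableForm_of_complex_weight {α α' k : ℂ} (hk : k ≠ 0) {F : V}
    (h : ∀ i j, cf F i j ≠ 0 → (2 * (i : ℕ) - 3) * α + (2 * (j : ℕ) - 3) * α' = k) :
    ¬ IsSemistableForm F := by
  refine not_isSemistableForm_of_wt_pos (α * starRingEnd ℂ k).re (α' * starRingEnd ℂ k).re
    fun i j hij => ?_
  have h1 : ((2 * (i : ℕ) - 3) * (α * starRingEnd ℂ k) +
      (2 * (j : ℕ) - 3) * (α' * starRingEnd ℂ k)).re = Complex.normSq k := by
    rw [← Complex.ofReal_re (Complex.normSq k), ← Complex.mul_conj]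
    congr 1
    rw [← h i j hij]
    ring
  have h2 : wt (α * starRingEnd ℂ k).re (α' * starRingEnd ℂ k).re i j = Complex.normSq k := by
    rw [← h1, wt]
    have e : ∀ (n : ℕ) (z : ℂ), ((2 * (n : ℂ) - 3) * z).re = z.re * (2 * n - 3) := by
      intro n z
      have : (2 * (n : ℂ) - 3) = ((2 * n - 3 : ℝ) : ℂ) := by push_cast; ring
      rw [this, Complex.re_ofReal_mul, mul_comm]
    rw [Complex.add_re, e, e]
  rw [h2]
  exact Complex.normSq_pos.2 hk

/-- The case of a diagonal element of the Lie algebra: the exponents of the form lie on a line through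
the centre of the square of exponents. -/
theorem meetsCurves_of_diagonal {α α' k : ℂ} (hα : α ≠ 0 ∨ α' ≠ 0) {F : V} (hF : F ≠ 0)
    (hss : IsSemistableForm F)
    (h : ∀ i j, cf F i j ≠ 0 → (2 * (i : ℕ) - 3) * α + (2 * (j : ℕ) - 3) * α' = k) :
    MeetsCurves (Projectivization.mk ℂ F hF) := by
  have hk : k = 0 := by
    by_contra hk
    exact not_isSemistableForm_of_complex_weight hk h hss
  subst hk
  obtain ⟨i₀, j₀, h0⟩ := exists_cf_ne_zero hF
  have hodd : ∀ i : Fin 4, (2 * ((i : ℕ) : ℂ) - 3) ≠ 0 := by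
    intro i
    fin_cases i <;> norm_num
  have hα0 : α ≠ 0 := by
    rintro rfl
    have h1 := h i₀ j₀ h0
    rw [mul_zero, zero_add, mul_eq_zero] at h1
    rcases hα with hα | hα
    · exact hα rfl
    · exact h1.elim (hodd j₀) hα
  have hline : ∀ i j, cf F i j ≠ 0 →
      (2 * (i : ℤ) - 3) * (2 * (j₀ : ℤ) - 3) = (2 * (i₀ : ℤ) - 3) * (2 * (j : ℤ) - 3) := by
    intro i j hij
    have h1 : ((2 * ((i : ℕ) : ℂ) - 3) * (2 * ((j₀ : ℕ) : ℂ) - 3)) * α =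
        ((2 * ((i₀ : ℕ) : ℂ) - 3) * (2 * ((j : ℕ) : ℂ) - 3)) * α := by
      linear_combination (2 * ((j₀ : ℕ) : ℂ) - 3) * h i j hij -
        (2 * ((j : ℕ) : ℂ) - 3) * h i₀ j₀ h0
    have h2 := mul_right_cancel₀ hα0 h1
    exact_mod_cast h2
  have hweyl : ∀ i j, cf (pair 1 weyl • F) i j ≠ 0 → cf F i j.rev ≠ 0 := by
    intro i j hij h1
    exact hij (by rw [cf_weyl_smul, h1, mul_zero])
  have hs : ∀ g : G, IsSemistableForm (g • F) := fun g =>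
    (isSemistableForm_group_smul_iff g F).2 hss
  rcases exponents_on_line i₀ j₀ with h1 | h1 | h1 | h1 | h1 | h1
  · refine ⟨1, Or.inl ?_⟩
    rw [one_smul]
    exact mk_mem_curvesD_of_support _ hss fun i j hij => h1 i j (hline i j hij)
  · refine ⟨pair 1 weyl, Or.inl ?_⟩
    rw [Projectivization.smul_mk]
    refine mk_mem_curvesD_of_support _ (hs _) fun i j hij => ?_
    have h2 := h1 _ _ (hline _ _ (hweyl i j hij))
    rw [h2, Fin.val_rev]
    omega
  · refine ⟨1, Or.inr ?_⟩
    rw [one_smul]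
    exact mk_mem_curvesA_of_support _ hss fun i j hij => h1 i j (hline i j hij)
  · refine ⟨pair 1 weyl, Or.inr ?_⟩
    rw [Projectivization.smul_mk]
    refine mk_mem_curvesA_of_support _ (hs _) fun i j hij => ?_
    have h2 := h1 _ _ (hline _ _ (hweyl i j hij))
    revert h2
    clear hij
    revert i j
    decide
  · refine ⟨sw, Or.inr ?_⟩
    rw [Projectivization.smul_mk]
    refine mk_mem_curvesA_of_support _ (hs _) fun i j hij => ?_
    rw [cf_sw_smul] at hij
    have h2 := h1 _ _ (hline _ _ hij)
    tauto
  · refine ⟨sw * pair 1 weyl, Or.inr ?_⟩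
    rw [Projectivization.smul_mk]
    refine mk_mem_curvesA_of_support _ (hs _) fun i j hij => ?_
    rw [mul_smul, cf_sw_smul] at hij
    have h2 := h1 _ _ (hline _ _ (hweyl _ _ hij))
    revert h2
    clear hij
    revert i j
    decide

/-- If a form is an eigenvector of the sum of a nonzero diagonal element in the first factor and a
nilpotent element in the second one, then only one power of `x₀` occurs in it. -/
theorem not_isSemistableForm_of_diag_nilpotent {α β k : ℂ} (hα : α ≠ 0) {F : V}
    (h : ∀ i j, lieCf α 0 0 0 β 0 (cf F) i j = k * cf F i j) : ¬ IsSemistableForm F := by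
  have hodd : ∀ i : Fin 4, (2 * ((i : ℕ) : ℂ) - 3) ≠ 0 := by
    intro i
    fin_cases i <;> norm_num
  have hsupp : ∀ i j, cf F i j ≠ 0 → (2 * ((i : ℕ) : ℂ) - 3) * α = k := by
    intro i j hij
    by_contra hne
    have hne' : (2 * ((i : ℕ) : ℂ) - 3) * α - k ≠ 0 := sub_ne_zero.2 hne
    have e : ∀ j, ((2 * ((i : ℕ) : ℂ) - 3) * α - k) * cf F i j +
        ![1 * β * cf F i 1, 2 * β * cf F i 2, 3 * β * cf F i 3, 0] j = 0 := by
      intro j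
      have h1 := h i j
      simp only [lieCf] at h1
      fin_cases i <;> fin_cases j <;>
        simp [-mul_eq_zero, -zero_eq_mul, -mul_eq_mul_right_iff] at h1 ⊢ <;>
      linear_combination h1
    have e3 := e 3
    have e2 := e 2
    have e1 := e 1
    have e0 := e 0
    simp [hne'] at e3
    simp [e3, hne'] at e2
    simp [e2, hne'] at e1
    simp [e1, hne'] at e0
    fin_cases j <;> simp_all
  intro hss
  obtain ⟨i₀, j₀, h0⟩ := exists_cf_ne_zero hss.ne_zero
  have hk : k ≠ 0 := by
    rw [← hsupp i₀ j₀ h0]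
    exact mul_ne_zero (hodd i₀) hα
  refine not_isSemistableForm_of_complex_weight (α := α) (α' := 0) hk (fun i j hij => ?_) hss
  rw [mul_zero, add_zero]
  exact hsupp i j hij

/-- The limit of a semistable form under a one-parameter subgroup stays in the orbit of the form if
that orbit is closed in the semistable locus. -/
theorem mk_mem_orbit_of_weightZeroPart {p q : ℝ} {F F₀ : V} (hF : F ≠ 0) (hss : IsSemistableForm F)
    (hcl : IsClosed {y : semistable | (y : XX) ∈ MulAction.orbit G (Projectivization.mk ℂ F hF)})
    (h : ∀ i j, cf F i j ≠ 0 → 0 ≤ wt p q i j)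
    (h₀ : ∀ i j, cf F₀ i j = if wt p q i j = 0 then cf F i j else 0) (hF₀ : F₀ ≠ 0) :
    ∃ g : G, g • Projectivization.mk ℂ F hF = Projectivization.mk ℂ F₀ hF₀ := by
  have hlim := tendsto_weightZeroPart h h₀
  set γ : ℝ → G := fun s => tor (expUnit (p * s)) (expUnit (q * s)) with hγ
  have h1 : Filter.Tendsto (fun s => toXX ⟨γ s • F, smul_ne_zero_of _ hF⟩) Filter.atTop
      (nhds (toXX ⟨F₀, hF₀⟩)) :=
    (continuous_toXX.tendsto _).comp (tendsto_subtype_rng.2 hlim)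
  have hmem : ∀ s, toXX ⟨γ s • F, smul_ne_zero_of _ hF⟩ ∈ semistable := fun s =>
    (mk_mem_semistable _).2 ((isSemistableForm_group_smul_iff _ _).2 hss)
  have hmem₀ : toXX ⟨F₀, hF₀⟩ ∈ semistable := (mk_mem_semistable _).2 (hss.weightZeroPart h h₀)
  have h2 : Filter.Tendsto (fun s => (⟨_, hmem s⟩ : semistable)) Filter.atTop
      (nhds ⟨toXX ⟨F₀, hF₀⟩, hmem₀⟩) := tendsto_subtype_rng.2 h1
  exact hcl.mem_of_tendsto h2 (Filter.Eventually.of_forall fun s =>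
    ⟨γ s, Projectivization.smul_mk _ _⟩)

/-- A semistable form that is an eigenvector of a pair of upper triangular nilpotent matrices, not
both zero, is annihilated by the pair, and both matrices are nonzero. Then the diagonal torus
contracts the form to its part with exponents `i + j = 3`, and the limit is a D-curve. -/
theorem meetsCurves_of_nilpotent {β β' k : ℂ} (hβ : β ≠ 0 ∨ β' ≠ 0) {F : V} (hF : F ≠ 0)
    (hss : IsSemistableForm F)
    (hcl : IsClosed {y : semistable | (y : XX) ∈ MulAction.orbit G (Projectivization.mk ℂ F hF)})
    (h : ∀ i j, lieCf 0 β 0 0 β' 0 (cf F) i j = k * cf F i j) :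
    MeetsCurves (Projectivization.mk ℂ F hF) := by
  have e : ∀ i j, ![1 * β * cf F 1 j, 2 * β * cf F 2 j, 3 * β * cf F 3 j, 0] i +
      ![1 * β' * cf F i 1, 2 * β' * cf F i 2, 3 * β' * cf F i 3, 0] j = k * cf F i j := by
    intro i j
    have h1 := h i j
    simp only [lieCf] at h1
    fin_cases i <;> fin_cases j <;>
        simp [-mul_eq_zero, -zero_eq_mul, -mul_eq_mul_right_iff] at h1 ⊢ <;>
      linear_combination h1
  have hk : k = 0 := by
    by_contra hk
    have e33 := e 3 3
    simp [hk] at e33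
    have e32 := e 3 2
    have e23 := e 2 3
    simp [hk, e33] at e32 e23
    have e31 := e 3 1
    have e22 := e 2 2
    have e13 := e 1 3
    simp [hk, e32, e23] at e31 e22 e13
    have e30 := e 3 0
    have e21 := e 2 1
    have e12 := e 1 2
    have e03 := e 0 3
    simp [hk, e31, e22, e13] at e30 e21 e12 e03
    have e20 := e 2 0
    have e11 := e 1 1
    have e02 := e 0 2
    simp [hk, e30, e21, e12, e03] at e20 e11 e02
    have e10 := e 1 0
    have e01 := e 0 1
    simp [hk, e20, e11, e02] at e10 e01
    have e00 := e 0 0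
    simp [hk, e10, e01] at e00
    apply hF
    apply ext_cf
    intro i j
    rw [cf_zero]
    fin_cases i <;> fin_cases j <;> assumption
  subst hk
  by_cases hβ0 : β = 0
  · have hβ' : β' ≠ 0 := hβ.resolve_left (not_not.2 hβ0)
    refine absurd hss (not_isSemistableForm_of_wt_pos 0 (-1) fun i j hij => ?_)
    have h0 := e i 0
    have h1 := e i 1
    have h2 := e i 2
    fin_cases i <;> simp [hβ0, hβ'] at h0 h1 h2 <;> fin_cases j <;>
      first | exact absurd (by assumption) hij | (norm_num [wt])
  by_cases hβ'0 : β' = 0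
  · refine absurd hss (not_isSemistableForm_of_wt_pos (-1) 0 fun i j hij => ?_)
    have h0 := e 0 j
    have h1 := e 1 j
    have h2 := e 2 j
    fin_cases j <;> simp [hβ'0, hβ0] at h0 h1 h2 <;> fin_cases i <;>
      first | exact absurd (by assumption) hij | (norm_num [wt])
  -- the coefficients with `i + j > 3` vanish
  have e30 := e 3 0
  have e31 := e 3 1
  have e32 := e 3 2
  have e03 := e 0 3
  have e13 := e 1 3
  have e23 := e 2 3
  simp [hβ0, hβ'0] at e30 e31 e32 e03 e13 e23
  have e21 := e 2 1
  simp [hβ'0, e30] at e21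
  have hle : ∀ i j, cf F i j ≠ 0 → (i : ℕ) + j ≤ 3 := by
    intro i j hij
    fin_cases i <;> fin_cases j <;>
      first | exact absurd (by assumption) hij | norm_num
  have hwt : ∀ i j : Fin 4, wt (-1) (-1) i j = 2 * (3 - (((i : ℕ) + j : ℕ) : ℝ)) := by
    intro i j
    rw [wt]
    push_cast
    ring
  have hpos : ∀ i j, cf F i j ≠ 0 → 0 ≤ wt (-1) (-1) i j := by
    intro i j hij
    have h1 : (((i : ℕ) + j : ℕ) : ℝ) ≤ 3 := by exact_mod_cast hle i j hij
    rw [hwt]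
    linarith
  have hzero : ∀ i j, cf (dForm (cf F 3 0) (cf F 2 1) (cf F 1 2) (cf F 0 3)) i j =
      if wt (-1) (-1) i j = 0 then cf F i j else 0 := by
    intro i j
    rw [cf_dForm]
    fin_cases i <;> fin_cases j <;> norm_num [wt] <;> rfl
  have hss₀ := hss.weightZeroPart hpos hzero
  obtain ⟨g, hg⟩ := mk_mem_orbit_of_weightZeroPart hF hss hcl hpos hzero hss₀.ne_zero
  refine ⟨g, Or.inl ?_⟩
  rw [hg]
  exact (mem_curvesD_iff _).2 (dForm_of_isSemistableForm hss₀)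

theorem orbit_smul_eq (g : G) (x : XX) : MulAction.orbit G (g • x) = MulAction.orbit G x :=
  MulAction.orbit_eq_iff.2 ⟨g, rfl⟩

/-- Every strictly polystable point is in the orbit of a D-curve or of an A-curve. -/
theorem IsStrictlyPolystable.meetsCurves {x : XX} (hx : IsStrictlyPolystable x) :
    MeetsCurves x := by
  obtain ⟨hxss, hcl, hinf⟩ := hx
  induction x using Projectivization.ind with
  | h F hF =>
    have hss := (mk_mem_semistable hF).1 hxss
    obtain ⟨P, Q, hP, hQ, hne, hPQ⟩ := exists_isInfStab_of_infinite hF hinf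
    obtain ⟨A, α, β, hA, hαβ⟩ := exists_sl_conj_normal_form hP
    obtain ⟨B, α', β', hB, hαβ'⟩ := exists_sl_conj_normal_form hQ
    have h1 := hPQ.smul (pair A B)
    rw [pair_inv, toGL_pair, toGL_pair, fromBlocks_multiply, fromBlocks_multiply] at h1
    simp only [mul_zero, zero_mul, add_zero, zero_add, hA, hB] at h1
    obtain ⟨k, hk⟩ := h1.lieCf_eq
    have hconj : ∀ (A : SL(2, ℂ)) (P : Matrix (Fin 2) (Fin 2) ℂ),
        A.1 * P * (A⁻¹).1 = 0 → P = 0 := by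
      intro A P h
      have h2 : (A⁻¹).1 * A.1 = 1 := by rw [← sl_mul, inv_mul_cancel]; rfl
      calc P = ((A⁻¹).1 * A.1) * P * ((A⁻¹).1 * A.1) := by rw [h2, one_mul, mul_one]
        _ = (A⁻¹).1 * (A.1 * P * (A⁻¹).1) * A.1 := by simp only [Matrix.mul_assoc]
        _ = 0 := by rw [h, mul_zero, zero_mul]
    have hne' : (α ≠ 0 ∨ β ≠ 0) ∨ (α' ≠ 0 ∨ β' ≠ 0) := by
      by_contra hcon
      push Not at hcon
      obtain ⟨⟨rfl, rfl⟩, rfl, rfl⟩ := hcon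
      have hz : (!![0, 0; 0, -0] : Matrix (Fin 2) (Fin 2) ℂ) = 0 := by
        ext i j
        fin_cases i <;> fin_cases j <;> simp
      rw [hz] at hA hB
      exact hne.elim (fun h => h (hconj A P hA)) (fun h => h (hconj B Q hB))
    apply MeetsCurves.of_smul (g := pair A B)
    rw [← orbit_smul_eq (pair A B)] at hcl
    rw [Projectivization.smul_mk] at hcl ⊢
    have hss' : IsSemistableForm (pair A B • F) := (isSemistableForm_group_smul_iff _ _).2 hss
    generalize_proofs hF' at hcl ⊢
    generalize pair A B • F = E at *
    by_cases hα : α = 0 <;> by_cases hα' : α' = 0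
    · subst hα hα'
      exact meetsCurves_of_nilpotent (β := β) (β' := β') (by tauto) hF' hss' hcl hk
    · obtain rfl := hαβ'.resolve_left hα'
      subst hα
      refine absurd ((isSemistableForm_group_smul_iff sw E).2 hss')
        (not_isSemistableForm_of_diag_nilpotent (β := β) hα' (k := k) fun i j => ?_)
      rw [cf_sw_smul, ← hk j i]
      simp only [lieCf, cf_sw_smul]
      ring
    · obtain rfl := hαβ.resolve_left hα
      subst hα'
      exact absurd hss' (not_isSemistableForm_of_diag_nilpotent hα hk)
    · obtain rfl := hαβ.resolve_left hα
      obtain rfl := hαβ'.resolve_left hα'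
      refine meetsCurves_of_diagonal (α' := α') (Or.inl hα) hF' hss' (k := k) fun i j hij => ?_
      have h2 := hk i j
      apply mul_right_cancel₀ hij
      rw [← h2, lieCf]
      fin_cases i <;> fin_cases j <;> simp

/-! ### Identity components of the stabilisers, up to conjugation -/

theorem identityComponent_of_mem_curvesD {x : XX} (hx : x ∈ curvesD) :
    ∃ g : G, conjSubgroup g (identityComponent (MulAction.stabilizer G x)) = RC ∨
      conjSubgroup g (identityComponent (MulAction.stabilizer G x)) = RD := by
  obtain ⟨a, b, c, d, h, rfl, hab, hcd⟩ := exists_of_mem_curvesD hx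
  by_cases hcube : ∃ r, r ≠ 0 ∧ b = -3 * r * a ∧ c = 3 * r ^ 2 * a ∧ d = -r ^ 3 * a
  · obtain ⟨g, hg⟩ := exists_smul_eq_tripleConic h hcube
    refine ⟨g, Or.inl ?_⟩
    rw [← identityComponent_stabilizer_smul, hg, identityComponent_stabilizer_tripleConic]
  · refine ⟨1, Or.inr ?_⟩
    rw [conjSubgroup_one, identityComponent_stabilizer_dForm h hab hcd hcube]

theorem identityComponent_of_mem_curvesA {x : XX} (hx : x ∈ curvesA) :
    identityComponent (MulAction.stabilizer G x) = RA := by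
  obtain ⟨a, b, h, rfl, ha, hb⟩ := exists_of_mem_curvesA hx
  exact identityComponent_stabilizer_aForm h ha hb

theorem exists_conjSubgroup_eq {R : Subgroup G} (hR : R ∈ polystableStabilisers) :
    ∃ g : G, conjSubgroup g R = RC ∨ conjSubgroup g R = RD ∨ conjSubgroup g R = RA := by
  obtain ⟨x, hx, rfl⟩ := hR
  obtain ⟨g, hg | hg⟩ := hx.meetsCurves
  · obtain ⟨g', h⟩ := identityComponent_of_mem_curvesD hg
    rw [identityComponent_stabilizer_smul, ← conjSubgroup_mul] at h
    exact ⟨g' * g, h.imp_right Or.inl⟩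
  · have h := identityComponent_of_mem_curvesA hg
    rw [identityComponent_stabilizer_smul] at h
    exact ⟨g, Or.inr (Or.inr h)⟩

/-! ### The three groups are pairwise not conjugate -/

/-- The elements of `H` commute with each other. -/
def IsComm (H : Subgroup G) : Prop := ∀ a ∈ H, ∀ b ∈ H, a * b = b * a

/-- The two components of each element of `H ∩ G⁰` have the same trace. -/
def HasEqualTraces (H : Subgroup G) : Prop :=
  ∀ A B : SL(2, ℂ), pair A B ∈ H → A.1.trace = B.1.trace

theorem IsComm.conjSubgroup {H : Subgroup G} (h : IsComm H) (g : G) :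
    IsComm (conjSubgroup g H) := by
  intro a ha b hb
  rw [mem_conjSubgroup] at ha hb
  have h1 := h _ ha _ hb
  have h2 := congrArg (fun x => g * x * g⁻¹) h1
  simpa only [mul_assoc, mul_inv_cancel_left, mul_inv_cancel, mul_one] using h2

theorem trace_conj (A C : SL(2, ℂ)) : (C⁻¹ * A * C).1.trace = A.1.trace := by
  have h : C.1 * (C⁻¹).1 = 1 := by rw [← sl_mul, mul_inv_cancel]; rfl
  rw [sl_mul, sl_mul, trace_mul_comm, ← Matrix.mul_assoc, h, one_mul]

theorem HasEqualTraces.conjSubgroup {H : Subgroup G} (h : HasEqualTraces H) (g : G) :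
    HasEqualTraces (conjSubgroup g H) := by
  intro A B hAB
  rw [mem_conjSubgroup] at hAB
  obtain ⟨C, D, rfl | rfl⟩ := eq_pair_or g
  · rw [pair_inv, pair_mul, pair_mul] at hAB
    simpa only [trace_conj] using h _ _ hAB
  · have h1 : (pair C D * sw)⁻¹ * pair A B * (pair C D * sw) =
        pair (D⁻¹ * B * D) (C⁻¹ * A * C) := by
      rw [_root_.mul_inv_rev, sw_inv, pair_inv]
      calc sw * pair C⁻¹ D⁻¹ * pair A B * (pair C D * sw)
          = sw * (pair C⁻¹ D⁻¹ * pair A B * pair C D) * sw := by simp only [mul_assoc]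
        _ = _ := by rw [pair_mul, pair_mul, sw_mul_pair, mul_assoc, sw_mul_sw, mul_one]
    rw [h1] at hAB
    simpa only [trace_conj] using (h _ _ hAB).symm

theorem isComm_range_torusHom (k : ℕ) : IsComm (torusHom k).range := by
  rintro _ ⟨s, rfl⟩ _ ⟨t, rfl⟩
  rw [← map_mul, ← map_mul, mul_comm]

theorem not_isComm_RC : ¬ IsComm RC := by
  intro h
  have h1 := h _ ⟨upper 1, rfl⟩ _ ⟨lower 1, rfl⟩
  rw [← map_mul, ← map_mul] at h1
  have h2 := congrArg Subtype.val (diagonalHom_injective h1)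
  rw [sl_mul, sl_mul, upper, lower] at h2
  simpa [mul_apply, Fin.sum_univ_two] using congrFun (congrFun h2 0) 0

theorem hasEqualTraces_RC : HasEqualTraces RC := by
  rintro A B ⟨C, hC⟩
  obtain ⟨rfl, rfl⟩ := pair_injective hC
  rfl

theorem not_hasEqualTraces_RA : ¬ HasEqualTraces RA := by
  intro h
  have h1 := h _ _ ⟨Units.mk0 2 two_ne_zero, torusHom_apply 3 _⟩
  rw [diagSL_val, diagSL_val, trace_fin_two, trace_fin_two] at h1
  norm_num at h1

theorem hasEqualTraces_RD : HasEqualTraces RD := fun A B h => hasEqualTraces_RC A B (RD_le_RC h)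

theorem conjSubgroup_RC_ne_range_torusHom (g : G) (k : ℕ) :
    conjSubgroup g RC ≠ (torusHom k).range := by
  intro h
  have h1 := (isComm_range_torusHom k).conjSubgroup g⁻¹
  rw [← h, conjSubgroup_inv_conjSubgroup] at h1
  exact not_isComm_RC h1

theorem conjSubgroup_RC_ne_RA (g : G) : conjSubgroup g RC ≠ RA :=
  conjSubgroup_RC_ne_range_torusHom g 3

theorem conjSubgroup_RC_ne_RD (g : G) : conjSubgroup g RC ≠ RD :=
  conjSubgroup_RC_ne_range_torusHom g 1

theorem conjSubgroup_RD_ne_RA (g : G) : conjSubgroup g RD ≠ RA := fun h =>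
  not_hasEqualTraces_RA (h ▸ hasEqualTraces_RD.conjSubgroup g)

theorem conjSubgroup_symm {g : G} {H K : Subgroup G} (h : conjSubgroup g H = K) :
    conjSubgroup g⁻¹ K = H := by
  rw [← h, conjSubgroup_inv_conjSubgroup]

theorem eq_of_conjSubgroup_eq {g : G} {H K : Subgroup G} (hH : H ∈ ({RC, RD, RA} : Set (Subgroup G)))
    (hK : K ∈ ({RC, RD, RA} : Set (Subgroup G))) (h : conjSubgroup g H = K) : H = K := by
  rcases hH with rfl | rfl | rfl <;> rcases hK with rfl | rfl | rfl
  · rfl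
  · exact absurd h (conjSubgroup_RC_ne_RD g)
  · exact absurd h (conjSubgroup_RC_ne_RA g)
  · exact absurd (conjSubgroup_symm h) (conjSubgroup_RC_ne_RD g⁻¹)
  · rfl
  · exact absurd h (conjSubgroup_RD_ne_RA g)
  · exact absurd (conjSubgroup_symm h) (conjSubgroup_RC_ne_RA g⁻¹)
  · exact absurd (conjSubgroup_symm h) (conjSubgroup_RD_ne_RA g⁻¹)
  · rfl

theorem isIndexingSet : IsIndexingSet {RC, RD, RA} := by
  refine ⟨?_, fun R hR => ?_⟩
  · rintro _ (rfl | rfl | rfl)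
    · exact RC_mem_polystableStabilisers
    · exact RD_mem_polystableStabilisers
    · exact RA_mem_polystableStabilisers
  · obtain ⟨g, hg⟩ := exists_conjSubgroup_eq hR
    refine ⟨conjSubgroup g R, ⟨hg, g, rfl⟩, ?_⟩
    rintro R' ⟨hR', g', hg'⟩
    refine eq_of_conjSubgroup_eq (g := g * g'⁻¹) hR' hg ?_
    rw [conjSubgroup_mul, conjSubgroup_symm hg']

theorem RC_ne_RD : RC ≠ RD := by
  have h := conjSubgroup_RC_ne_RD 1
  rwa [conjSubgroup_one] at h

theorem RC_ne_RA : RC ≠ RA := by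
  have h := conjSubgroup_RC_ne_RA 1
  rwa [conjSubgroup_one] at h

theorem RD_ne_RA : RD ≠ RA := by
  have h := conjSubgroup_RD_ne_RA 1
  rwa [conjSubgroup_one] at h

theorem ncard_three_groups : ({RC, RD, RA} : Set (Subgroup G)).ncard = 3 :=
  Set.ncard_eq_three.2 ⟨_, _, _, RC_ne_RD, RC_ne_RA, RD_ne_RA, rfl⟩

theorem diagSL_neg_one : diagSL (-1) = -1 := by
  apply Subtype.ext
  ext i j
  fin_cases i <;> fin_cases j <;> simp [diagSL_val]

theorem RA_inf_RC :
    ((RA ⊓ RC : Subgroup G) : Set G) = {1, SemidirectProduct.inl (-1, -1)} := by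
  ext g
  constructor
  · rintro ⟨⟨t, rfl⟩, A, hA⟩
    rw [torusHom_apply] at hA
    obtain ⟨h1, h2⟩ := pair_injective hA
    have h3 : t = t ^ 3 := diagSL_injective (h1.symm.trans h2)
    have h4 : (t : ℂ) = (t : ℂ) ^ 3 := by exact_mod_cast congrArg Units.val h3
    have h5 : ((t : ℂ) - 1) * ((t : ℂ) + 1) = 0 := by
      apply mul_left_cancel₀ t.ne_zero
      linear_combination -h4
    rcases mul_eq_zero.1 h5 with h6 | h6
    · left
      have : t = 1 := Units.ext (by simpa using sub_eq_zero.1 h6)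
      rw [this, map_one]
    · right
      have ht : t = -1 := Units.ext (by simpa using eq_neg_of_add_eq_zero_left h6)
      rw [torusHom_apply, ht, tor, Odd.neg_one_pow (by decide), diagSL_neg_one]
      rfl
  · rintro (rfl | rfl)
    · exact one_mem _
    · refine ⟨⟨-1, ?_⟩, -1, rfl⟩
      rw [torusHom_apply, tor, Odd.neg_one_pow (by decide), diagSL_neg_one]
      rfl

/-! ### The saturations of the fixed loci -/

theorem saturation_RC_ssubset_saturation_RD :
    saturation (ssFixedLocus RC) ⊂ saturation (ssFixedLocus RD) := by
  rw [ssFixedLocus_RC, ssFixedLocus_RD]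
  refine ⟨?_, fun hsub => ?_⟩
  · rintro x ⟨g, z, rfl, rfl⟩
    exact ⟨g, _, tripleConic_mem_curvesD, rfl⟩
  · have hss : IsSemistableForm (dForm 1 0 0 1) :=
      isSemistableForm_dForm (Or.inl one_ne_zero) (Or.inr one_ne_zero)
    have hne := hss.ne_zero
    have hmem : Projectivization.mk ℂ _ hne ∈ curvesD :=
      (mem_curvesD_iff hne).2 ⟨Or.inl one_ne_zero, Or.inr one_ne_zero⟩
    obtain ⟨g, z, rfl, hz⟩ := hsub ⟨1, _, hmem, (one_smul G _).symm⟩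
    have h1 := identityComponent_stabilizer_dForm hne (Or.inl one_ne_zero) (Or.inr one_ne_zero) (by
      rintro ⟨r, hr, h1, -⟩
      simp [hr] at h1)
    rw [hz, identityComponent_stabilizer_smul, identityComponent_stabilizer_tripleConic] at h1
    exact conjSubgroup_RC_ne_RD g h1

theorem saturation_RA_inter_saturation_RD :
    saturation (ssFixedLocus RA) ∩ saturation (ssFixedLocus RD) = ∅ := by
  rw [ssFixedLocus_RA, ssFixedLocus_RD, Set.eq_empty_iff_forall_notMem]
  rintro x ⟨⟨g, a, ha, rfl⟩, h, d, hd, hx⟩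
  have had : a = (g⁻¹ * h) • d := by rw [mul_smul, ← hx, inv_smul_smul]
  have h1 := identityComponent_of_mem_curvesA ha
  rw [had, identityComponent_stabilizer_smul] at h1
  obtain ⟨g', h2 | h2⟩ := identityComponent_of_mem_curvesD hd
  · rw [← conjSubgroup_symm h2, ← conjSubgroup_mul] at h1
    exact conjSubgroup_RC_ne_RA _ h1
  · rw [← conjSubgroup_symm h2, ← conjSubgroup_mul] at h1
    exact conjSubgroup_RD_ne_RA _ h1

/-! ### Maximal tori -/

theorem isTorus_range_torusHom (k : ℕ) : IsTorus (torusHom k).range := by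
  refine ⟨1, (torusHom k).comp (Pi.evalMonoidHom (fun _ : Fin 1 => ℂˣ) 0), ?_, ?_, ?_⟩
  · intro s t h
    have h1 := torusHom_injective k h
    funext i
    rw [Subsingleton.elim i 0]
    exact h1
  · ext g
    constructor
    · rintro ⟨t, rfl⟩
      exact ⟨t 0, rfl⟩
    · rintro ⟨t, rfl⟩
      exact ⟨fun _ => t, rfl⟩
  · intro i j
    refine ⟨fromBlocks !![X (Sum.inl 0), 0; 0, X (Sum.inr 0)] 0 0
      !![X (Sum.inl 0) ^ k, 0; 0, X (Sum.inr 0) ^ k] i j, fun t => ?_⟩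
    change (toGL (pair (diagSL (t 0)) (diagSL (t 0 ^ k))) : Matrix Idx Idx ℂ) i j = _
    rw [toGL_pair, diagSL_val, diagSL_val]
    rcases i with i | i <;> rcases j with j | j <;> fin_cases i <;> fin_cases j <;> simp

theorem IsTorus.conjSubgroup {S : Subgroup G} (h : IsTorus S) (g : G) :
    IsTorus (conjSubgroup g S) := by
  obtain ⟨n, φ, hinj, rfl, hpoly⟩ := h
  choose p hp using hpoly
  refine ⟨n, (MulAut.conj g).toMonoidHom.comp φ, (MulAut.conj g).injective.comp hinj,
    MonoidHom.range_comp _ _, fun i j => ?_⟩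
  refine ⟨∑ b, (∑ a, C ((toGL g : Matrix Idx Idx ℂ) i a) * p a b) *
    C ((toGL g⁻¹ : Matrix Idx Idx ℂ) b j), fun t => ?_⟩
  change (toGL (g * φ t * g⁻¹) : Matrix Idx Idx ℂ) i j = _
  rw [map_mul, map_mul, Units.val_mul, Units.val_mul]
  simp only [mul_apply, map_sum, map_mul, eval_C, hp]

theorem IsMaximalTorus.conjSubgroup {R T : Subgroup G} (h : IsMaximalTorus R T) (g : G) :
    IsMaximalTorus (conjSubgroup g R) (conjSubgroup g T) := by
  refine ⟨⟨h.1.1.conjSubgroup g, conjSubgroup_mono g h.1.2⟩, ?_⟩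
  rintro S ⟨hS, hSR⟩ hTS
  have h1 := conjSubgroup_mono g⁻¹ hSR
  have h2 := conjSubgroup_mono g⁻¹ hTS
  rw [conjSubgroup_inv_conjSubgroup] at h1 h2
  have h3 := conjSubgroup_mono g (h.2 ⟨hS.conjSubgroup g⁻¹, h1⟩ h2)
  rwa [← conjSubgroup_mul, mul_inv_cancel, conjSubgroup_one] at h3

theorem isMaximalTorus_self {T : Subgroup G} (h : IsTorus T) : IsMaximalTorus T T :=
  ⟨⟨h, le_rfl⟩, fun _ hS _ => hS.2⟩

theorem IsMaximalTorus.eq_self {R T : Subgroup G} (hR : IsTorus R) (h : IsMaximalTorus R T) :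
    T = R := le_antisymm h.1.2 (h.2 ⟨hR, le_rfl⟩ h.1.2)

theorem IsTorus.isComm {T : Subgroup G} (h : IsTorus T) : IsComm T := by
  obtain ⟨n, φ, -, rfl, -⟩ := h
  rintro _ ⟨s, rfl⟩ _ ⟨t, rfl⟩
  rw [← map_mul, ← map_mul, mul_comm]

/-- The centraliser of a regular diagonal matrix is diagonal. -/
theorem exists_diagSL_of_commute {B : SL(2, ℂ)} {u : ℂˣ} (hu : (u : ℂ) ≠ (u : ℂ)⁻¹)
    (h : B * diagSL u = diagSL u * B) : ∃ s, B = diagSL s := by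
  have h1 := congrArg Subtype.val h
  rw [sl_mul, sl_mul, diagSL_val] at h1
  have h2 := congrFun (congrFun h1 0) 1
  have h3 := congrFun (congrFun h1 1) 0
  simp [mul_apply, Fin.sum_univ_two] at h2 h3
  have h4 : (u : ℂ) - (u : ℂ)⁻¹ ≠ 0 := sub_ne_zero.2 hu
  refine exists_diagSL ?_ ?_
  · apply mul_left_cancel₀ h4
    linear_combination -h2
  · apply mul_left_cancel₀ h4
    linear_combination h3

/-- Elements of order three in `SL₂` are regular semisimple. -/
theorem exists_conj_eq_diagSL {A : SL(2, ℂ)} (h3 : A ^ 3 = 1) (h1 : A ≠ 1) :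
    ∃ (C : SL(2, ℂ)) (u : ℂˣ), C * A * C⁻¹ = diagSL u ∧ (u : ℂ) ≠ (u : ℂ)⁻¹ := by
  set s := A.1.trace / 2 with hs
  have htr : (A.1 - s • (1 : Matrix (Fin 2) (Fin 2) ℂ)).trace = 0 := by
    rw [trace_sub, trace_smul, trace_one, Fintype.card_fin, hs, smul_eq_mul]
    push_cast
    ring
  obtain ⟨C, α, β, hC, hαβ⟩ := exists_sl_conj_normal_form htr
  have hCC : C.1 * (C⁻¹).1 = 1 := by rw [← sl_mul, mul_inv_cancel]; rfl
  have hB : (C * A * C⁻¹).1 = !![s + α, β; 0, s - α] := by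
    rw [Matrix.mul_sub, Matrix.sub_mul, Matrix.mul_smul, Matrix.smul_mul, mul_one, hCC,
      sub_eq_iff_eq_add] at hC
    rw [sl_mul, sl_mul, hC]
    ext i j
    fin_cases i <;> fin_cases j <;> simp
    · ring
    · ring
  have hB3 : (C * A * C⁻¹) ^ 3 = 1 := by
    rw [conj_pow, h3, mul_one, mul_inv_cancel]
  have hB1 : C * A * C⁻¹ ≠ 1 := fun h => h1 (by
    rw [mul_inv_eq_one] at h
    exact mul_eq_left.1 h)
  refine ⟨C, ?_⟩
  generalize C * A * C⁻¹ = B at *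
  have hdet := sl_det B
  have hcube := congrArg Subtype.val hB3
  rw [pow_three, sl_mul, sl_mul, sl_one, hB] at hcube
  rw [hB] at hdet
  have e00 := congrFun (congrFun hcube 0) 0
  have e01 := congrFun (congrFun hcube 0) 1
  simp [mul_apply, Fin.sum_univ_two] at e00 e01 hdet
  by_cases hα : α = 0
  · -- a unipotent or scalar matrix of determinant one and order three is trivial
    exfalso
    subst hα
    have hs1 : s = 1 := by linear_combination e00 - s * hdet
    have hβ : β = 0 := by
      rw [hs1] at e01
      linear_combination e01 / 3
    apply hB1
    apply Subtype.ext
    rw [hB, hs1, hβ, sl_one]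
    ext i j
    fin_cases i <;> fin_cases j <;> simp
  · obtain rfl := hαβ.resolve_left hα
    have hu : s + α ≠ 0 := left_ne_zero_of_mul_eq_one hdet
    have hinv : (s + α)⁻¹ = s - α := inv_eq_of_mul_eq_one_right hdet
    refine ⟨Units.mk0 (s + α) hu, Subtype.ext ?_, ?_⟩
    · rw [hB, diagSL_val, Units.val_inv_eq_inv_val, Units.val_mk0, hinv]
    · rw [Units.val_mk0, hinv]
      intro h
      exact hα (by linear_combination h / 2)

/-- The torus is commutative, so it centralises its elements of order three. These are regular, and a
conjugation that diagonalises one of them diagonalises the torus. -/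
theorem exists_conjSubgroup_le_RD {T : Subgroup G} (hT : IsTorus T) (hle : T ≤ RC) :
    ∃ h ∈ RC, conjSubgroup h T ≤ RD := by
  have hcomm := hT.isComm
  obtain ⟨n, φ, hinj, rfl, -⟩ := hT
  rcases Nat.eq_zero_or_pos n with rfl | hn
  · refine ⟨1, one_mem _, ?_⟩
    rw [conjSubgroup_one]
    rintro _ ⟨t, rfl⟩
    rw [Subsingleton.elim t 1, map_one]
    exact one_mem _
  · -- an element of order three of the torus
    have hω := Complex.isPrimitiveRoot_exp 3 (by norm_num)
    obtain ⟨ω, hω3, hω1⟩ : ∃ ω : ℂˣ, ω ^ 3 = 1 ∧ ω ≠ 1 := by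
      have h0 := hω.ne_zero (by norm_num)
      refine ⟨Units.mk0 _ h0, Units.ext (by simpa using hω.pow_eq_one), fun h => ?_⟩
      exact hω.ne_one (by norm_num) (by simpa using congrArg Units.val h)
    obtain ⟨A, hA⟩ := hle ⟨fun _ => ω, rfl⟩
    have hA3 : A ^ 3 = 1 := by
      apply diagonalHom_injective
      rw [map_pow, hA, ← map_pow, map_one, ← map_one φ]
      congr 1
      funext i
      exact hω3
    have hA1 : A ≠ 1 := by
      rintro rfl
      rw [map_one, ← map_one φ] at hA
      exact hω1 (congrFun (hinj hA) ⟨0, hn⟩).symm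
    obtain ⟨C, u, hC, hu⟩ := exists_conj_eq_diagSL hA3 hA1
    refine ⟨diagonalHom C, ⟨C, rfl⟩, ?_⟩
    rintro _ ⟨_, ⟨t, rfl⟩, rfl⟩
    obtain ⟨B, hB⟩ := hle ⟨t, rfl⟩
    have h1 : B * A = A * B := by
      apply diagonalHom_injective
      rw [map_mul, map_mul, hA, hB]
      exact hcomm _ ⟨t, rfl⟩ _ ⟨_, rfl⟩
    have h2 : C * B * C⁻¹ * diagSL u = diagSL u * (C * B * C⁻¹) := by
      rw [← hC]
      calc C * B * C⁻¹ * (C * A * C⁻¹) = C * (B * A) * C⁻¹ := by group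
        _ = C * (A * B) * C⁻¹ := by rw [h1]
        _ = C * A * C⁻¹ * (C * B * C⁻¹) := by group
    obtain ⟨s, hs⟩ := exists_diagSL_of_commute hu h2
    refine ⟨s, ?_⟩
    change torusHom 1 s = diagonalHom C * φ t * (diagonalHom C)⁻¹
    rw [← hB, ← map_inv, ← map_mul, ← map_mul, hs, torusHom_apply, pow_one]
    rfl

theorem isMaximalTorus_RC_RD : IsMaximalTorus RC RD := by
  refine ⟨⟨isTorus_range_torusHom 1, RD_le_RC⟩, ?_⟩
  rintro S ⟨hS, hSR⟩ hle g hg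
  obtain ⟨B, rfl⟩ := hSR hg
  have h1 := hS.isComm _ hg _ (hle ⟨Units.mk0 2 two_ne_zero, rfl⟩)
  rw [torusHom_apply, pow_one, tor, ← diagonalHom_apply, ← map_mul, ← map_mul] at h1
  obtain ⟨s, rfl⟩ := exists_diagSL_of_commute (by norm_num) (diagonalHom_injective h1)
  exact ⟨s, by rw [torusHom_apply, pow_one]; rfl⟩

theorem conjSubgroup_of_mem {g : G} {H : Subgroup G} (hg : g ∈ H) : conjSubgroup g H = H := by
  ext x
  rw [mem_conjSubgroup, mul_mem_cancel_right hg, mul_mem_cancel_left (inv_mem hg)]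

theorem IsMaximalTorus.exists_conjSubgroup_eq_RD {T : Subgroup G} (hT : IsMaximalTorus RC T) :
    ∃ h ∈ RC, _root_.BidegreeThree.conjSubgroup h T = RD := by
  obtain ⟨h, hh, hle⟩ := exists_conjSubgroup_le_RD hT.1.1 hT.1.2
  have h1 := hT.conjSubgroup h
  rw [conjSubgroup_of_mem hh] at h1
  exact ⟨h, hh, le_antisymm hle (h1.2 ⟨isTorus_range_torusHom 1, RD_le_RC⟩ hle)⟩

theorem maximal_tori {R : Subgroup G} (hR : R ∈ polystableStabilisers) :
    (∃ T : Subgroup G, IsMaximalTorus R T) ∧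
      ∀ T : Subgroup G, IsMaximalTorus R T → ∃ g : G,
        (conjSubgroup g T = RD ∧ ssFixedLocus (conjSubgroup g R) ⊆ spaceD) ∨
        (conjSubgroup g T = RA ∧ ssFixedLocus (conjSubgroup g R) ⊆ spaceA) := by
  obtain ⟨g, hg⟩ := exists_conjSubgroup_eq hR
  have hD : ssFixedLocus RD ⊆ spaceD := by
    rw [ssFixedLocus_RD]
    exact fun x hx => hx.1
  have hC : ssFixedLocus RC ⊆ spaceD := by
    rw [ssFixedLocus_RC, Set.singleton_subset_iff]
    exact tripleConic_mem_curvesD.1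
  have hA : ssFixedLocus RA ⊆ spaceA := by
    rw [ssFixedLocus_RA]
    exact fun x hx => hx.1
  constructor
  · obtain ⟨T, hT⟩ : ∃ T, IsMaximalTorus (conjSubgroup g R) T := by
      rcases hg with h | h | h <;> rw [h]
      · exact ⟨_, isMaximalTorus_RC_RD⟩
      · exact ⟨_, isMaximalTorus_self (isTorus_range_torusHom 1)⟩
      · exact ⟨_, isMaximalTorus_self (isTorus_range_torusHom 3)⟩
    have h1 := hT.conjSubgroup g⁻¹
    rw [conjSubgroup_inv_conjSubgroup] at h1
    exact ⟨_, h1⟩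
  · intro T hT
    have h1 := hT.conjSubgroup g
    rcases hg with h | h | h <;> rw [h] at h1
    · obtain ⟨k, hk, h2⟩ := h1.exists_conjSubgroup_eq_RD
      refine ⟨k * g, Or.inl ⟨by rw [conjSubgroup_mul, h2], ?_⟩⟩
      rw [conjSubgroup_mul, h, conjSubgroup_of_mem hk]
      exact hC
    · exact ⟨g, Or.inl ⟨h1.eq_self (isTorus_range_torusHom 1), by rwa [h]⟩⟩
    · exact ⟨g, Or.inr ⟨h1.eq_self (isTorus_range_torusHom 3), by rwa [h]⟩⟩

end

end BidegreeThree

theorem mainTheorem3 :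
    -- the indexing set consists of the three groups
    (IsIndexingSet {RC, RD, RA} ∧ ({RC, RD, RA} : Set (Subgroup G)).ncard = 3) ∧
    -- the groups are isomorphic to `SL(2, ℂ)`, `ℂˣ`, `ℂˣ`
    (Function.Injective diagonalHom ∧ Function.Injective (torusHom 1) ∧
      Function.Injective (torusHom 3)) ∧
    -- the fixed loci
    (fixedLocus RC = {tripleConic} ∧ ssFixedLocus RC = {tripleConic}) ∧
    ssFixedLocus RD = curvesD ∧
    ssFixedLocus RA = curvesA ∧
    -- relations between the groups and between the loci
    RD < RC ∧
    ((RA ⊓ RC : Subgroup G) : Set G) = {1, SemidirectProduct.inl (-1, -1)} ∧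
    saturation (ssFixedLocus RC) ⊂ saturation (ssFixedLocus RD) ∧
    saturation (ssFixedLocus RA) ∩ saturation (ssFixedLocus RD) = ∅ ∧
    -- the spanning monomials are independent, so that the two linear systems are `ℙ³` and `ℙ¹`
    (LinearIndependent ℂ monD ∧ LinearIndependent ℂ monA) ∧
    -- the maximal tori and the fixed loci up to conjugation
    (∀ R ∈ polystableStabilisers,
      (∃ T : Subgroup G, IsMaximalTorus R T) ∧
      ∀ T : Subgroup G, IsMaximalTorus R T → ∃ g : G,
        (conjSubgroup g T = RD ∧ ssFixedLocus (conjSubgroup g R) ⊆ spaceD) ∨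
        (conjSubgroup g T = RA ∧ ssFixedLocus (conjSubgroup g R) ⊆ spaceA)) := by
  exact ⟨⟨isIndexingSet, ncard_three_groups⟩,
    ⟨diagonalHom_injective, torusHom_injective 1, torusHom_injective 3⟩,
    ⟨fixedLocus_RC, ssFixedLocus_RC⟩, ssFixedLocus_RD, ssFixedLocus_RA,
    lt_of_le_of_ne RD_le_RC RC_ne_RD.symm, RA_inf_RC,
    saturation_RC_ssubset_saturation_RD, saturation_RA_inter_saturation_RD,
    ⟨linearIndependent_monD, linearIndependent_monA⟩, fun R hR => maximal_tori hR⟩
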